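/- Let $X$ be a real Hilbert space with norm $\|\cdot\|_X$, and let $\langle\cdot,\cdot\rangle_u$, $u\in X\setminus\{0\}$, be scalar products on $X$ with induced norms $\|\cdot\|_u$. Let $G$ be a topological group acting linearly on $X$, $(g,u)\mapsto g*u$. Assume: (M1) every $u\in X\setminus\{0\}$ has a neighborhood $U\subset X\setminus\{0\}$ and a constant $C>0$ with $\frac1C\|v\|_X\le\|v\|_{\tilde u}\le C\|v\|_X$ for all $\tilde u\in U$, $v\in X$; (M2) every $u\in X\setminus\{0\}$ has a neighborhood $U\subset X\setminus\{0\}$ and a constant $C>0$ with $|\langle v,w\rangle_{u_1}-\langle v,w\rangle_{u_2}|\le C\|u_1-u_2\|_X\|v\|_X\|w\|_X$ for all $u_1,u_2\in U$, $v,w\in X$; (M3) $\langle g*v,g*w\rangle_{g*u}=\langle v,w\rangle_u$ for all $u,v,w\in X\setminus\{0\}$, $g\in G$. Let $M\subset X\setminus\{0\}$ be a $C^{1,1}$ submanifold with $M=-M$ that is $G$-invariant, and let $\Phi\in C^{1,1}(M)$ be an even, $G$-invariant functional. For $u,v\in M$ let $d(u,v)\in[0,\infty]$ be the infimum of the lengths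 $\int_0^1\|\sigma'(s)\|_{\sigma(s)}\,ds$ over all curves $\sigma\in C^1([0,1],M)$ with $\sigma(0)=u$, $\sigma(1)=v$. For $w\in M$ let $N(w)=\inf\{\|u\|_u+d(u,w):u\in M\}$. For $u\in M$ let $\nabla_u\Phi(u)\in T_uM$ be the gradient of $\Phi$ at $u$ with respect to $\langle\cdot,\cdot\rangle_u$. Put $K=\{u\in M:\Phi'(u)=0\}$, and for $c\in\mathbb R$ put $K_c=\{u\in K:\Phi(u)=c\}$ and $\Phi^c=\{u\in M:\Phi(u)\le c\}$. Let $\gamma(Z)\in\mathbb N_0\cup\{\infty\}$ be the Krasnoselskii genus of a symmetric set $Z$: $\gamma(\varnothing)=0$, and for $Z\neq\varnothing$ it is the least $k\ge1$ such that there is an odd continuous map from $Z$ to the unit sphere of $\mathbb R^k$ ($\infty$ if there is none). Put $$c_k=\inf\{c\in\mathbb R:\gamma(\Phi^c)\ge k\}\in[-\infty,\infty],\qquad k\in\mathbb N .$$ Consider the conditions $(G_*)$ if $g_n*u\to v$ in $X$ for a sequence $(g_n)$ in $G$ and $u,v\in X$, then $g*u=v$ for some $g\in G$; $(NCG)_c$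 if $(u_n)\subset M$ satisfies $\Phi(u_n)\to c$ and $\|\nabla_{u_n}\Phi(u_n)\|_{u_n}(1+N(u_n))\to0$, then, after passing to a subsequence, there are $g_n\in G$ and $u\in M$ with $g_n*u_n\to u$ in $X$; $(I)_c$ $g*u\neq-u$ for all $u\in K_c$ and $g\in G$. **Theorem.** Suppose that $(G_*)$ holds and that there are $c_*\in\mathbb R$ and $c_\infty\in\mathbb R\cup\{+\infty\}$, $c_*<c_\infty$, such that (i) $(\Phi^{-1}([c_*,c]),d)$ is complete for all real $c<c_\infty$; (ii) $k_*:=\lim_{c\downarrow c_*}\gamma(\Phi^c)<\infty$; (iii) $\lim_{c\uparrow c_\infty}\gamma(\Phi^c)=\infty$; (iv) $(NCG)_c$ and $(I)_c$ hold for every $c\in[c_*,c_\infty)$. Then $c_*<c_k\le c_{k+1}<c_\infty$ for all $k>k_*$, $\lim_{k\to\infty}c_k=c_\infty$, and every $c_k$ with $k>k_*$ is a critical value of $\Phi$. Hence there is a sequence of pairwise distinct pairs $\{\pm u_k\}$ of critical points of $\Phi$ with $\Phi(u_k)\to c_\infty$. -/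

import Mathlib

open Set Filter Topology
open scoped ENNReal

namespace EquivariantLS

noncomputable section

variable {X : Type*} [NormedAddCommGroup X] [InnerProductSpace ℝ X]

/-! ### Submanifolds and functions of class `C^{1,1}` -/

/-- `f` is of class `C^{1,1}` on the (open) set `U`: it is differentiable and its derivative is
locally Lipschitz continuous. -/
def C11On {Y : Type*} [NormedAddCommGroup Y] [NormedSpace ℝ Y] (f : X → Y) (U : Set X) : Prop :=
  DifferentiableOn ℝ f U ∧ LocallyLipschitzOn U (fderiv ℝ f)

/-- `M` is an (embedded) `C^{1,1}` submanifold of `X`: around each of its points there is a local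
`C^{1,1}` diffeomorphism of `X` which straightens `M` to a closed linear subspace. -/
def IsC11Submanifold (M : Set X) : Prop :=
  ∀ u ∈ M, ∃ (e : OpenPartialHomeomorph X X) (E : Submodule ℝ X),
    u ∈ e.source ∧ C11On e e.source ∧ C11On e.symm e.target ∧
    IsClosed (E : Set X) ∧ e '' (e.source ∩ M) = e.target ∩ (E : Set X)

/-- `Φ ∈ C^{1,1}(M)`: near each point of `M`, the function `Φ` is the restriction to `M` of a
`C^{1,1}` function on an open subset of `X`. Only the values of `Φ` on `M` matter. -/
def IsC11OnManifold (M : Set X) (Φ : X → ℝ) : Prop :=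
  ∀ u ∈ M, ∃ (U : Set X) (F : X → ℝ), IsOpen U ∧ u ∈ U ∧ C11On F U ∧ EqOn F Φ (U ∩ M)

/-- The tangent space `T_u M`: velocities at `u` of curves in `M`. -/
def tangentSpaceAt (M : Set X) (u : X) : Set X :=
  {v | ∃ γ : ℝ → X, γ 0 = u ∧ HasDerivAt γ v 0 ∧ ∀ᶠ t in 𝓝 0, γ t ∈ M}

/-! ### The family of scalar products -/

/-- A scalar product on `X` (as a bilinear form that is symmetric and positive definite). -/
def IsScalarProduct (b : LinearMap.BilinForm ℝ X) : Prop :=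
  (∀ v w, b v w = b w v) ∧ ∀ v, v ≠ 0 → 0 < b v v

/-- The norm `‖v‖_u = √⟨v, v⟩_u` of a family `B u = ⟨·,·⟩_u`. -/
def normAt (B : X → LinearMap.BilinForm ℝ X) (u v : X) : ℝ :=
  Real.sqrt (B u v v)

/-- The norms `‖·‖_u`, `u ≠ 0`, are locally uniformly equivalent to the norm of `X`. -/
def LocallyUniformlyEquivalent (B : X → LinearMap.BilinForm ℝ X) : Prop :=
  ∀ u : X, u ≠ 0 → ∃ U ∈ 𝓝 u, U ⊆ {0}ᶜ ∧ ∃ C : ℝ, 0 < C ∧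
    ∀ u' ∈ U, ∀ v : X, 1 / C * ‖v‖ ≤ normAt B u' v ∧ normAt B u' v ≤ C * ‖v‖

/-- The scalar products depend locally Lipschitz continuously on `u ≠ 0`. -/
def LocallyLipschitzFamily (B : X → LinearMap.BilinForm ℝ X) : Prop :=
  ∀ u : X, u ≠ 0 → ∃ U ∈ 𝓝 u, U ⊆ {0}ᶜ ∧ ∃ C : ℝ, 0 < C ∧
    ∀ u₁ ∈ U, ∀ u₂ ∈ U, ∀ v w : X, |B u₁ v w - B u₂ v w| ≤ C * ‖u₁ - u₂‖ * ‖v‖ * ‖w‖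

/-! ### The distance on `M` induced by the family -/

/-- The length `∫₀¹ ‖γ'(s)‖_{γ(s)} ds` of a curve on `[0,1]`. -/
def curveLength (B : X → LinearMap.BilinForm ℝ X) (γ : ℝ → X) : ℝ≥0∞ :=
  ∫⁻ s in Icc (0 : ℝ) 1, ENNReal.ofReal (normAt B (γ s) (derivWithin γ (Icc 0 1) s))

/-- `d(u,v)`: infimum of the lengths of the `C^1` curves in `M` joining `u` to `v`
(`∞` if there is no such curve). -/
def mdist (M : Set X) (B : X → LinearMap.BilinForm ℝ X) (u v : X) : ℝ≥0∞ :=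
  ⨅ (γ : ℝ → X) (_ : ContDiffOn ℝ 1 γ (Icc 0 1) ∧ MapsTo γ (Icc 0 1) M ∧ γ 0 = u ∧ γ 1 = v),
    curveLength B γ

/-- The metric space `(S, d)`, for `S ⊆ M`, is complete. -/
def IsCompleteFor (M : Set X) (B : X → LinearMap.BilinForm ℝ X) (S : Set X) : Prop :=
  ∀ s : ℕ → X, (∀ n, s n ∈ S) →
    (∀ ε : ℝ≥0∞, 0 < ε → ∃ n₀, ∀ m ≥ n₀, ∀ n ≥ n₀, mdist M B (s m) (s n) < ε) →
    ∃ u ∈ S, Tendsto (fun n => mdist M B (s n) u) atTop (𝓝 0)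

/-- `N(w) = inf {‖u‖_u + d(u,w) : u ∈ M}`. -/
def Nfun (M : Set X) (B : X → LinearMap.BilinForm ℝ X) (w : X) : ℝ≥0∞ :=
  ⨅ u ∈ M, (ENNReal.ofReal (normAt B u u) + mdist M B u w)

/-! ### Critical points, gradients and the compactness condition -/

/-- The differential of `Φ` along `M` at `u`; only its values on `T_u M` are meaningful, and on
`T_u M` every derivative of `Φ` within `M` takes the same values. -/
def differential (M : Set X) (Φ : X → ℝ) (u : X) : X →L[ℝ] ℝ :=
  fderivWithin ℝ Φ M u

/-- The critical set `K`. -/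
def criticalSet (M : Set X) (Φ : X → ℝ) : Set X :=
  {u ∈ M | ∀ w ∈ tangentSpaceAt M u, differential M Φ u w = 0}

/-- The critical set `K_c` at the level `c`. -/
def criticalSetAt (M : Set X) (Φ : X → ℝ) (c : ℝ) : Set X :=
  {u ∈ criticalSet M Φ | Φ u = c}

/-- `p` is the gradient `∇_u Φ(u) ∈ T_u M` with respect to `⟨·,·⟩_u`. -/
def IsGradient (M : Set X) (B : X → LinearMap.BilinForm ℝ X) (Φ : X → ℝ) (u p : X) : Prop :=
  p ∈ tangentSpaceAt M u ∧ ∀ w ∈ tangentSpaceAt M u, differential M Φ u w = B u p w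

/-- `(u n)` is an `N`-Cerami sequence at the level `c` :
`Φ(u n) → c` and `‖∇_{u n} Φ(u n)‖_{u n} (1 + N(u n)) → 0`. -/
def IsNCeramiSeq (M : Set X) (B : X → LinearMap.BilinForm ℝ X) (Φ : X → ℝ) (c : ℝ)
    (u : ℕ → X) : Prop :=
  (∀ n, u n ∈ M) ∧ Tendsto (fun n => Φ (u n)) atTop (𝓝 c) ∧
    ∃ p : ℕ → X, (∀ n, IsGradient M B Φ (u n) (p n)) ∧
      Tendsto (fun n => ENNReal.ofReal (normAt B (u n) (p n)) * (1 + Nfun M B (u n)))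
        atTop (𝓝 0)

/-- The `N`-Cerami condition relative to `G` at the level `c` in `M`. -/
def NCeramiCondition (G : Type*) [SMul G X] (M : Set X) (B : X → LinearMap.BilinForm ℝ X)
    (Φ : X → ℝ) (c : ℝ) : Prop :=
  ∀ u : ℕ → X, IsNCeramiSeq M B Φ c u →
    ∃ (φ : ℕ → ℕ) (g : ℕ → G) (v : X), StrictMono φ ∧ v ∈ M ∧
      Tendsto (fun n => g n • u (φ n)) atTop (𝓝 v)

/-- Limits of sequences in an orbit belong to that orbit. -/
def SeqClosedOrbits (G X : Type*) [NormedAddCommGroup X] [SMul G X] : Prop :=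
  ∀ (g : ℕ → G) (u v : X), Tendsto (fun n => g n • u) atTop (𝓝 v) → ∃ h : G, h • u = v

/-! ### Genus and Ljusternik-Schnirelmann values -/

/-- The Krasnoselskii genus of a symmetric set `Z`: the least `k` such that there is an odd
continuous map from `Z` to the unit sphere of `ℝ^k`, and `∞` if there is none. As the unit sphere of
`ℝ^0` is empty, `k = 0` is admissible exactly when `Z = ∅`. -/
def genus (Z : Set X) : ℕ∞ :=
  ⨅ (k : ℕ) (_ : ∃ h : X → EuclideanSpace ℝ (Fin k), ContinuousOn h Z ∧
    MapsTo h Z (Metric.sphere 0 1) ∧ ∀ x ∈ Z, h (-x) = -h x), (k : ℕ∞)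

/-- The sublevel set `Φ^c = {u ∈ M : Φ(u) ≤ c}`. -/
def sublevel (M : Set X) (Φ : X → ℝ) (c : ℝ) : Set X :=
  {u ∈ M | Φ u ≤ c}

/-- `c_k = inf {c ∈ ℝ : γ(Φ^c) ≥ k} ∈ [-∞, ∞]`. -/
def lsValue (M : Set X) (Φ : X → ℝ) (k : ℕ) : EReal :=
  ⨅ (c : ℝ) (_ : (k : ℕ∞) ≤ genus (sublevel M Φ c)), (c : EReal)

end

end EquivariantLS

open EquivariantLS

/-!
The theorem follows from one fact about the levels `c` between `c_*` and `c_∞`: if `ε > 0` is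
small, the genus of `Φ^{c+ε}` exceeds that of `Φ^{c-ε}` at most by a finite number, and not at all
if `K_c = ∅`; this is `IsEquivariantSetting.exists_genus_sublevel_le`. Indeed, `c = c_k` means
that `γ(Φ^{c-ε}) < k ≤ γ(Φ^{c+ε})` for all `ε > 0`, so there are critical points at the level
`c_k`; and if the `c_k` converged to some `c < c_∞`, then `γ(Φ^{c+ε})` would be infinite and
`γ(Φ^{c-ε})` finite.

To prove this fact one needs a neighborhood of `K_c` of finite genus and an odd map that deforms
`Φ^{c+ε}` into the union of `Φ^{c-ε}` and that neighborhood; the genus is monotone for odd maps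
(`genus_le_of_odd_map`) and subadditive (`genus_le_add`).

*The neighborhood.* By the Cerami condition `K_c` is compact modulo `G`, and, as orbits are closed
and no orbit in `K_c` contains an antipodal pair, the orbits of `v` and of `-v` have a positive
distance for each `v ∈ K_c`. The differences of the truncated distances to these two orbits, for
finitely many `v`, are odd functions without common zero on a set `{ψ < r}`, where `ψ` is the
truncated distance from `K_c` (`IsEquivariantSetting.exists_cutoff`).

*The deformation.* For levels near `c` and where `ψ ≥ r / 2`, the Cerami condition bounds
`‖∇Φ‖ (1 + N)` below by some `δ > 0` (`IsEquivariantSetting.exists_slope_bound`). Instead of a gradient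
flow, a discrete construction is used. Near each point `u` one translates, in a chart that
straightens `M`, in the constant direction `-∇Φ(u)` (`exists_local_deformation`). These local
deformations are composed in a fixed order, with durations that are continuous functions of the
starting point (`exists_global_descent`). Integrating `|d'| ≤ C (1 + N) |Φ'|`, where `N` is
`1`-Lipschitz for `d`, yields a bound for the distance covered that is stable under composition
(`CeramiControlled`). By this bound and by completeness, iterates that never left the region would
converge; the limit would be a fixed point, but `Φ` drops at each point of the region. So each
point leaves the region after finitely many steps, and the number of steps can be made a
continuous function of the point (`exists_long_descent`).

*Oddness.* The scalar products at `u` and at `-u` are unrelated, so the deformation obtained so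
far is not odd. It is made odd afterwards, by performing it and its conjugate under `u ↦ -u`
alternately, for the durations `f_i(x)` and `f_i(-x)` at the starting point `x`, where the supports
of the bump functions `f_i` contain no antipodal pairs (`exists_odd_descent`). The
bound in terms of `N` need not survive this, but the bound of the variation of `ψ` by a multiple
of the drop of `Φ` does, since both functions are even. For small `ε` this suffices: a point that
has left the region because of `ψ < r / 2` cannot reach `ψ ≥ r` without falling below the level
`c - ε`.
-/

namespace EquivariantLS

open MeasureTheory

/-! ### The norms of a family of scalar products -/

section

variable {X : Type*} [NormedAddCommGroup X] [InnerProductSpace ℝ X]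

/-- A family of scalar products on `X`, indexed by the nonzero vectors, that is locally uniformly
equivalent to the norm and locally Lipschitz. -/
structure IsAdmissible (B : X → LinearMap.BilinForm ℝ X) : Prop where
  scalar : ∀ u : X, u ≠ 0 → IsScalarProduct (B u)
  equiv : LocallyUniformlyEquivalent B
  lip : LocallyLipschitzFamily B

theorem normAt_nonneg (B : X → LinearMap.BilinForm ℝ X) (u v : X) : 0 ≤ normAt B u v :=
  Real.sqrt_nonneg _

@[simp] theorem normAt_zero (B : X → LinearMap.BilinForm ℝ X) (u : X) : normAt B u 0 = 0 := by
  simp [normAt]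

theorem normAt_smul (B : X → LinearMap.BilinForm ℝ X) (u v : X) (c : ℝ) :
    normAt B u (c • v) = |c| * normAt B u v := by
  have h : B u (c • v) (c • v) = c ^ 2 * B u v v := by
    simp only [map_smul, LinearMap.smul_apply, smul_eq_mul]; ring
  rw [normAt, normAt, h, Real.sqrt_mul (sq_nonneg c), Real.sqrt_sq_eq_abs]

theorem IsScalarProduct.self_nonneg {b : LinearMap.BilinForm ℝ X} (hb : IsScalarProduct b)
    (v : X) : 0 ≤ b v v := by
  rcases eq_or_ne v 0 with rfl | hv
  · simp
  · exact (hb.2 v hv).le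

variable {B : X → LinearMap.BilinForm ℝ X}

theorem IsAdmissible.sq_normAt (hB : IsAdmissible B) {u : X} (hu : u ≠ 0) (v : X) :
    normAt B u v ^ 2 = B u v v :=
  Real.sq_sqrt ((hB.scalar u hu).self_nonneg v)

/-- The Cauchy-Schwarz inequality. -/
theorem IsAdmissible.abs_apply_le (hB : IsAdmissible B) {u : X} (hu : u ≠ 0) (v w : X) :
    |B u v w| ≤ normAt B u v * normAt B u w := by
  have hs := (hB.scalar u hu).self_nonneg
  have h := LinearMap.BilinForm.apply_mul_apply_le_of_forall_zero_le (B u) hs v w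
  rw [(hB.scalar u hu).1 w v, ← hB.sq_normAt hu, ← hB.sq_normAt hu, ← mul_pow, ← sq] at h
  exact abs_le_of_sq_le_sq h (mul_nonneg (normAt_nonneg ..) (normAt_nonneg ..))

theorem IsAdmissible.exists_ball (hB : IsAdmissible B) {u : X} (hu : u ≠ 0) :
    ∃ ρ > 0, ∃ C > 0, ∀ u' ∈ Metric.ball u ρ, u' ≠ 0 ∧
      ∀ v : X, ‖v‖ ≤ C * normAt B u' v ∧ normAt B u' v ≤ C * ‖v‖ := by
  obtain ⟨U, hU, hU0, C, hC, h⟩ := hB.equiv u hu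
  obtain ⟨ρ, hρ, hρU⟩ := Metric.mem_nhds_iff.1 hU
  refine ⟨ρ, hρ, C, hC, fun u' hu' => ⟨hU0 (hρU hu'), fun v => ⟨?_, (h u' (hρU hu') v).2⟩⟩⟩
  have := (h u' (hρU hu') v).1
  rwa [one_div, inv_mul_le_iff₀ hC] at this

/-- The scalar product at a point, as a continuous bilinear map. -/
theorem IsAdmissible.exists_clm (hB : IsAdmissible B) {u : X} (hu : u ≠ 0) :
    ∃ b : X →L[ℝ] X →L[ℝ] ℝ, ∀ v w, b v w = B u v w := by
  obtain ⟨ρ, hρ, C, hC, h⟩ := hB.exists_ball hu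
  refine ⟨LinearMap.mkContinuous₂ (B u) (C * C) fun v w => ?_, fun v w => rfl⟩
  have h1 := ((h u (Metric.mem_ball_self hρ)).2 v).2
  have h2 := ((h u (Metric.mem_ball_self hρ)).2 w).2
  calc ‖B u v w‖ ≤ normAt B u v * normAt B u w := hB.abs_apply_le hu v w
    _ ≤ (C * ‖v‖) * (C * ‖w‖) := by
      gcongr
      exact normAt_nonneg ..
    _ = C * C * ‖v‖ * ‖w‖ := by ring

/-- The norm `‖v‖_u` is jointly continuous in `u` and `v`. -/
theorem IsAdmissible.tendsto_normAt (hB : IsAdmissible B) {u : X} (hu : u ≠ 0) (v : X) :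
    Tendsto (fun p : X × X => normAt B p.1 p.2) (𝓝 (u, v)) (𝓝 (normAt B u v)) := by
  refine (Real.continuous_sqrt.tendsto _).comp ?_
  obtain ⟨b, hb⟩ := hB.exists_clm hu
  obtain ⟨U, hU, -, C, hC, h⟩ := hB.lip u hu
  have h1 : Tendsto (fun p : X × X => b p.2 p.2) (𝓝 (u, v)) (𝓝 (b v v)) := by
    have : Continuous fun p : X × X => b p.2 p.2 := by fun_prop
    exact this.tendsto (u, v)
  have h2 : Tendsto (fun p : X × X => C * ‖p.1 - u‖ * ‖p.2‖ * ‖p.2‖) (𝓝 (u, v)) (𝓝 0) := by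
    have : Continuous fun p : X × X => C * ‖p.1 - u‖ * ‖p.2‖ * ‖p.2‖ := by fun_prop
    simpa using this.tendsto (u, v)
  have h3 : Tendsto (fun p : X × X => B p.1 p.2 p.2 - b p.2 p.2) (𝓝 (u, v)) (𝓝 0) := by
    refine squeeze_zero_norm' ?_ h2
    filter_upwards [(continuous_fst.tendsto (u, v)).eventually hU] with p hp
    rw [hb]
    exact h p.1 hp u (mem_of_mem_nhds hU) p.2 p.2
  have := h3.add h1
  simpa [hb] using this

/-! ### The distance `d` -/

variable {M : Set X}

theorem curveLength_eq_lintegral_deriv {γ : ℝ → X} (hγ : ContDiff ℝ 1 γ) :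
    curveLength B γ = ∫⁻ s in Icc (0 : ℝ) 1, ENNReal.ofReal (normAt B (γ s) (deriv γ s)) := by
  refine setLIntegral_congr_fun measurableSet_Icc fun s hs => ?_
  rw [(hγ.differentiable one_ne_zero s).derivWithin (uniqueDiffOn_Icc_zero_one s hs)]

theorem mdist_le_curveLength {γ : ℝ → X} (hγ : ContDiffOn ℝ 1 γ (Icc 0 1))
    (hM : MapsTo γ (Icc 0 1) M) : mdist M B (γ 0) (γ 1) ≤ curveLength B γ :=
  iInf₂_le γ ⟨hγ, hM, rfl, rfl⟩

theorem exists_curve_of_mdist_lt {u v : X} {r : ℝ≥0∞} (h : mdist M B u v < r) :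
    ∃ γ : ℝ → X, ContDiffOn ℝ 1 γ (Icc 0 1) ∧ MapsTo γ (Icc 0 1) M ∧ γ 0 = u ∧ γ 1 = v ∧
      curveLength B γ < r := by
  simp only [mdist, iInf_lt_iff] at h
  obtain ⟨γ, ⟨h1, h2, h3, h4⟩, h5⟩ := h
  exact ⟨γ, h1, h2, h3, h4, h5⟩

theorem mdist_le_of_normAt_le {γ : ℝ → X} (hγ : ContDiffOn ℝ 1 γ (Icc 0 1))
    (hM : MapsTo γ (Icc 0 1) M) {l : ℝ}
    (hl : ∀ s ∈ Icc (0 : ℝ) 1, normAt B (γ s) (derivWithin γ (Icc 0 1) s) ≤ l) :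
    mdist M B (γ 0) (γ 1) ≤ ENNReal.ofReal l := by
  refine (mdist_le_curveLength hγ hM).trans ?_
  calc curveLength B γ ≤ ∫⁻ _ in Icc (0 : ℝ) 1, ENNReal.ofReal l :=
        setLIntegral_mono measurable_const fun s hs => ENNReal.ofReal_le_ofReal (hl s hs)
    _ = ENNReal.ofReal l := by simp

@[simp] theorem mdist_self {u : X} (hu : u ∈ M) : mdist M B u u = 0 := by
  have := mdist_le_of_normAt_le (M := M) (B := B) (γ := fun _ => u) (l := 0) contDiffOn_const
    (fun _ _ => hu) (fun s _ => by simp)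
  simpa using this

/-- A reparametrization of a `C^1` curve on `[0,1]` by a function that takes all its values in
`[0,1]`. -/
theorem hasDerivAt_comp_curve {γ : ℝ → X} (hγ : ContDiffOn ℝ 1 γ (Icc 0 1)) {f : ℝ → ℝ}
    (hf : ContDiff ℝ 1 f) (hf01 : ∀ s, f s ∈ Icc (0 : ℝ) 1) (s : ℝ) :
    HasDerivAt (γ ∘ f) (deriv f s • derivWithin γ (Icc 0 1) (f s)) s :=
  HasDerivWithinAt.scomp_hasDerivAt s
    ((hγ.differentiableOn one_ne_zero _ (hf01 s)).hasDerivWithinAt)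
    (hf.differentiable one_ne_zero s).hasDerivAt hf01

theorem contDiff_comp_curve {γ : ℝ → X} (hγ : ContDiffOn ℝ 1 γ (Icc 0 1)) {f : ℝ → ℝ}
    (hf : ContDiff ℝ 1 f) (hf01 : ∀ s, f s ∈ Icc (0 : ℝ) 1) : ContDiff ℝ 1 (γ ∘ f) := by
  rw [← contDiffOn_univ]
  exact hγ.comp hf.contDiffOn fun s _ => hf01 s

/-- The length does not change under a reparametrization that runs through `[0,1]`
during `[a,b]`. -/
theorem lintegral_comp_curve_of_monotone {γ : ℝ → X} (hγ : ContDiffOn ℝ 1 γ (Icc 0 1))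
    {f : ℝ → ℝ} (hf : ContDiff ℝ 1 f) (hf01 : ∀ s, f s ∈ Icc (0 : ℝ) 1) (hmono : Monotone f)
    {a b : ℝ} (hab : a ≤ b) (ha : f a = 0) (hb : f b = 1) :
    ∫⁻ s in Icc a b, ENNReal.ofReal (normAt B ((γ ∘ f) s) (deriv (γ ∘ f) s)) =
      curveLength B γ := by
  have him : f '' Icc a b = Icc 0 1 := by
    rw [hf.continuous.continuousOn.image_Icc_of_monotoneOn hab (hmono.monotoneOn _), ha, hb]
  rw [curveLength, ← him, lintegral_image_eq_lintegral_deriv_mul_of_monotoneOn measurableSet_Icc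
    (fun x _ => (hf.differentiable one_ne_zero x).hasDerivAt.hasDerivWithinAt)
    (hmono.monotoneOn _)]
  refine setLIntegral_congr_fun measurableSet_Icc fun s _ => ?_
  rw [(hasDerivAt_comp_curve hγ hf hf01 s).deriv, normAt_smul, abs_of_nonneg hmono.deriv_nonneg,
    ENNReal.ofReal_mul hmono.deriv_nonneg, him]
  rfl

/-- The length of the reversed curve. -/
theorem lintegral_comp_curve_of_antitone {γ : ℝ → X} (hγ : ContDiffOn ℝ 1 γ (Icc 0 1))
    {f : ℝ → ℝ} (hf : ContDiff ℝ 1 f) (hf01 : ∀ s, f s ∈ Icc (0 : ℝ) 1) (hanti : Antitone f)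
    {a b : ℝ} (hab : a ≤ b) (ha : f a = 1) (hb : f b = 0) :
    ∫⁻ s in Icc a b, ENNReal.ofReal (normAt B ((γ ∘ f) s) (deriv (γ ∘ f) s)) =
      curveLength B γ := by
  have him : f '' Icc a b = Icc 0 1 := by
    rw [hf.continuous.continuousOn.image_Icc_of_antitoneOn hab (hanti.antitoneOn _), ha, hb]
  rw [curveLength, ← him, lintegral_image_eq_lintegral_deriv_mul_of_antitoneOn measurableSet_Icc
    (fun x _ => (hf.differentiable one_ne_zero x).hasDerivAt.hasDerivWithinAt)
    (hanti.antitoneOn _)]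
  refine setLIntegral_congr_fun measurableSet_Icc fun s _ => ?_
  rw [(hasDerivAt_comp_curve hγ hf hf01 s).deriv, normAt_smul, abs_of_nonpos hanti.deriv_nonpos,
    ENNReal.ofReal_mul (neg_nonneg.2 hanti.deriv_nonpos), him]
  rfl

theorem smoothTransition_mem_Icc (s : ℝ) : Real.smoothTransition s ∈ Icc (0 : ℝ) 1 :=
  ⟨Real.smoothTransition.nonneg s, Real.smoothTransition.le_one s⟩

theorem mdist_comm_le (u v : X) : mdist M B v u ≤ mdist M B u v := by
  refine le_of_forall_gt fun r hr => ?_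
  obtain ⟨γ, h1, h2, rfl, rfl, h5⟩ := exists_curve_of_mdist_lt hr
  -- Unlike `1 - s`, the function `f` has all its values in `[0,1]`, so that the reversed curve is
  -- of class `C^1` on the whole line.
  let f : ℝ → ℝ := fun s => Real.smoothTransition (1 - s)
  have hf : ContDiff ℝ 1 f := Real.smoothTransition.contDiff.comp (contDiff_const.sub contDiff_id)
  have hf01 : ∀ s, f s ∈ Icc (0 : ℝ) 1 := fun s => smoothTransition_mem_Icc _
  have hanti : Antitone f := fun s t hst => Real.smoothTransition.monotone (by linarith)
  have hc := contDiff_comp_curve h1 hf hf01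
  have h6 := mdist_le_curveLength (B := B) (M := M) hc.contDiffOn (fun s _ => h2 (hf01 s))
  rw [curveLength_eq_lintegral_deriv hc, lintegral_comp_curve_of_antitone h1 hf hf01 hanti
    zero_le_one (by simp [f]) (by simp [f])] at h6
  simp only [f, Function.comp_apply, sub_zero, sub_self, Real.smoothTransition.one,
    Real.smoothTransition.zero] at h6
  exact h6.trans_lt h5

theorem mdist_comm (u v : X) : mdist M B u v = mdist M B v u :=
  le_antisymm (mdist_comm_le v u) (mdist_comm_le u v)

theorem mdist_triangle (u v w : X) : mdist M B u w ≤ mdist M B u v + mdist M B v w := by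
  refine ENNReal.le_of_forall_pos_le_add fun ε hε hlt => ?_
  have hε' : (0 : ℝ≥0∞) < ε / 2 := ENNReal.half_pos (by exact_mod_cast hε.ne')
  obtain ⟨h₁, h₂⟩ := ENNReal.add_lt_top.1 hlt
  obtain ⟨γ, a1, a2, a3, a4, a5⟩ :=
    exists_curve_of_mdist_lt (ENNReal.lt_add_right h₁.ne hε'.ne')
  obtain ⟨η, b1, b2, b3, b4, b5⟩ :=
    exists_curve_of_mdist_lt (ENNReal.lt_add_right h₂.ne hε'.ne')
  -- Both curves are made constant near the end where they meet, so that gluing them is `C^1`.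
  let f : ℝ → ℝ := fun s => Real.smoothTransition (3 * s)
  let g : ℝ → ℝ := fun s => Real.smoothTransition (3 * s - 2)
  have hf : ContDiff ℝ 1 f := Real.smoothTransition.contDiff.comp (contDiff_const.mul contDiff_id)
  have hg : ContDiff ℝ 1 g :=
    Real.smoothTransition.contDiff.comp ((contDiff_const.mul contDiff_id).sub contDiff_const)
  have hf01 : ∀ s, f s ∈ Icc (0 : ℝ) 1 := fun s => smoothTransition_mem_Icc _
  have hg01 : ∀ s, g s ∈ Icc (0 : ℝ) 1 := fun s => smoothTransition_mem_Icc _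
  have hfm : Monotone f := fun s t hst => Real.smoothTransition.monotone (by linarith)
  have hgm : Monotone g := fun s t hst => Real.smoothTransition.monotone (by linarith)
  let σ : ℝ → X := fun s => if s ≤ 1 / 2 then γ (f s) else η (g s)
  have e1 : ∀ s < 2 / 3, σ s = (γ ∘ f) s := by
    intro s hs
    by_cases h : s ≤ 1 / 2
    · exact if_pos h
    · simp only [σ, h, if_false, Function.comp_apply]
      have h1 : f s = 1 := Real.smoothTransition.one_of_one_le (by linarith)
      have h2 : g s = 0 := Real.smoothTransition.zero_of_nonpos (by linarith)
      rw [h1, h2, a4, b3]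
  have e2 : ∀ s > 1 / 3, σ s = (η ∘ g) s := by
    intro s hs
    by_cases h : s ≤ 1 / 2
    · simp only [σ, h, if_true, Function.comp_apply]
      have h1 : f s = 1 := Real.smoothTransition.one_of_one_le (by linarith)
      have h2 : g s = 0 := Real.smoothTransition.zero_of_nonpos (by linarith)
      rw [h1, h2, a4, b3]
    · exact if_neg h
  have n1 : ∀ s < 2 / 3, σ =ᶠ[𝓝 s] γ ∘ f := fun s hs => by
    filter_upwards [Iio_mem_nhds hs] with t ht using e1 t ht
  have n2 : ∀ s > 1 / 3, σ =ᶠ[𝓝 s] η ∘ g := fun s hs => by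
    filter_upwards [Ioi_mem_nhds hs] with t ht using e2 t ht
  have hc1 := contDiff_comp_curve a1 hf hf01
  have hc2 := contDiff_comp_curve b1 hg hg01
  have hc : ContDiff ℝ 1 σ := by
    rw [contDiff_iff_contDiffAt]
    intro s
    rcases lt_or_ge s (2 / 3) with hs | hs
    · exact hc1.contDiffAt.congr_of_eventuallyEq (n1 s hs)
    · exact hc2.contDiffAt.congr_of_eventuallyEq (n2 s (by linarith))
  have hM : MapsTo σ (Icc 0 1) M := by
    intro s _
    by_cases h : s ≤ 1 / 2
    · simp only [σ, h, if_true]; exact a2 (hf01 s)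
    · simp only [σ, h, if_false]; exact b2 (hg01 s)
  have key := mdist_le_curveLength (B := B) hc.contDiffOn hM
  have s0 : σ 0 = u := by rw [e1 0 (by norm_num)]; simp [f, a3]
  have s1 : σ 1 = w := by
    rw [e2 1 (by norm_num), ← b4, Function.comp_apply,
      show g 1 = 1 from Real.smoothTransition.one_of_one_le (by norm_num)]
  rw [s0, s1, curveLength_eq_lintegral_deriv hc] at key
  have hle : ∫⁻ s in Icc (0 : ℝ) 1, ENNReal.ofReal (normAt B (σ s) (deriv σ s)) ≤
      curveLength B γ + curveLength B η := by
    rw [← lintegral_comp_curve_of_monotone (B := B) a1 hf hf01 hfm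
      (a := 0) (b := 1 / 2) (by norm_num) (by simp [f])
      (Real.smoothTransition.one_of_one_le (by norm_num)),
      ← lintegral_comp_curve_of_monotone (B := B) b1 hg hg01 hgm (a := 1 / 2) (b := 1)
      (by norm_num) (Real.smoothTransition.zero_of_nonpos (by norm_num))
      (Real.smoothTransition.one_of_one_le (by norm_num)),
      ← Icc_union_Icc_eq_Icc (a := (0 : ℝ)) (b := 1 / 2) (c := 1) (by norm_num) (by norm_num)]
    refine (lintegral_union_le _ _ _).trans (add_le_add (le_of_eq ?_) (le_of_eq ?_))
    · refine setLIntegral_congr_fun measurableSet_Icc fun s hs => ?_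
      have hs' : s < 2 / 3 := by linarith [hs.2]
      rw [e1 s hs', (n1 s hs').deriv_eq]
    · refine setLIntegral_congr_fun measurableSet_Icc fun s hs => ?_
      have hs' : s > 1 / 3 := by linarith [hs.1]
      rw [e2 s hs', (n2 s hs').deriv_eq]
  calc mdist M B u w ≤ curveLength B γ + curveLength B η := key.trans hle
    _ ≤ (mdist M B u v + ε / 2) + (mdist M B v w + ε / 2) := add_le_add a5.le b5.le
    _ = mdist M B u v + mdist M B v w + (ε / 2 + ε / 2) := by ring
    _ = _ := by rw [ENNReal.add_halves]

/-- A curve that stays in a region where the norms `‖·‖_u` are bounded below by `‖·‖ / C` moves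
by at most `C` times its length. -/
theorem enorm_sub_le_mul_curveLength {γ : ℝ → X} (hγ : ContDiffOn ℝ 1 γ (Icc 0 1)) {C b : ℝ}
    (hb : b ∈ Icc (0 : ℝ) 1)
    (h : ∀ s ∈ Ioo 0 b, ∀ v, ‖v‖ ≤ C * normAt B (γ s) v) (hC : 0 ≤ C) :
    ‖γ b - γ 0‖ₑ ≤ ENNReal.ofReal C * curveLength B γ := by
  have hsub : Icc 0 b ⊆ Icc (0 : ℝ) 1 := Icc_subset_Icc_right hb.2
  calc ‖γ b - γ 0‖ₑ ≤ ∫⁻ s in Icc 0 b, ‖deriv γ s‖ₑ :=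
        enorm_sub_le_lintegral_deriv_of_contDiffOn_Icc (hγ.mono hsub) hb.1
    _ = ∫⁻ s in Ioo 0 b, ‖deriv γ s‖ₑ := by rw [restrict_Ioo_eq_restrict_Icc]
    _ ≤ ∫⁻ s in Ioo 0 b, ENNReal.ofReal C *
          ENNReal.ofReal (normAt B (γ s) (derivWithin γ (Icc 0 1) s)) := by
        refine setLIntegral_mono' measurableSet_Ioo fun s hs => ?_
        rw [derivWithin_of_mem_nhds (Icc_mem_nhds hs.1 (hs.2.trans_le hb.2)),
          ← ENNReal.ofReal_mul hC, ← ofReal_norm]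
        exact ENNReal.ofReal_le_ofReal (h s hs _)
    _ = ENNReal.ofReal C * ∫⁻ s in Ioo 0 b,
          ENNReal.ofReal (normAt B (γ s) (derivWithin γ (Icc 0 1) s)) :=
        lintegral_const_mul' _ _ ENNReal.ofReal_ne_top
    _ ≤ _ := by
        gcongr
        exact lintegral_mono_set (Ioo_subset_Icc_self.trans hsub)

/-- Locally, the norm distance from `u` is bounded by a multiple of `d`: a short curve that starts
at `u` cannot leave the ball on which the norms `‖·‖_u` and `‖·‖` are comparable. -/
theorem IsAdmissible.exists_enorm_sub_le (hB : IsAdmissible B) (M : Set X) {u : X}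
    (hu : u ≠ 0) : ∃ ρ > 0, ∃ C > 0, ∀ v, mdist M B u v < ENNReal.ofReal ρ →
      ‖v - u‖ₑ ≤ ENNReal.ofReal C * mdist M B u v := by
  obtain ⟨ρ, hρ, C, hC, h⟩ := hB.exists_ball hu
  refine ⟨ρ / C, by positivity, C, hC, fun v hv => ?_⟩
  have hC0 : ENNReal.ofReal C ≠ 0 := by simpa using hC
  rw [mul_comm, ← ENNReal.div_le_iff hC0 ENNReal.ofReal_ne_top]
  refine le_of_forall_gt fun r hr => ?_
  obtain ⟨γ, h1, h2, h3, h4, h5⟩ := exists_curve_of_mdist_lt (lt_min hr hv)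
  have hstay : ∀ s ∈ Icc (0 : ℝ) 1, γ s ∈ Metric.ball u ρ := by
    by_contra! hcon
    -- Otherwise consider the first time at which the curve leaves the ball.
    let T : Set ℝ := {s ∈ Icc (0 : ℝ) 1 | ρ ≤ ‖γ s - u‖}
    have hT : IsCompact T := by
      have : IsClosed T := by
        have hc : ContinuousOn (fun s => ‖γ s - u‖) (Icc 0 1) :=
          (h1.continuousOn.sub continuousOn_const).norm
        exact hc.preimage_isClosed_of_isClosed isClosed_Icc isClosed_Ici
      exact isCompact_Icc.of_isClosed_subset this (sep_subset _ _)
    have hTne : T.Nonempty := by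
      obtain ⟨s, hs, hs'⟩ := hcon
      exact ⟨s, hs, by simpa [dist_eq_norm] using hs'⟩
    obtain ⟨b, ⟨hb, hbρ⟩, hmin⟩ := hT.exists_isLeast hTne
    have hle := enorm_sub_le_mul_curveLength (B := B) h1 hb (C := C) (fun s hs v => by
      refine ((h (γ s) ?_).2 v).1
      by_contra hsρ
      have : s ∈ T := ⟨⟨hs.1.le, hs.2.le.trans hb.2⟩, by simpa [dist_eq_norm] using hsρ⟩
      exact absurd (hmin this) (not_le.2 hs.2)) hC.le
    rw [h3] at hle
    have : ENNReal.ofReal ρ < ENNReal.ofReal ρ := by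
      calc ENNReal.ofReal ρ ≤ ‖γ b - u‖ₑ := by
            rw [← ofReal_norm]; exact ENNReal.ofReal_le_ofReal hbρ
        _ ≤ ENNReal.ofReal C * curveLength B γ := hle
        _ < ENNReal.ofReal C * ENNReal.ofReal (ρ / C) :=
            ENNReal.mul_lt_mul_right hC0 ENNReal.ofReal_ne_top (h5.trans_le (min_le_right _ _))
        _ = ENNReal.ofReal ρ := by
            rw [← ENNReal.ofReal_mul hC.le, mul_div_cancel₀ _ hC.ne']
    exact lt_irrefl _ this
  have hle := enorm_sub_le_mul_curveLength (B := B) h1 (b := 1) (by simp) (C := C)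
    (fun s hs v => ((h (γ s) (hstay s ⟨hs.1.le, hs.2.le⟩)).2 v).1) hC.le
  rw [h3, h4, mul_comm, ← ENNReal.div_le_iff hC0 ENNReal.ofReal_ne_top] at hle
  exact hle.trans_lt (h5.trans_le (min_le_left _ _))

/-- The topology of `d` is finer than that of `X`. -/
theorem IsAdmissible.tendsto_of_mdist (hB : IsAdmissible B) {u : X} (hu : u ≠ 0) {α : Type*}
    {l : Filter α} {s : α → X} (h : Tendsto (fun n => mdist M B u (s n)) l (𝓝 0)) :
    Tendsto s l (𝓝 u) := by
  obtain ⟨ρ, hρ, C, hC, h'⟩ := hB.exists_enorm_sub_le M hu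
  rw [tendsto_iff_edist_tendsto_0]
  have h2 : Tendsto (fun n => ENNReal.ofReal C * mdist M B u (s n)) l (𝓝 0) := by
    simpa using ENNReal.Tendsto.const_mul h (Or.inr ENNReal.ofReal_ne_top)
  refine tendsto_of_tendsto_of_tendsto_of_le_of_le' tendsto_const_nhds h2
    (Eventually.of_forall fun _ => zero_le) ?_
  filter_upwards [h.eventually (gt_mem_nhds (ENNReal.ofReal_pos.2 hρ))] with n hn
  rw [edist_eq_enorm_sub]
  exact h' _ hn

end

/-! ### Charts that straighten `M` -/

section

variable {X : Type*} [NormedAddCommGroup X] [InnerProductSpace ℝ X]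

section C11

variable {Y : Type*} [NormedAddCommGroup Y] [NormedSpace ℝ Y] {f : X → Y} {U : Set X}

theorem C11On.contDiffOn (h : C11On f U) (hU : IsOpen U) : ContDiffOn ℝ 1 f U := by
  rw [show (1 : WithTop ℕ∞) = 0 + 1 from rfl, contDiffOn_succ_iff_fderiv_of_isOpen hU]
  exact ⟨h.1, by simp, contDiffOn_zero.2 h.2.continuousOn⟩

theorem C11On.hasStrictFDerivAt (h : C11On f U) (hU : IsOpen U) {x : X} (hx : x ∈ U) :
    HasStrictFDerivAt f (fderiv ℝ f x) x :=
  ((h.contDiffOn hU).contDiffAt (hU.mem_nhds hx)).hasStrictFDerivAt one_ne_zero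

theorem C11On.continuousAt_fderiv (h : C11On f U) (hU : IsOpen U) {x : X} (hx : x ∈ U) :
    ContinuousAt (fderiv ℝ f) x :=
  h.2.continuousOn.continuousAt (hU.mem_nhds hx)

end C11

/-- The local diffeomorphism `e` of class `C^{1,1}` straightens `M` to the closed subspace `E`. -/
structure IsStraightening (M : Set X) (e : OpenPartialHomeomorph X X) (E : Submodule ℝ X) :
    Prop where
  c11 : C11On e e.source
  c11_symm : C11On e.symm e.target
  isClosed : IsClosed (E : Set X)
  image_eq : e '' (e.source ∩ M) = e.target ∩ (E : Set X)

variable {M : Set X} {e : OpenPartialHomeomorph X X} {E : Submodule ℝ X}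

namespace IsStraightening

theorem apply_mem (h : IsStraightening M e E) {u : X} (hu : u ∈ e.source) (huM : u ∈ M) :
    e u ∈ E :=
  (h.image_eq.subset (mem_image_of_mem e ⟨hu, huM⟩)).2

theorem symm_mem (h : IsStraightening M e E) {y : X} (hy : y ∈ e.target) (hyE : y ∈ E) :
    e.symm y ∈ M := by
  obtain ⟨u, ⟨hu, huM⟩, rfl⟩ := h.image_eq.superset ⟨hy, hyE⟩
  rwa [e.left_inv hu]

theorem fderiv_symm_fderiv (h : IsStraightening M e E) {u : X} (hu : u ∈ e.source) (v : X) :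
    fderiv ℝ e.symm (e u) (fderiv ℝ e u v) = v := by
  have h1 := (h.c11.hasStrictFDerivAt e.open_source hu).hasFDerivAt
  have h2 := (h.c11_symm.hasStrictFDerivAt e.open_target (e.map_source hu)).hasFDerivAt
  have h3 := (h2.comp u h1).congr_of_eventuallyEq (f₁ := id) (by
    filter_upwards [e.open_source.mem_nhds hu] with x hx using (e.left_inv hx).symm)
  exact (DFunLike.congr_fun (h3.unique (hasFDerivAt_id u)) v)

theorem fderiv_fderiv_symm (h : IsStraightening M e E) {u : X} (hu : u ∈ e.source) (w : X) :
    fderiv ℝ e u (fderiv ℝ e.symm (e u) w) = w := by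
  have h1 := (h.c11.hasStrictFDerivAt e.open_source hu).hasFDerivAt
  have h2 := (h.c11_symm.hasStrictFDerivAt e.open_target (e.map_source hu)).hasFDerivAt
  have h1' : HasFDerivAt e (fderiv ℝ e u) (e.symm (e u)) := by rwa [e.left_inv hu]
  have h3 := (h1'.comp (e u) h2).congr_of_eventuallyEq (f₁ := id) (by
    filter_upwards [e.open_target.mem_nhds (e.map_source hu)] with x hx
      using (e.right_inv hx).symm)
  exact (DFunLike.congr_fun (h3.unique (hasFDerivAt_id (e u))) w)

/-- The chart identifies `T_u M` with `E`, so `T_u M` is a closed linear subspace. -/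
theorem mem_tangentSpaceAt_iff (h : IsStraightening M e E) {u : X} (hu : u ∈ e.source)
    (huM : u ∈ M) {v : X} : v ∈ tangentSpaceAt M u ↔ fderiv ℝ e u v ∈ E := by
  constructor
  · rintro ⟨γ, h0, hd, hγM⟩
    have he : HasFDerivAt e (fderiv ℝ e u) (γ 0) := by
      rw [h0]; exact (h.c11.hasStrictFDerivAt e.open_source hu).hasFDerivAt
    have hsl := (hasDerivAt_iff_tendsto_slope.1 (he.comp_hasDerivAt 0 hd))
    refine h.isClosed.mem_of_tendsto hsl ?_
    have hsrc : ∀ᶠ t in 𝓝 (0 : ℝ), γ t ∈ e.source :=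
      hd.continuousAt.eventually_mem (e.open_source.mem_nhds (by rwa [h0]))
    filter_upwards [mem_nhdsWithin_of_mem_nhds (hγM.and hsrc)] with t ht
    rw [slope_def_module]
    exact E.smul_mem _ (E.sub_mem (h.apply_mem ht.2 ht.1)
      (h.apply_mem (by rwa [h0]) (by rwa [h0])))
  · intro hv
    have hl : HasDerivAt (fun t : ℝ => e u + t • fderiv ℝ e u v) (fderiv ℝ e u v) 0 := by
      simpa using ((hasDerivAt_id (0 : ℝ)).smul_const (fderiv ℝ e u v)).const_add (e u)
    have he : HasFDerivAt e.symm (fderiv ℝ e.symm (e u))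
        ((fun t : ℝ => e u + t • fderiv ℝ e u v) 0) := by
      simpa using (h.c11_symm.hasStrictFDerivAt e.open_target (e.map_source hu)).hasFDerivAt
    refine ⟨fun t => e.symm (e u + t • fderiv ℝ e u v), by simp [e.left_inv hu], ?_, ?_⟩
    · have := he.comp_hasDerivAt (0 : ℝ) hl
      rwa [h.fderiv_symm_fderiv hu] at this
    · have : ∀ᶠ t in 𝓝 (0 : ℝ), e u + t • fderiv ℝ e u v ∈ e.target :=
        hl.continuousAt.eventually_mem (e.open_target.mem_nhds (by simpa using e.map_source hu))
      filter_upwards [this] with t ht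
      exact h.symm_mem ht (E.add_mem (h.apply_mem hu huM) (E.smul_mem _ hv))

variable {B : X → LinearMap.BilinForm ℝ X}

/-- The image under the inverse chart of a segment in `E` is a curve in `M`, which bounds `d`. -/
theorem mdist_segment_le (h : IsStraightening M e E) {y w : X} (hy : y ∈ E) (hw : w ∈ E)
    {l : ℝ} (ht : ∀ s ∈ Icc (0 : ℝ) 1, y + s • w ∈ e.target)
    (hl : ∀ s ∈ Icc (0 : ℝ) 1,
      normAt B (e.symm (y + s • w)) (fderiv ℝ e.symm (y + s • w) w) ≤ l) :
    mdist M B (e.symm y) (e.symm (y + w)) ≤ ENNReal.ofReal l := by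
  have hline : ContDiff ℝ 1 fun s : ℝ => y + s • w := by fun_prop
  have key := mdist_le_of_normAt_le (M := M) (B := B) (γ := fun s : ℝ => e.symm (y + s • w))
    (l := l) ((h.c11_symm.contDiffOn e.open_target).comp hline.contDiffOn ht)
    (fun s hs => h.symm_mem (ht s hs) (E.add_mem hy (E.smul_mem _ hw))) (fun s hs => by
      have hd : HasDerivAt (fun s : ℝ => e.symm (y + s • w))
          (fderiv ℝ e.symm (y + s • w) w) s := by
        have h1 : HasDerivAt (fun t : ℝ => y + t • w) w s := by
          simpa using ((hasDerivAt_id s).smul_const w).const_add y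
        exact ((h.c11_symm.hasStrictFDerivAt e.open_target (ht s hs)).hasFDerivAt).comp_hasDerivAt
          s h1
      rw [hd.hasDerivWithinAt.derivWithin (uniqueDiffOn_Icc_zero_one s hs)]
      exact hl s hs)
  simpa using key

theorem tendsto_mdist (h : IsStraightening M e E) (hB : IsAdmissible B) {u : X} (hu0 : u ≠ 0)
    (hu : u ∈ e.source) (huM : u ∈ M) :
    Tendsto (fun v => mdist M B u v) (𝓝[M] u) (𝓝 0) := by
  have htu := e.map_source hu
  obtain ⟨ρ, hρ, C, hC, hball⟩ := hB.exists_ball hu0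
  set K := ‖fderiv ℝ e.symm (e u)‖ + 1
  have hev : ∀ᶠ y in 𝓝 (e u), y ∈ e.target ∧ e.symm y ∈ Metric.ball u ρ ∧
      ‖fderiv ℝ e.symm y‖ < K := by
    refine Eventually.and (e.open_target.mem_nhds htu) (Eventually.and ?_ ?_)
    · refine (e.continuousAt_symm htu).eventually_mem ?_
      rw [e.left_inv hu]; exact Metric.ball_mem_nhds u hρ
    · exact (h.c11_symm.continuousAt_fderiv e.open_target htu).norm.eventually
        (gt_mem_nhds (by simp [K]))
  obtain ⟨r, hr, hball'⟩ := Metric.eventually_nhds_iff_ball.1 hev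
  have hlim : Tendsto (fun v => ENNReal.ofReal (C * (K * ‖e v - e u‖))) (𝓝[M] u) (𝓝 0) := by
    have : Tendsto (fun v => C * (K * ‖e v - e u‖)) (𝓝[M] u) (𝓝 0) := by
      have hc : ContinuousAt (fun v => C * (K * ‖e v - e u‖)) u :=
        continuousAt_const.mul (continuousAt_const.mul
          ((e.continuousAt hu).sub continuousAt_const).norm)
      simpa using hc.tendsto.mono_left nhdsWithin_le_nhds
    simpa using ENNReal.tendsto_ofReal this
  refine tendsto_of_tendsto_of_tendsto_of_le_of_le' tendsto_const_nhds hlim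
    (Eventually.of_forall fun _ => zero_le) ?_
  have h1 : ∀ᶠ v in 𝓝[M] u, v ∈ e.source ∧ e v ∈ Metric.ball (e u) r :=
    mem_nhdsWithin_of_mem_nhds (Eventually.and (e.open_source.mem_nhds hu)
      ((e.continuousAt hu).eventually_mem (Metric.ball_mem_nhds _ hr)))
  filter_upwards [h1, self_mem_nhdsWithin] with v hv hvM
  have hseg : ∀ s ∈ Icc (0 : ℝ) 1, e u + s • (e v - e u) ∈ Metric.ball (e u) r := by
    intro s hs
    exact (convex_ball (e u) r).add_smul_sub_mem (Metric.mem_ball_self hr) hv.2 hs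
  have := h.mdist_segment_le (B := B) (h.apply_mem hu huM)
    (E.sub_mem (h.apply_mem hv.1 hvM) (h.apply_mem hu huM)) (l := C * (K * ‖e v - e u‖))
    (fun s hs => (hball' _ (hseg s hs)).1) (fun s hs => by
      obtain ⟨-, h2, h3⟩ := hball' _ (hseg s hs)
      refine (((hball _ h2).2 _).2).trans ?_
      gcongr
      exact (ContinuousLinearMap.le_opNorm _ _).trans (by gcongr))
  rwa [add_sub_cancel, e.left_inv hu, e.left_inv hv.1] at this

/-- Near `u`, moving in the chart by `s` times the image of the tangent vector `w` costs at most
`l s`, for each `l` above the norm of `w`. -/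
theorem eventually_mdist_le (h : IsStraightening M e E) (hB : IsAdmissible B) {u : X}
    (hu0 : u ≠ 0) (hu : u ∈ e.source) (huM : u ∈ M) {w : X} (hw : w ∈ tangentSpaceAt M u) {l : ℝ}
    (hl : normAt B u w < l) :
    ∀ᶠ p : X × ℝ in 𝓝 (e u, 0), p.1 ∈ E → 0 ≤ p.2 →
      mdist M B (e.symm p.1) (e.symm (p.1 + p.2 • fderiv ℝ e u w)) ≤
        ENNReal.ofReal (l * p.2) := by
  have htu := e.map_source hu
  have hev : ∀ᶠ y in 𝓝 (e u), y ∈ e.target ∧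
      normAt B (e.symm y) (fderiv ℝ e.symm y (fderiv ℝ e u w)) < l := by
    refine Eventually.and (e.open_target.mem_nhds htu) ?_
    have h1 : Tendsto (fun y => (e.symm y, fderiv ℝ e.symm y (fderiv ℝ e u w))) (𝓝 (e u))
        (𝓝 (u, w)) := by
      refine Tendsto.prodMk_nhds ?_ ?_
      · simpa [e.left_inv hu] using (e.continuousAt_symm htu).tendsto
      · have := (h.c11_symm.continuousAt_fderiv e.open_target htu).clm_apply
          (continuousAt_const (y := fderiv ℝ e u w))
        simpa [h.fderiv_symm_fderiv hu] using this.tendsto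
    exact ((hB.tendsto_normAt hu0 w).comp h1).eventually (gt_mem_nhds hl)
  obtain ⟨r, hr, hball⟩ := Metric.eventually_nhds_iff_ball.1 hev
  have c1 : ContinuousAt (fun p : X × ℝ => p.1 + p.2 • fderiv ℝ e u w) (e u, 0) := by fun_prop
  have e1 : ∀ᶠ p : X × ℝ in 𝓝 (e u, 0), p.1 + p.2 • fderiv ℝ e u w ∈ Metric.ball (e u) r :=
    c1.eventually_mem (by simpa using Metric.ball_mem_nhds _ hr)
  have e2 : ∀ᶠ p : X × ℝ in 𝓝 (e u, 0), p.1 ∈ Metric.ball (e u) r :=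
    continuousAt_fst.eventually_mem (by simpa using Metric.ball_mem_nhds _ hr)
  filter_upwards [e1, e2] with p hp1 hp2 hpE hp0
  have hseg : ∀ s ∈ Icc (0 : ℝ) 1,
      p.1 + s • (p.2 • fderiv ℝ e u w) ∈ Metric.ball (e u) r := fun s hs =>
    (convex_ball (e u) r).add_smul_mem hp2 hp1 hs
  refine h.mdist_segment_le hpE (E.smul_mem _ ((h.mem_tangentSpaceAt_iff hu huM).1 hw))
    (fun s hs => (hball _ (hseg s hs)).1) fun s hs => ?_
  rw [map_smul, normAt_smul, abs_of_nonneg hp0, mul_comm]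
  exact mul_le_mul_of_nonneg_right (hball _ (hseg s hs)).2.le hp0

end IsStraightening

theorem IsC11Submanifold.exists_straightening (hM : IsC11Submanifold M) {u : X} (hu : u ∈ M) :
    ∃ (e : OpenPartialHomeomorph X X) (E : Submodule ℝ X),
      IsStraightening M e E ∧ u ∈ e.source := by
  obtain ⟨e, E, h1, h2, h3, h4, h5⟩ := hM u hu
  exact ⟨e, E, ⟨h2, h3, h4, h5⟩, h1⟩

/-- The topology of `X` on `M` is finer than that of `d`. -/
theorem tendsto_mdist {B : X → LinearMap.BilinForm ℝ X} (hM : IsC11Submanifold M)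
    (hM0 : (0 : X) ∉ M) (hB : IsAdmissible B) {u : X} (hu : u ∈ M) :
    Tendsto (fun v => mdist M B u v) (𝓝[M] u) (𝓝 0) := by
  obtain ⟨e, E, he, hue⟩ := hM.exists_straightening hu
  exact he.tendsto_mdist hB (ne_of_mem_of_not_mem hu hM0) hue hu

/-! ### Differentials and gradients -/

variable {Φ : X → ℝ} {B : X → LinearMap.BilinForm ℝ X}

theorem IsC11OnManifold.differentiableWithinAt (hΦ : IsC11OnManifold M Φ) {u : X} (hu : u ∈ M) :
    DifferentiableWithinAt ℝ Φ M u := by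
  obtain ⟨U, F, hU, huU, hF, hFΦ⟩ := hΦ u hu
  have h1 : DifferentiableWithinAt ℝ F M u :=
    (hF.hasStrictFDerivAt hU huU).hasFDerivAt.differentiableAt.differentiableWithinAt
  refine h1.congr_of_eventuallyEq ?_ (hFΦ ⟨huU, hu⟩).symm
  filter_upwards [mem_nhdsWithin_of_mem_nhds (hU.mem_nhds huU), self_mem_nhdsWithin] with x hx hxM
    using (hFΦ ⟨hx, hxM⟩).symm

theorem IsC11OnManifold.continuousOn (hΦ : IsC11OnManifold M Φ) : ContinuousOn Φ M :=
  fun _ hu => (hΦ.differentiableWithinAt hu).continuousWithinAt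

theorem hasDerivAt_comp_differential (hΦ : IsC11OnManifold M Φ) {u v : X} (hu : u ∈ M)
    {γ : ℝ → X} (h0 : γ 0 = u) (hd : HasDerivAt γ v 0) (hγ : ∀ᶠ t in 𝓝 0, γ t ∈ M) :
    HasDerivAt (Φ ∘ γ) (differential M Φ u v) 0 := by
  have h1 : HasFDerivWithinAt Φ (differential M Φ u) M (γ 0) := by
    rw [h0]; exact (hΦ.differentiableWithinAt hu).hasFDerivWithinAt
  have h2 : HasDerivWithinAt (Φ ∘ γ) (differential M Φ u v) {t | γ t ∈ M} 0 :=
    h1.comp_hasDerivWithinAt 0 hd.hasDerivWithinAt fun t ht => ht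
  exact h2.hasDerivAt hγ

/-- On `T_u M`, the differential is given by the derivative of any local extension of `Φ`, although
`fderivWithin` may choose another functional if `M` has positive codimension. -/
theorem differential_eq_of_eqOn (hΦ : IsC11OnManifold M Φ) {u v : X} (hu : u ∈ M)
    (hv : v ∈ tangentSpaceAt M u) {U : Set X} {F : X → ℝ} (hU : U ∈ 𝓝 u) {F' : X →L[ℝ] ℝ}
    (hF : HasFDerivAt F F' u) (hFΦ : EqOn F Φ (U ∩ M)) : differential M Φ u v = F' v := by
  obtain ⟨γ, h0, hd, hγ⟩ := hv
  have h1 := hasDerivAt_comp_differential hΦ hu h0 hd hγ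
  have h2 : HasDerivAt (F ∘ γ) (F' v) 0 := by
    refine HasFDerivAt.comp_hasDerivAt 0 ?_ hd
    rwa [h0]
  refine h1.unique (h2.congr_of_eventuallyEq ?_)
  filter_upwards [hγ, hd.continuousAt.eventually_mem (by rwa [h0] : U ∈ 𝓝 (γ 0))] with t h3 h4
  exact (hFΦ ⟨h4, h3⟩).symm

/-- Near `u`, moving in the chart by `s` times the image of the tangent vector `w` lowers `Φ` by at
least `m s`, for each `m` below the rate of decrease of `Φ` along `w`. -/
theorem IsStraightening.eventually_apply_le (h : IsStraightening M e E)
    (hΦ : IsC11OnManifold M Φ) {u : X} (hu : u ∈ e.source) (huM : u ∈ M) {w : X}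
    (hw : w ∈ tangentSpaceAt M u) {m : ℝ} (hm : m < -differential M Φ u w) :
    ∀ᶠ p : X × ℝ in 𝓝 (e u, 0), p.1 ∈ E → 0 ≤ p.2 →
      p.1 ∈ e.target ∧ p.1 + p.2 • fderiv ℝ e u w ∈ e.target ∧
      e.symm (p.1 + p.2 • fderiv ℝ e u w) ∈ M ∧
      Φ (e.symm (p.1 + p.2 • fderiv ℝ e u w)) ≤ Φ (e.symm p.1) - m * p.2 := by
  obtain ⟨U, F, hU, huU, hF, hFΦ⟩ := hΦ u huM
  have htu := e.map_source hu
  set w' := fderiv ℝ e u w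
  have hw' : w' ∈ E := (h.mem_tangentSpaceAt_iff hu huM).1 hw
  have hD : HasStrictFDerivAt (F ∘ e.symm)
      ((fderiv ℝ F u).comp (fderiv ℝ e.symm (e u))) (e u) := by
    have hFs : HasStrictFDerivAt F (fderiv ℝ F u) (e.symm (e u)) := by
      rw [e.left_inv hu]
      exact hF.hasStrictFDerivAt hU huU
    exact hFs.comp (e u) (h.c11_symm.hasStrictFDerivAt e.open_target htu)
  have hDw : ((fderiv ℝ F u).comp (fderiv ℝ e.symm (e u))) w' = differential M Φ u w := by
    rw [ContinuousLinearMap.comp_apply, h.fderiv_symm_fderiv hu,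
      differential_eq_of_eqOn hΦ huM hw (hU.mem_nhds huU)
      (hF.hasStrictFDerivAt hU huU).hasFDerivAt hFΦ]
  obtain ⟨c, hc, hcm⟩ : ∃ c > 0, c * ‖w'‖ ≤ -differential M Φ u w - m := by
    refine ⟨(-differential M Φ u w - m) / (‖w'‖ + 1), by
      apply div_pos (by linarith); positivity, ?_⟩
    rw [div_mul_eq_mul_div, div_le_iff₀ (by positivity)]
    nlinarith [norm_nonneg w']
  have c1 : ContinuousAt (fun p : X × ℝ => p.1 + p.2 • w') (e u, 0) := by fun_prop
  have c2 : Tendsto (fun p : X × ℝ => (p.1 + p.2 • w', p.1)) (𝓝 (e u, 0)) (𝓝 (e u, e u)) := by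
    have : ContinuousAt (fun p : X × ℝ => (p.1 + p.2 • w', p.1)) (e u, 0) := by fun_prop
    simpa [ContinuousAt] using this
  have hW : e.target ∩ e.symm ⁻¹' U ∈ 𝓝 (e u) := by
    refine inter_mem (e.open_target.mem_nhds htu) ((e.continuousAt_symm htu).preimage_mem_nhds ?_)
    rw [e.left_inv hu]; exact hU.mem_nhds huU
  have e1 : ∀ᶠ p : X × ℝ in 𝓝 (e u, 0), p.1 + p.2 • w' ∈ e.target ∩ e.symm ⁻¹' U :=
    c1.eventually_mem (by simpa using hW)
  have e2 : ∀ᶠ p : X × ℝ in 𝓝 (e u, 0), p.1 ∈ e.target ∩ e.symm ⁻¹' U :=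
    continuousAt_fst.eventually_mem (by simpa using hW)
  filter_upwards [e1, e2, c2.eventually (hD.isLittleO.def hc)] with p h1 h2 h3 hpE hp0
  have hM1 : e.symm p.1 ∈ M := h.symm_mem h2.1 hpE
  have hM2 : e.symm (p.1 + p.2 • w') ∈ M := h.symm_mem h1.1 (E.add_mem hpE (E.smul_mem _ hw'))
  refine ⟨h2.1, h1.1, hM2, ?_⟩
  rw [← hFΦ ⟨h1.2, hM2⟩, ← hFΦ ⟨h2.2, hM1⟩]
  simp only [Function.comp_apply, add_sub_cancel_left, map_smul, hDw, smul_eq_mul, norm_smul,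
    Real.norm_eq_abs, abs_of_nonneg hp0] at h3
  have h4 := (abs_le.1 h3).2
  nlinarith [mul_le_mul_of_nonneg_left hcm hp0]

theorem zero_mem_tangentSpaceAt {u : X} (hu : u ∈ M) : (0 : X) ∈ tangentSpaceAt M u :=
  ⟨fun _ => u, rfl, hasDerivAt_const _ _, Eventually.of_forall fun _ => hu⟩

theorem isGradient_zero_of_mem_criticalSet {u : X} (hu : u ∈ criticalSet M Φ) :
    IsGradient M B Φ u 0 :=
  ⟨zero_mem_tangentSpaceAt hu.1, fun w hw => by simpa using hu.2 w hw⟩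

/-- The gradient exists, by the Lax-Milgram theorem on the closed subspace `T_u M`. -/
theorem exists_isGradient [CompleteSpace X] (hM : IsC11Submanifold M) (hM0 : (0 : X) ∉ M)
    (hB : IsAdmissible B) (Φ : X → ℝ) {u : X} (hu : u ∈ M) : ∃ p, IsGradient M B Φ u p := by
  obtain ⟨e, E, he, hue⟩ := hM.exists_straightening hu
  have hu0 : u ≠ 0 := ne_of_mem_of_not_mem hu hM0
  let T : Submodule ℝ X := E.comap (fderiv ℝ e u : X →ₗ[ℝ] X)
  have hT : ∀ v, v ∈ T ↔ v ∈ tangentSpaceAt M u := fun v =>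
    (he.mem_tangentSpaceAt_iff hue hu).symm
  have hTc : IsClosed (T : Set X) := he.isClosed.preimage (fderiv ℝ e u).continuous
  have : CompleteSpace T := hTc.completeSpace_coe
  obtain ⟨b, hb⟩ := hB.exists_clm hu0
  let bT : T →L[ℝ] T →L[ℝ] ℝ := b.bilinearComp T.subtypeL T.subtypeL
  have hbT : ∀ v w : T, bT v w = B u v w := fun v w => hb v w
  have hco : IsCoercive bT := by
    obtain ⟨ρ, hρ, C, hC, h⟩ := hB.exists_ball hu0
    refine ⟨(C * C)⁻¹, by positivity, fun v => ?_⟩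
    have h1 := ((h u (Metric.mem_ball_self hρ)).2 v).1
    rw [hbT, ← hB.sq_normAt hu0, mul_assoc, inv_mul_le_iff₀ (by positivity)]
    calc ‖v‖ * ‖v‖ ≤ (C * normAt B u v) * (C * normAt B u v) :=
          mul_self_le_mul_self (norm_nonneg _) h1
      _ = _ := by ring
  let f : StrongDual ℝ T := (differential M Φ u).comp T.subtypeL
  let q : T := (InnerProductSpace.toDual ℝ T).symm f
  let p : T := hco.continuousLinearEquivOfBilin.symm q
  refine ⟨p, (hT p).1 p.2, fun w hw => ?_⟩
  let w' : T := ⟨w, (hT w).2 hw⟩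
  have h1 := hco.continuousLinearEquivOfBilin_apply p w'
  rw [hbT, ContinuousLinearEquiv.apply_symm_apply, InnerProductSpace.toDual_symm_apply] at h1
  exact h1

/-- The norm of the gradient is bounded below near a point that is not critical. Continuity of the
gradient is not needed: it is enough to test it with a continuous field of tangent vectors. -/
theorem exists_le_normAt_gradient (hM : IsC11Submanifold M) (hM0 : (0 : X) ∉ M)
    (hB : IsAdmissible B) (hΦ : IsC11OnManifold M Φ) {v : X} (hv : v ∈ M)
    (hcrit : v ∉ criticalSet M Φ) :
    ∃ δ > 0, ∀ᶠ u in 𝓝[M] v, ∀ p, IsGradient M B Φ u p → δ ≤ normAt B u p := by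
  obtain ⟨w, hw, hne⟩ : ∃ w ∈ tangentSpaceAt M v, differential M Φ v w ≠ 0 := by
    by_contra! h
    exact hcrit ⟨hv, h⟩
  obtain ⟨e, E, he, hve⟩ := hM.exists_straightening hv
  obtain ⟨U, F, hU, hvU, hF, hFΦ⟩ := hΦ v hv
  have hv0 : v ≠ 0 := ne_of_mem_of_not_mem hv hM0
  -- The tangent vector `w` is extended to a continuous field of tangent vectors.
  let W : X → X := fun u => fderiv ℝ e.symm (e u) (fderiv ℝ e v w)
  have hW : Tendsto W (𝓝 v) (𝓝 w) := by
    have h1 : ContinuousAt (fun u => fderiv ℝ e.symm (e u)) v :=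
      (he.c11_symm.continuousAt_fderiv e.open_target (e.map_source hve)).comp (e.continuousAt hve)
    have := h1.clm_apply (continuousAt_const (y := fderiv ℝ e v w))
    simpa [ContinuousAt, he.fderiv_symm_fderiv hve] using this
  have hd : Tendsto (fun u => |fderiv ℝ F u (W u)|) (𝓝 v) (𝓝 |differential M Φ v w|) := by
    rw [differential_eq_of_eqOn hΦ hv hw (hU.mem_nhds hvU)
      (hF.hasStrictFDerivAt hU hvU).hasFDerivAt hFΦ]
    have hWv : W v = w := he.fderiv_symm_fderiv hve w
    have hWc : ContinuousAt W v := by rw [ContinuousAt, hWv]; exact hW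
    have := ((hF.continuousAt_fderiv hU hvU).clm_apply hWc).abs
    simpa only [ContinuousAt, hWv] using this
  have hn : Tendsto (fun u => normAt B u (W u)) (𝓝 v) (𝓝 (normAt B v w)) :=
    (hB.tendsto_normAt hv0 w).comp (tendsto_id.prodMk_nhds hW)
  set a := |differential M Φ v w|
  have ha : 0 < a := abs_pos.2 hne
  set l := normAt B v w + 1
  have hl : 0 < l := by have := normAt_nonneg B v w; positivity
  refine ⟨a / 2 / l, by positivity, ?_⟩
  filter_upwards [self_mem_nhdsWithin, mem_nhdsWithin_of_mem_nhds (hU.mem_nhds hvU),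
    mem_nhdsWithin_of_mem_nhds (e.open_source.mem_nhds hve),
    mem_nhdsWithin_of_mem_nhds (hd.eventually (lt_mem_nhds (half_lt_self ha))),
    mem_nhdsWithin_of_mem_nhds (hn.eventually (gt_mem_nhds (lt_add_one _)))]
    with u huM huU hue h1 h2 p hp
  have hT : W u ∈ tangentSpaceAt M u := by
    rw [he.mem_tangentSpaceAt_iff hue huM, he.fderiv_fderiv_symm hue]
    exact (he.mem_tangentSpaceAt_iff hve hv).1 hw
  have h3 := hp.2 _ hT
  rw [differential_eq_of_eqOn hΦ huM hT (hU.mem_nhds huU)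
    (hF.hasStrictFDerivAt hU huU).hasFDerivAt hFΦ] at h3
  rw [h3] at h1
  have h4 := hB.abs_apply_le (ne_of_mem_of_not_mem huM hM0) p (W u)
  rw [div_le_iff₀ hl]
  nlinarith [normAt_nonneg B u p]

end

/-! ### Ordered compositions of locally finite families of maps -/

section Fold

variable {ι α β : Type*}

/-- The composition, in increasing order of `i`, of the maps `F i b` over the finitely many indices
`i` with `b ∈ T i`, applied to the point `p b`. The parameter `b`, and not the current position,
determines the maps: this makes the composition continuous if `T` is locally finite. -/
noncomputable def orderedComp [LinearOrder ι] (T : ι → Set β) (hT : ∀ b, {i | b ∈ T i}.Finite)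
    (F : ι → β → α → α) (p : β → α) (b : β) : α :=
  ((hT b).toFinset.sort (· ≤ ·)).foldl (fun x i => F i b x) (p b)

theorem foldl_rel {W : α → α → Prop} (hrefl : ∀ x, W x x)
    (htrans : ∀ x y z, W x y → W y z → W x z) {f : α → ι → α} (h : ∀ x i, W x (f x i))
    (l : List ι) (a : α) : W a (l.foldl f a) := by
  induction l generalizing a with
  | nil => exact hrefl a
  | cons i l ih => exact htrans _ _ _ (h a i) (ih (f a i))

theorem foldl_filter_eq {f : α → ι → α} (q : ι → Bool) (h : ∀ i, q i = false → ∀ x, f x i = x)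
    (l : List ι) (a : α) : (l.filter q).foldl f a = l.foldl f a := by
  induction l generalizing a with
  | nil => rfl
  | cons i l ih =>
    cases hi : q i
    · rw [List.filter_cons_of_neg (by simp [hi]), ih, List.foldl_cons, h i hi]
    · rw [List.filter_cons_of_pos hi, List.foldl_cons, List.foldl_cons, ih]

theorem continuous_foldl [TopologicalSpace α] [TopologicalSpace β] {F : ι → β → α → α}
    (hF : ∀ i, Continuous fun q : β × α => F i q.1 q.2) (l : List ι) {p : β → α}
    (hp : Continuous p) : Continuous fun b => l.foldl (fun x i => F i b x) (p b) := by
  induction l generalizing p with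
  | nil => exact hp
  | cons i l ih => exact ih (p := fun b => F i b (p b)) ((hF i).comp (continuous_id.prodMk hp))

variable [LinearOrder ι] {T : ι → Set β} {F : ι → β → α → α} {p : β → α}

/-- Near a given point, the composition runs over a fixed finite set of indices. -/
theorem orderedComp_eq_foldl (hT : ∀ b, {i | b ∈ T i}.Finite) (hid : ∀ i b x, b ∉ T i → F i b x = x)
    (J : Finset ι) {b : β} (hJ : ∀ i, b ∈ T i → i ∈ J) :
    orderedComp T hT F p b = (J.sort (· ≤ ·)).foldl (fun x i => F i b x) (p b) := by
  classical
  rw [← foldl_filter_eq (fun i => decide (b ∈ T i)) (fun i hi x => hid i b x (by simpa using hi)),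
    orderedComp]
  congr 1
  refine List.Perm.eq_of_pairwise' (r := (· ≤ ·)) (Finset.pairwise_sort _ _)
    ((Finset.pairwise_sort _ _).filter _) ?_
  rw [List.perm_ext_iff_of_nodup (Finset.sort_nodup _ _) ((Finset.sort_nodup _ _).filter _)]
  intro i
  simp only [Finset.mem_sort, Finite.mem_toFinset, mem_ofPred_eq, List.mem_filter,
    decide_eq_true_eq]
  exact ⟨fun h => ⟨hJ i h, h⟩, fun h => h.2⟩

theorem continuous_orderedComp [TopologicalSpace α] [TopologicalSpace β] (hT : LocallyFinite T)
    (hid : ∀ i b x, b ∉ T i → F i b x = x) (hF : ∀ i, Continuous fun q : β × α => F i q.1 q.2)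
    (hp : Continuous p) : Continuous (orderedComp T hT.point_finite F p) := by
  rw [continuous_iff_continuousAt]
  intro b
  obtain ⟨N, hN, hfin⟩ := hT b
  refine (continuous_foldl hF (hfin.toFinset.sort (· ≤ ·)) hp).continuousAt.congr ?_
  filter_upwards [hN] with b' hb'
  refine (orderedComp_eq_foldl _ hid _ fun i hi => ?_).symm
  simpa using ⟨b', hi, hb'⟩

theorem orderedComp_rel (hT : ∀ b, {i | b ∈ T i}.Finite) {W : α → α → Prop} (hrefl : ∀ x, W x x)
    (htrans : ∀ x y z, W x y → W y z → W x z) (b : β) (h : ∀ i x, W x (F i b x)) :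
    W (p b) (orderedComp T hT F p b) :=
  foldl_rel hrefl htrans (fun x i => h i x) _ _

/-- The composition splits at any of its indices `i` into what happens before, the map `F i b`, and
what happens after. -/
theorem exists_orderedComp_rel (hT : ∀ b, {i | b ∈ T i}.Finite) {W : α → α → Prop}
    (hrefl : ∀ x, W x x) (htrans : ∀ x y z, W x y → W y z → W x z) {b : β}
    (h : ∀ i x, W x (F i b x)) {i : ι} (hi : b ∈ T i) :
    ∃ x, W (p b) x ∧ W (F i b x) (orderedComp T hT F p b) := by
  have hmem : i ∈ (hT b).toFinset.sort (· ≤ ·) := by simpa using hi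
  obtain ⟨l₁, l₂, hl⟩ := List.append_of_mem hmem
  refine ⟨l₁.foldl (fun x i => F i b x) (p b), foldl_rel hrefl htrans (fun x i => h i x) _ _, ?_⟩
  rw [orderedComp, hl, List.foldl_append, List.foldl_cons]
  exact foldl_rel hrefl htrans (fun x i => h i x) _ _

theorem orderedComp_equivariant (hT : ∀ b, {i | b ∈ T i}.Finite) {σ : β → β} {τ : α → α}
    (hσ : ∀ i b, σ b ∈ T i ↔ b ∈ T i) (hp : ∀ b, p (σ b) = τ (p b))
    (hF : ∀ i b x, F i (σ b) (τ x) = τ (F i b x)) (b : β) :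
    orderedComp T hT F p (σ b) = τ (orderedComp T hT F p b) := by
  have h1 : (hT (σ b)).toFinset = (hT b).toFinset := by
    ext i; simpa using hσ i b
  rw [orderedComp, orderedComp, h1, hp]
  generalize (hT b).toFinset.sort (· ≤ ·) = l
  generalize p b = a
  induction l generalizing a with
  | nil => rfl
  | cons i l ih => rw [List.foldl_cons, List.foldl_cons, hF, ih]

end Fold

/-! ### From local descent to an equivariant global descent -/

section Descent

variable {α : Type*} [TopologicalSpace α] [T2Space α] [ParacompactSpace α]

/-- Local deformations that lower `Φ` near each point of `s` combine to a global one that lowers `Φ`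
on `s`: at each point, finitely many local deformations are performed one after the other, with
durations that depend continuously on the starting point. -/
theorem exists_global_descent {Φ : α → ℝ} {s : Set α} (hs : IsClosed s) {Q : α → α → Prop}
    (hrefl : ∀ x, Q x x) (htrans : ∀ x y z, Q x y → Q y z → Q x z)
    (hloc : ∀ u ∈ s, ∃ H : ℝ → α → α, (Continuous fun q : ℝ × α => H q.1 q.2) ∧
      (∀ x, H 0 x = x) ∧ (∀ t x, Q x (H t x)) ∧ (∀ t x, H t x = x ∨ Φ (H t x) < Φ x) ∧
      {x | Φ (H 1 x) < Φ x} ∈ 𝓝 u) :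
    ∃ S : ℝ → α → α, (Continuous fun q : ℝ × α => S q.1 q.2) ∧ (∀ x, S 0 x = x) ∧
      (∀ t x, Q x (S t x)) ∧ ∀ x ∈ s, Φ (S 1 x) < Φ x := by
  choose! H hc h0 hQ hdrop hnhds using hloc
  obtain ⟨f, hf⟩ := BumpCovering.exists_isSubordinate hs
    (fun u : s => interior {x | Φ (H u 1 x) < Φ x}) (fun _ => isOpen_interior)
    (fun u hu => mem_iUnion.2 ⟨⟨u, hu⟩, mem_interior_iff_mem_nhds.2 (hnhds u hu)⟩)
  classical
  let : LinearOrder s := linearOrderOfSTO WellOrderingRel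
  let T : s → Set (ℝ × α) := fun i => Prod.snd ⁻¹' Function.support (f i)
  have hT : LocallyFinite T := f.locallyFinite.preimage_continuous continuous_snd
  let F : s → ℝ × α → α → α := fun i q x => H i (q.1 * f i q.2) x
  let P := orderedComp T hT.point_finite F Prod.snd
  have hid : ∀ i b x, b ∉ T i → F i b x = x := by
    intro i b x hb
    have : f i b.2 = 0 := by simpa [T] using hb
    simp only [F, this, mul_zero]
    exact h0 i i.2 x
  refine ⟨fun t x => P (t, x), ?_, fun x => ?_, fun t x => ?_, fun x hx => ?_⟩
  · refine continuous_orderedComp hT hid (fun i => ?_) continuous_snd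
    exact (hc i i.2).comp (by fun_prop : Continuous fun q : (ℝ × α) × α =>
      (q.1.1 * f i q.1.2, q.2))
  · exact (orderedComp_rel (p := Prod.snd) hT.point_finite (W := Eq) (fun _ => rfl)
      (fun _ _ _ => Eq.trans) (0, x) fun i y => by
        simp only [F, zero_mul]; exact (h0 i i.2 y).symm).symm
  · exact orderedComp_rel (p := Prod.snd) hT.point_finite (W := Q) hrefl htrans (t, x)
      fun i y => hQ i i.2 _ y
  · have h1 := f.ind_apply x hx
    set i := f.ind x hx
    have hmem : ((1, x) : ℝ × α) ∈ T i := by simp [T, h1]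
    -- Either a previous deformation has moved `x` and lowered `Φ`, or the `i`-th one does so.
    obtain ⟨y, hy, hy'⟩ := exists_orderedComp_rel (p := Prod.snd) (F := F) hT.point_finite
      (W := fun x y => y = x ∨ Φ y < Φ x) (fun _ => Or.inl rfl)
      (fun a b c hab hbc => by
        rcases hab with rfl | hab
        · exact hbc
        · rcases hbc with rfl | hbc
          · exact Or.inr hab
          · exact Or.inr (hbc.trans hab)) (b := (1, x)) (fun j z => hdrop j j.2 _ z) hmem
    have hFle : Φ (P (1, x)) ≤ Φ (F i (1, x) y) := by
      rcases hy' with h | h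
      · exact (congrArg Φ h).le
      · exact h.le
    have hFy : Φ (F i (1, x) y) ≤ Φ y := by
      rcases hdrop i i.2 (1 * f i x) y with h | h
      · exact (congrArg Φ h).le
      · exact h.le
    rcases hy with hyx | hy
    · refine hFle.trans_lt ?_
      rw [show y = x from hyx]
      simp only [F, h1, mul_one]
      have hsub : x ∈ tsupport (f i) := subset_tsupport _ (by simp [h1])
      have hx1 : x ∈ {x | Φ (H i 1 x) < Φ x} := interior_subset (hf i hsub)
      exact hx1
    · exact (hFle.trans hFy).trans_lt hy

/-- If each orbit of the time-one map of `S` leaves `s`, then `S` can be run for so long, depending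
continuously on the starting point, that each trajectory has left `s` at some time. -/
theorem exists_long_descent {s : Set α} (hs : IsClosed s) {Q : α → α → Prop}
    (hrefl : ∀ x, Q x x) (htrans : ∀ x y z, Q x y → Q y z → Q x z) {S : ℝ → α → α}
    (hc : Continuous fun q : ℝ × α => S q.1 q.2) (h0 : ∀ x, S 0 x = x) (hQ : ∀ t x, Q x (S t x))
    (hexit : ∀ x, ∃ n : ℕ, (S 1)^[n] x ∉ s) :
    ∃ E : ℝ → α → α, (Continuous fun q : ℝ × α => E q.1 q.2) ∧ (∀ x, E 0 x = x) ∧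
      (∀ t x, Q x (E t x)) ∧ ∀ x, ∃ z, z ∉ s ∧ Q x z ∧ Q z (E 1 x) := by
  have hc1 : Continuous (S 1) := hc.comp (continuous_const.prodMk continuous_id)
  -- A continuous bound `τ` for the number of steps after which a point has left `s`.
  obtain ⟨τ, hτ⟩ := exists_continuous_forall_mem_convex_of_local_const
    (t := fun x => {r : ℝ | ∃ n : ℕ, (n : ℝ) ≤ r ∧ (S 1)^[n] x ∉ s})
    (fun x => by
      refine OrdConnected.convex ⟨?_⟩
      rintro a ⟨n, hn, hn'⟩ b - r hr
      exact ⟨n, hn.trans hr.1, hn'⟩)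
    (fun x => by
      obtain ⟨n, hn⟩ := hexit x
      refine ⟨n, ?_⟩
      filter_upwards [(hc1.iterate n).continuousAt.preimage_mem_nhds (hs.isOpen_compl.mem_nhds hn)]
        with y hy using ⟨n, le_rfl, hy⟩)
  let clip : ℝ → ℝ := fun r => max 0 (min r 1)
  have hclip : Continuous clip := by fun_prop
  -- `e N (t, x)` is the position of `x` after the time `min N (t * τ x)`.
  let e : ℕ → ℝ × α → α := fun N q =>
    Nat.rec q.2 (fun N y => S (clip (q.1 * τ q.2 - N)) y) N
  have es : ∀ N q, e (N + 1) q = S (clip (q.1 * τ q.2 - N)) (e N q) := fun N q => rfl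
  have ec : ∀ N, Continuous (e N) := by
    intro N
    induction N with
    | zero => exact continuous_snd
    | succ N ih =>
      have : Continuous fun q : ℝ × α => clip (q.1 * τ q.2 - N) := by fun_prop
      exact hc.comp (this.prodMk ih)
  have eQ : ∀ (q : ℝ × α) (N K : ℕ), Q (e N q) (e (N + K) q) := by
    intro q N K
    induction K with
    | zero => exact hrefl _
    | succ K ih => exact htrans _ _ _ ih (hQ _ _)
  have est : ∀ (q : ℝ × α) (N K : ℕ), q.1 * τ q.2 ≤ N → e (N + K) q = e N q := by
    intro q N K h
    induction K with
    | zero => rfl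
    | succ K ih =>
      have : clip (q.1 * τ q.2 - (N + K : ℕ)) = 0 := by
        refine max_eq_left ((min_le_left _ _).trans ?_)
        push_cast
        have : (0 : ℝ) ≤ K := Nat.cast_nonneg K
        linarith
      rw [← add_assoc, es, this, h0, ih]
  have eit : ∀ x (N : ℕ), (N : ℝ) ≤ τ x → e N (1, x) = (S 1)^[N] x := by
    intro x N
    induction N with
    | zero => intro _; rfl
    | succ N ih =>
      intro h
      push_cast at h
      have : clip (1 * τ x - N) = 1 := by
        simp only [clip, one_mul]
        rw [min_eq_right (by linarith), max_eq_right zero_le_one]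
      rw [es, this, ih (by linarith), Function.iterate_succ_apply']
  let E : ℝ → α → α := fun t x => e ⌈t * τ x⌉₊ (t, x)
  have hE : ∀ (q : ℝ × α) (N : ℕ), q.1 * τ q.2 ≤ N → E q.1 q.2 = e N q := by
    intro q N h
    obtain ⟨K, hK⟩ := Nat.exists_eq_add_of_le (Nat.ceil_le.2 h)
    simp only [E]
    rw [hK, est _ _ _ (Nat.le_ceil _)]
  refine ⟨E, ?_, fun x => ?_, fun t x => ?_, fun x => ?_⟩
  · rw [continuous_iff_continuousAt]
    intro q
    obtain ⟨N, hN⟩ := exists_nat_gt (q.1 * τ q.2)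
    refine (ec N).continuousAt.congr ?_
    have : Continuous fun q : ℝ × α => q.1 * τ q.2 := by fun_prop
    filter_upwards [this.continuousAt.eventually (gt_mem_nhds hN)] with q' hq'
      using (hE q' N hq'.le).symm
  · exact hE (0, x) 0 (by simp)
  · simpa [E, e] using eQ (t, x) 0 ⌈t * τ x⌉₊
  · obtain ⟨n, hn, hns⟩ := hτ x
    refine ⟨(S 1)^[n] x, hns, ?_, ?_⟩
    · rw [← eit x n hn]
      simpa [e] using eQ (1, x) 0 n
    · rw [← eit x n hn]
      obtain ⟨K, hK⟩ := Nat.exists_eq_add_of_le (Nat.cast_le (α := ℝ).1 (hn.trans (Nat.le_ceil _)))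
      have h1 := hE (1, x) ⌈τ x⌉₊ (by simpa using Nat.le_ceil (τ x))
      simp only at h1
      rw [h1, hK]
      exact eQ _ _ _

/-- A deformation `E` can be made odd with respect to a free involution: `E` and its conjugate under
the involution are performed alternately, for the durations `f i u` and `f i (neg u)`, where `u` is
the starting point and the bump functions `f i` have supports disjoint from their images under the
involution. Nothing is assumed on how `E` is related to the involution. -/
theorem exists_odd_descent {s : Set α} {W : α → α → Prop}
    (hrefl : ∀ x, W x x) (htrans : ∀ x y z, W x y → W y z → W x z)
    {neg : α → α} (hneg : Continuous neg) (hinv : ∀ x, neg (neg x) = x) (hfree : ∀ x, neg x ≠ x)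
    (hW : ∀ x y, W x y → W (neg x) (neg y)) {E : ℝ → α → α}
    (hc : Continuous fun q : ℝ × α => E q.1 q.2) (h0 : ∀ x, E 0 x = x) (hE : ∀ t x, W x (E t x))
    (hexit : ∀ x, ∃ z, z ∉ s ∧ W x z ∧ W z (E 1 x)) :
    ∃ P : α → α, Continuous P ∧ (∀ x, P (neg x) = neg (P x)) ∧
      ∀ x, ∃ z, z ∉ s ∧ W x z ∧ W z (P x) := by
  have hV : ∀ u : α, ∃ V : Set α, IsOpen V ∧ u ∈ V ∧ ∀ x ∈ V, neg x ∉ V := by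
    intro u
    obtain ⟨A, A', hA, hA', hu, hu', hd⟩ := t2_separation (hfree u).symm
    refine ⟨A ∩ neg ⁻¹' A', hA.inter (hA'.preimage hneg), ⟨hu, hu'⟩, fun x hx hx' => ?_⟩
    exact disjoint_left.1 hd hx'.1 hx.2
  choose V hVo huV hVneg using hV
  obtain ⟨f, hf⟩ := BumpCovering.exists_isSubordinate (s := univ) isClosed_univ V hVo
    (fun u _ => mem_iUnion.2 ⟨u, huV u⟩)
  classical
  let : LinearOrder α := linearOrderOfSTO WellOrderingRel
  -- At each point, at most one of `E` and its conjugate is active for a given label `i`.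
  have hf0 : ∀ i x, f i x ≠ 0 → f i (neg x) = 0 := by
    intro i x hx
    by_contra h
    exact hVneg i x (hf i (subset_tsupport _ hx)) (hf i (subset_tsupport _ h))
  let T : α → Set α := fun i => Function.support (f i) ∪ neg ⁻¹' Function.support (f i)
  have hT : LocallyFinite T := by
    intro x
    obtain ⟨N, hN, h1⟩ := f.locallyFinite x
    obtain ⟨N', hN', h2⟩ := (f.locallyFinite.preimage_continuous hneg) x
    refine ⟨N ∩ N', inter_mem hN hN', (h1.union h2).subset ?_⟩
    rintro i ⟨y, hy | hy, hyN⟩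
    · exact Or.inl ⟨y, hy, hyN.1⟩
    · exact Or.inr ⟨y, hy, hyN.2⟩
  let F : α → α → α → α := fun i u x => neg (E (f i (neg u)) (neg (E (f i u) x)))
  have hid : ∀ i b x, b ∉ T i → F i b x = x := by
    intro i b x hb
    have h1 : f i b = 0 := by by_contra h; exact hb (Or.inl h)
    have h2 : f i (neg b) = 0 := by by_contra h; exact hb (Or.inr h)
    simp only [F, h1, h2, h0, hinv]
  have hWF : ∀ i b x, W x (F i b x) := by
    intro i b x
    refine htrans _ _ _ (hE (f i b) x) ?_
    have := hW _ _ (hE (f i (neg b)) (neg (E (f i b) x)))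
    rwa [hinv] at this
  refine ⟨orderedComp T hT.point_finite F id, ?_, ?_, fun u => ?_⟩
  · refine continuous_orderedComp hT hid (fun i => ?_) continuous_id
    have h1 : Continuous fun q : α × α => E (f i q.1) q.2 :=
      hc.comp (by fun_prop : Continuous fun q : α × α => (f i q.1, q.2))
    have h2 : Continuous fun q : α × α => (f i (neg q.1), neg (E (f i q.1) q.2)) := by fun_prop
    exact hneg.comp (hc.comp h2)
  · refine orderedComp_equivariant hT.point_finite (fun i b => ?_) (fun b => rfl) fun i b x => ?_
    · simp only [T, mem_union, mem_preimage, hinv]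
      exact or_comm
    · by_cases h : f i b = 0
      · simp only [F, hinv, h, h0]
      · simp only [F, hinv, hf0 i b h, h0]
  · have h1 := f.ind_apply u (mem_univ u)
    set i := f.ind u (mem_univ u)
    have hne : f i u ≠ 0 := by rw [h1]; exact one_ne_zero
    obtain ⟨x, hx, hx'⟩ := exists_orderedComp_rel (p := id) hT.point_finite hrefl htrans (b := u)
      (fun i x => hWF i u x) (i := i) (Or.inl hne)
    obtain ⟨z, hz, hxz, hz'⟩ := hexit x
    refine ⟨z, hz, htrans _ _ _ hx hxz, htrans _ _ _ hz' ?_⟩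
    simpa only [F, h1, hf0 i u hne, h0, hinv] using hx'

/-- The abstract deformation theorem. The relation `Q` expresses the control on the deformation that
makes the iterates converge as long as they stay in `s`; the weaker relation `W` is compatible with
the involution `neg`, and is the control that survives for the odd deformation. -/
theorem exists_odd_map_of_local_descent {Φ : α → ℝ} {s : Set α}
    (hs : IsClosed s) {Q W : α → α → Prop} (hQrefl : ∀ x, Q x x)
    (hQtrans : ∀ x y z, Q x y → Q y z → Q x z) (hWtrans : ∀ x y z, W x y → W y z → W x z)
    (hQW : ∀ x y, Q x y → W x y)
    {neg : α → α} (hneg : Continuous neg) (hinv : ∀ x, neg (neg x) = x) (hfree : ∀ x, neg x ≠ x)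
    (hW : ∀ x y, W x y → W (neg x) (neg y))
    (hloc : ∀ u ∈ s, ∃ H : ℝ → α → α, (Continuous fun q : ℝ × α => H q.1 q.2) ∧
      (∀ x, H 0 x = x) ∧ (∀ t x, Q x (H t x)) ∧ (∀ t x, H t x = x ∨ Φ (H t x) < Φ x) ∧
      {x | Φ (H 1 x) < Φ x} ∈ 𝓝 u)
    (hlim : ∀ x : ℕ → α, (∀ n, x n ∈ s) → (∀ n, Q (x n) (x (n + 1))) →
      ∃ y, Tendsto x atTop (𝓝 y)) :
    ∃ P : α → α, Continuous P ∧ (∀ x, P (neg x) = neg (P x)) ∧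
      ∀ x, ∃ z, z ∉ s ∧ W x z ∧ W z (P x) := by
  obtain ⟨S, hc, h0, hQ, hdrop⟩ := exists_global_descent hs hQrefl hQtrans hloc
  have hc1 : Continuous (S 1) := hc.comp (continuous_const.prodMk continuous_id)
  have hexit : ∀ x, ∃ n : ℕ, (S 1)^[n] x ∉ s := by
    intro x
    by_contra! hcon
    obtain ⟨y, hy⟩ := hlim (fun n => (S 1)^[n] x) hcon fun n => by
      rw [Function.iterate_succ_apply']; exact hQ 1 _
    have hys : y ∈ s := hs.mem_of_tendsto hy (Eventually.of_forall hcon)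
    have hy1 : Tendsto (fun n => S 1 ((S 1)^[n] x)) atTop (𝓝 (S 1 y)) :=
      (hc1.tendsto y).comp hy
    have hy2 := hy.comp (tendsto_add_atTop_nat 1)
    have : S 1 y = y := tendsto_nhds_unique hy1 (hy2.congr fun n => by
      simp only [Function.comp_apply]
      rw [Function.iterate_succ_apply'])
    exact absurd (hdrop y hys) (by rw [this]; exact lt_irrefl _)
  obtain ⟨E, hEc, hE0, hEQ, hEexit⟩ := exists_long_descent hs hQrefl hQtrans hc h0 hQ hexit
  exact exists_odd_descent (fun x => hQW _ _ (hQrefl x)) hWtrans hneg hinv hfree hW hEc hE0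
    (fun t x => hQW _ _ (hEQ t x)) fun x => by
      obtain ⟨z, h1, h2, h3⟩ := hEexit x
      exact ⟨z, h1, hQW _ _ h2, hQW _ _ h3⟩

end Descent

/-! ### The genus -/

section Genus

variable {X : Type*} [NormedAddCommGroup X]

theorem exists_of_genus_ne_top {Z : Set X} (h : genus Z ≠ ⊤) :
    ∃ k : ℕ, (k : ℕ∞) = genus Z ∧ ∃ f : X → EuclideanSpace ℝ (Fin k), ContinuousOn f Z ∧
      MapsTo f Z (Metric.sphere 0 1) ∧ ∀ x ∈ Z, f (-x) = -f x := by
  obtain ⟨n, hn⟩ := ENat.ne_top_iff_exists.1 h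
  have hlt : genus Z < ((n + 1 : ℕ) : ℕ∞) := by rw [← hn]; exact_mod_cast n.lt_succ_self
  obtain ⟨k, hk⟩ := iInf_lt_iff.1 hlt
  obtain ⟨hf, hk⟩ := iInf_lt_iff.1 hk
  refine ⟨k, le_antisymm ?_ (iInf₂_le k hf), hf⟩
  rw [← hn]
  exact_mod_cast Nat.lt_succ_iff.1 (by exact_mod_cast hk)

/-- An odd map without zeros into `ℝ^ι` can be normalized. -/
theorem genus_le_card {ι : Type*} [Fintype ι] {Z : Set X}
    {f : X → ι → ℝ} (hf : ContinuousOn f Z) (h0 : ∀ x ∈ Z, f x ≠ 0)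
    (hodd : ∀ x ∈ Z, f (-x) = -f x) : genus Z ≤ Fintype.card ι := by
  let e := Fintype.equivFin ι
  let g : X → EuclideanSpace ℝ (Fin (Fintype.card ι)) := fun x =>
    WithLp.toLp 2 fun j => f x (e.symm j)
  have hg : ContinuousOn g Z := by
    refine (PiLp.continuous_toLp 2 _).comp_continuousOn ?_
    exact continuousOn_pi.2 fun j => (continuous_apply (e.symm j)).comp_continuousOn hf
  have hg0 : ∀ x ∈ Z, g x ≠ 0 := by
    intro x hx h
    refine h0 x hx (funext fun i => ?_)
    have := congrArg (fun v : EuclideanSpace ℝ (Fin (Fintype.card ι)) => v (e i)) h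
    simpa [g] using this
  have hgodd : ∀ x ∈ Z, g (-x) = -g x := by
    intro x hx
    ext j
    simp [g, hodd x hx]
  refine iInf₂_le (Fintype.card ι) ⟨fun x => ‖g x‖⁻¹ • g x, ?_, fun x hx => ?_, fun x hx => ?_⟩
  · exact (hg.norm.inv₀ fun x hx => norm_ne_zero_iff.2 (hg0 x hx)).smul hg
  · rw [mem_sphere_zero_iff_norm, norm_smul, norm_inv, norm_norm,
      inv_mul_cancel₀ (norm_ne_zero_iff.2 (hg0 x hx))]
  · simp only [hgodd x hx, norm_neg, smul_neg]

theorem genus_le_of_odd_map {Y A : Set X} {P : X → X} (hP : ContinuousOn P Y) (hYA : MapsTo P Y A)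
    (hodd : ∀ x ∈ Y, P (-x) = -P x) : genus Y ≤ genus A := by
  by_cases h : genus A = ⊤
  · simp [h]
  obtain ⟨k, hk, f, hf, hfA, hfodd⟩ := exists_of_genus_ne_top h
  rw [← hk]
  refine iInf₂_le k ⟨f ∘ P, hf.comp hP hYA, hfA.comp hYA, fun x hx => ?_⟩
  simp only [Function.comp_apply, hodd x hx, hfodd _ (hYA hx)]

theorem genus_mono {Y A : Set X} (h : Y ⊆ A) : genus Y ≤ genus A :=
  genus_le_of_odd_map continuousOn_id h fun _ _ => rfl

/-- Multiplication by a continuous function that vanishes outside of `A₁` extends the unit vector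
field `h`, which is continuous on `A₁` only, by zero. -/
theorem continuousOn_smul_of_support {Y : Type*} [NormedAddCommGroup Y] [NormedSpace ℝ Y]
    {A A₁ : Set X} {a : X → ℝ} {h : X → Y} (ha : ContinuousOn a A) (hA : ∀ x ∈ A, a x ≠ 0 → x ∈ A₁)
    (hh : ContinuousOn h A₁) (h1 : ∀ x ∈ A₁, ‖h x‖ = 1) : ContinuousOn (fun x => a x • h x) A := by
  intro x hx
  by_cases hax : a x = 0
  · have hlim : Tendsto (fun y => ‖a y‖) (𝓝[A] x) (𝓝 0) := by
      simpa [hax] using (ha x hx).norm.tendsto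
    rw [ContinuousWithinAt, hax, zero_smul]
    refine squeeze_zero_norm' ?_ hlim
    filter_upwards [self_mem_nhdsWithin] with y hy
    by_cases hay : a y = 0
    · simp [hay]
    · simp [norm_smul, h1 y (hA y hy hay)]
  · refine (ha x hx).smul ?_
    refine (hh x (hA x hx hax)).mono_of_mem_nhdsWithin ?_
    filter_upwards [self_mem_nhdsWithin, (ha x hx).eventually_ne hax] with y hy hay
      using hA y hy hay

/-- Subadditivity of the genus, for two sets that are the supports of even continuous functions. -/
theorem genus_le_add {A A₁ A₂ : Set X} {a₁ a₂ : X → ℝ}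
    (ha₁ : ContinuousOn a₁ A)
    (ha₂ : ContinuousOn a₂ A) (he₁ : ∀ x ∈ A, a₁ (-x) = a₁ x) (he₂ : ∀ x ∈ A, a₂ (-x) = a₂ x)
    (h₁ : ∀ x ∈ A, a₁ x ≠ 0 → x ∈ A₁) (h₂ : ∀ x ∈ A, a₂ x ≠ 0 → x ∈ A₂)
    (h : ∀ x ∈ A, a₁ x ≠ 0 ∨ a₂ x ≠ 0) : genus A ≤ genus A₁ + genus A₂ := by
  by_cases ht₁ : genus A₁ = ⊤
  · simp [ht₁]
  by_cases ht₂ : genus A₂ = ⊤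
  · simp [ht₂]
  obtain ⟨k₁, hk₁, f₁, hf₁, hs₁, ho₁⟩ := exists_of_genus_ne_top ht₁
  obtain ⟨k₂, hk₂, f₂, hf₂, hs₂, ho₂⟩ := exists_of_genus_ne_top ht₂
  have hn₁ : ∀ x ∈ A₁, ‖f₁ x‖ = 1 := fun x hx => mem_sphere_zero_iff_norm.1 (hs₁ hx)
  have hn₂ : ∀ x ∈ A₂, ‖f₂ x‖ = 1 := fun x hx => mem_sphere_zero_iff_norm.1 (hs₂ hx)
  have hodd : ∀ {k : ℕ} {a : X → ℝ} {f : X → EuclideanSpace ℝ (Fin k)} {A' : Set X},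
      (∀ x ∈ A, a (-x) = a x) → (∀ x ∈ A, a x ≠ 0 → x ∈ A') → (∀ x ∈ A', f (-x) = -f x) →
      ∀ x ∈ A, a (-x) • f (-x) = -(a x • f x) := by
    intro k a f A' he hs ho x hx
    rw [he x hx]
    by_cases hax : a x = 0
    · simp [hax]
    · rw [ho x (hs x hx hax), smul_neg]
  have hne : ∀ {k : ℕ} {a : ℝ} {v : EuclideanSpace ℝ (Fin k)}, a ≠ 0 → ‖v‖ = 1 → a • v ≠ 0 := by
    intro k a v ha hv h0
    rcases smul_eq_zero.1 h0 with h | h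
    · exact ha h
    · simp [h] at hv
  have key := genus_le_card (Z := A)
    (f := fun x => Sum.elim (a₁ x • f₁ x).ofLp (a₂ x • f₂ x).ofLp) ?_ ?_ ?_
  · rw [Fintype.card_sum, Fintype.card_fin, Fintype.card_fin, Nat.cast_add, hk₁, hk₂] at key
    exact key
  · refine continuousOn_pi.2 fun i => ?_
    rcases i with i | i
    · exact ((continuous_apply i).comp (PiLp.continuous_ofLp 2 _)).comp_continuousOn
        (continuousOn_smul_of_support ha₁ h₁ hf₁ hn₁)
    · exact ((continuous_apply i).comp (PiLp.continuous_ofLp 2 _)).comp_continuousOn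
        (continuousOn_smul_of_support ha₂ h₂ hf₂ hn₂)
  · intro x hx h0
    rcases h x hx with hx' | hx'
    · refine hne hx' (hn₁ x (h₁ x hx hx')) ?_
      ext i
      simpa using congrFun h0 (Sum.inl i)
    · refine hne hx' (hn₂ x (h₂ x hx hx')) ?_
      ext i
      simpa using congrFun h0 (Sum.inr i)
  · intro x hx
    simp only
    rw [hodd he₁ h₁ ho₁ x hx, hodd he₂ h₂ ho₂ x hx]
    ext i
    rcases i with i | i <;> simp

end Genus

/-! ### A compactness lemma -/

/-- Let `K` be sequentially compact for the pseudo-distance `D`. Then finitely many of the `D`-balls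
of radii `r v` about the points `v` of `K` cover a uniform neighborhood of `K`. -/
theorem exists_finite_cover {α : Type*} (D : α → α → ℝ≥0∞) (hself : ∀ x, D x x = 0)
    (hcomm : ∀ x y, D x y = D y x) (htri : ∀ x y z, D x z ≤ D x y + D y z) {K : Set α}
    (hK : ∀ u : ℕ → α, (∀ n, u n ∈ K) → ∃ v ∈ K, ∃ φ : ℕ → ℕ, StrictMono φ ∧
      Tendsto (fun n => D (u (φ n)) v) atTop (𝓝 0))
    {r : α → ℝ≥0∞} (hr : ∀ v ∈ K, 0 < r v) :
    ∃ t : Finset α, (∀ v ∈ t, v ∈ K) ∧ ∃ ρ : ℝ≥0∞, 0 < ρ ∧ ρ ≠ ⊤ ∧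
      ∀ w, ∀ v ∈ K, D w v < ρ → ∃ v' ∈ t, D w v' < r v' := by
  let inst : PseudoEMetricSpace α :=
    { edist := D, edist_self := hself, edist_comm := hcomm, edist_triangle := htri }
  have hseq : IsSeqCompact K := by
    intro u hu
    obtain ⟨v, hv, φ, hφ, hlim⟩ := hK u hu
    exact ⟨v, hv, φ, hφ, tendsto_iff_edist_tendsto_0.2 hlim⟩
  obtain ⟨t, htK, hcov⟩ := hseq.isCompact.elim_nhds_subcover (fun v => Metric.eball v (r v))
    fun v hv => Metric.eball_mem_nhds v (hr v hv)
  obtain ⟨δ, hδ, hsub⟩ := hseq.isCompact.exists_thickening_subset_open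
    (isOpen_biUnion fun v (_ : v ∈ t) => Metric.isOpen_eball) hcov
  refine ⟨t, htK, ENNReal.ofReal δ, by simpa using hδ, ENNReal.ofReal_ne_top,
    fun w v hv hwv => ?_⟩
  have hw : w ∈ Metric.thickening δ K := Metric.infEDist_lt_iff.2 ⟨v, hv, hwv⟩
  obtain ⟨v', hv', h⟩ := mem_iUnion₂.1 (hsub hw)
  exact ⟨v', hv', h⟩

/-! ### Symmetries -/

section

variable {X : Type*} [NormedAddCommGroup X] [InnerProductSpace ℝ X]
  {B : X → LinearMap.BilinForm ℝ X} {M : Set X} {Φ : X → ℝ}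

theorem mdist_map_le {L : X →L[ℝ] X} (hL : ∀ u ∈ M, L u ∈ M)
    (hn : ∀ u ∈ M, ∀ v, normAt B (L u) (L v) = normAt B u v) (u v : X) :
    mdist M B (L u) (L v) ≤ mdist M B u v := by
  refine le_of_forall_gt fun r hr => ?_
  obtain ⟨γ, h1, h2, rfl, rfl, h5⟩ := exists_curve_of_mdist_lt hr
  refine lt_of_le_of_lt ?_ h5
  refine (mdist_le_curveLength (B := B) (M := M) (γ := L ∘ γ)
    (L.contDiff.comp_contDiffOn h1) fun s hs => hL _ (h2 hs)).trans (le_of_eq ?_)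
  refine setLIntegral_congr_fun measurableSet_Icc fun s hs => ?_
  have hd := (h1.differentiableOn one_ne_zero s hs).hasDerivWithinAt
  have hd' : HasDerivWithinAt (L ∘ γ) (L (derivWithin γ (Icc 0 1) s)) (Icc 0 1) s :=
    L.hasFDerivAt.comp_hasDerivWithinAt s hd
  rw [hd'.derivWithin (uniqueDiffOn_Icc_zero_one s hs), Function.comp_apply, hn _ (h2 hs)]

theorem map_mem_tangentSpaceAt {L : X →L[ℝ] X} (hL : ∀ u ∈ M, L u ∈ M) {u v : X}
    (hv : v ∈ tangentSpaceAt M u) : L v ∈ tangentSpaceAt M (L u) := by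
  obtain ⟨γ, h0, hd, hγ⟩ := hv
  exact ⟨L ∘ γ, by simp [h0], L.hasFDerivAt.comp_hasDerivAt 0 hd, hγ.mono fun t ht => hL _ ht⟩

theorem differential_map (hΦ : IsC11OnManifold M Φ) {L : X →L[ℝ] X} (hL : ∀ u ∈ M, L u ∈ M)
    (hΦL : ∀ u ∈ M, Φ (L u) = Φ u) {u v : X} (hu : u ∈ M) (hv : v ∈ tangentSpaceAt M u) :
    differential M Φ (L u) (L v) = differential M Φ u v := by
  obtain ⟨γ, h0, hd, hγ⟩ := hv
  have h1 := hasDerivAt_comp_differential hΦ hu h0 hd hγ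
  have h2 := hasDerivAt_comp_differential hΦ (hL u hu) (γ := L ∘ γ) (by simp [h0])
    (L.hasFDerivAt.comp_hasDerivAt 0 hd) (hγ.mono fun t ht => hL _ ht)
  refine h2.unique (h1.congr_of_eventuallyEq ?_)
  filter_upwards [hγ] with t ht using hΦL _ ht

/-- The sum of the scalar product at `u` and the one at `-u`. The family `B` itself is not assumed
to be even; the distance of the symmetrized family is invariant under `u ↦ -u`. -/
noncomputable def symmetrize (B : X → LinearMap.BilinForm ℝ X) (u : X) : LinearMap.BilinForm ℝ X :=
  B u + B (-u)

theorem normAt_symmetrize_neg (u v : X) :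
    normAt (symmetrize B) (-u) (-v) = normAt (symmetrize B) u v := by
  simp [normAt, symmetrize, add_comm]

theorem IsAdmissible.normAt_le_symmetrize (hB : IsAdmissible B) {u : X} (hu : u ≠ 0) (v : X) :
    normAt B u v ≤ normAt (symmetrize B) u v := by
  refine Real.sqrt_le_sqrt ?_
  simpa [symmetrize] using (hB.scalar (-u) (neg_ne_zero.2 hu)).self_nonneg v

theorem IsAdmissible.normAt_symmetrize_le (hB : IsAdmissible B) {u : X} (hu : u ≠ 0) (v : X) :
    normAt (symmetrize B) u v ≤ normAt B u v + normAt B (-u) v := by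
  refine Real.sqrt_le_iff.2 ⟨add_nonneg (normAt_nonneg ..) (normAt_nonneg ..), ?_⟩
  rw [add_sq, hB.sq_normAt hu, hB.sq_normAt (neg_ne_zero.2 hu), symmetrize, LinearMap.add_apply,
    LinearMap.add_apply]
  nlinarith [mul_nonneg (normAt_nonneg B u v) (normAt_nonneg B (-u) v)]

theorem IsAdmissible.symmetrize (hB : IsAdmissible B) : IsAdmissible (symmetrize B) where
  scalar u hu := by
    have h1 := hB.scalar u hu
    have h2 := hB.scalar (-u) (neg_ne_zero.2 hu)
    refine ⟨fun v w => ?_, fun v hv => ?_⟩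
    · simp only [EquivariantLS.symmetrize, LinearMap.add_apply, h1.1 v w, h2.1 v w]
    · simpa [EquivariantLS.symmetrize] using add_pos (h1.2 v hv) (h2.2 v hv)
  equiv u hu := by
    obtain ⟨ρ, hρ, C, hC, h⟩ := hB.exists_ball hu
    obtain ⟨ρ', hρ', C', hC', h'⟩ := hB.exists_ball (neg_ne_zero.2 hu)
    refine ⟨Metric.ball u (min ρ ρ'), Metric.ball_mem_nhds _ (lt_min hρ hρ'), fun x hx =>
      (h x (Metric.ball_subset_ball (min_le_left _ _) hx)).1, C + C', by positivity,
      fun x hx v => ?_⟩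
    obtain ⟨hx0, hx1⟩ := h x (Metric.ball_subset_ball (min_le_left _ _) hx)
    have hxn : -x ∈ Metric.ball (-u) ρ' := by
      rw [Metric.mem_ball, dist_neg_neg]; exact hx.trans_le (min_le_right _ _)
    obtain ⟨-, hx2⟩ := h' (-x) hxn
    have hle := hB.normAt_le_symmetrize hx0 v
    constructor
    · rw [one_div, inv_mul_le_iff₀ (by positivity)]
      nlinarith [(hx1 v).1, normAt_nonneg (EquivariantLS.symmetrize B) x v]
    · nlinarith [hB.normAt_symmetrize_le hx0 v, (hx1 v).2, (hx2 v).2]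
  lip u hu := by
    obtain ⟨U, hU, hU0, C, hC, h⟩ := hB.lip u hu
    obtain ⟨U', hU', -, C', hC', h'⟩ := hB.lip (-u) (neg_ne_zero.2 hu)
    refine ⟨U ∩ Neg.neg ⁻¹' U', inter_mem hU (continuous_neg.continuousAt.preimage_mem_nhds hU'),
      inter_subset_left.trans hU0, C + C', by positivity, fun x hx y hy v w => ?_⟩
    have h1 := h x hx.1 y hy.1 v w
    have h2 := h' (-x) hx.2 (-y) hy.2 v w
    rw [show -x - -y = -(x - y) by abel, norm_neg] at h2
    simp only [EquivariantLS.symmetrize, LinearMap.add_apply]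
    calc |B x v w + B (-x) v w - (B y v w + B (-y) v w)|
        = |(B x v w - B y v w) + (B (-x) v w - B (-y) v w)| := by ring_nf
      _ ≤ _ := abs_add_le _ _
      _ ≤ _ := add_le_add h1 h2
      _ = _ := by ring

/-- The standing assumptions: the family `B` is admissible and invariant, the manifold is a
symmetric and invariant submanifold that avoids the origin, and the functional is even and
invariant. -/
structure IsEquivariantSetting (G : Type*) [Group G] [DistribMulAction G X]
    (B : X → LinearMap.BilinForm ℝ X) (M : Set X) (Φ : X → ℝ) : Prop where
  adm : IsAdmissible B
  form_smul : ∀ (g : G) (u v w : X), u ≠ 0 → v ≠ 0 → w ≠ 0 →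
    B (g • u) (g • v) (g • w) = B u v w
  subm : IsC11Submanifold M
  zero_notMem : (0 : X) ∉ M
  neg_mem : ∀ u ∈ M, -u ∈ M
  smul_mem : ∀ (g : G), ∀ u ∈ M, g • u ∈ M
  c11 : IsC11OnManifold M Φ
  even : ∀ u ∈ M, Φ (-u) = Φ u
  invariant : ∀ (g : G), ∀ u ∈ M, Φ (g • u) = Φ u

namespace IsEquivariantSetting

variable {G : Type*} [Group G] [DistribMulAction G X]

theorem ne_zero (h : IsEquivariantSetting G B M Φ) {u : X} (hu : u ∈ M) : u ≠ 0 :=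
  ne_of_mem_of_not_mem hu h.zero_notMem

theorem normAt_smul_smul (h : IsEquivariantSetting G B M Φ) (g : G) {u : X} (hu : u ∈ M) (v : X) :
    normAt B (g • u) (g • v) = normAt B u v := by
  rcases eq_or_ne v 0 with rfl | hv
  · simp
  · rw [normAt, normAt, h.form_smul g u v v (h.ne_zero hu) hv hv]

theorem form_smul_smul (h : IsEquivariantSetting G B M Φ) (g : G) {u : X} (hu : u ∈ M) (v w : X) :
    B (g • u) (g • v) (g • w) = B u v w := by
  rcases eq_or_ne v 0 with rfl | hv
  · simp
  rcases eq_or_ne w 0 with rfl | hw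
  · simp
  · exact h.form_smul g u v w (h.ne_zero hu) hv hw

/-- The group acts by bounded operators, as it acts by isometries between equivalent norms. -/
theorem exists_clm_smul [SMulCommClass G ℝ X] (h : IsEquivariantSetting G B M Φ) (g : G) {u : X}
    (hu : u ∈ M) : ∃ L : X →L[ℝ] X, ∀ v, L v = g • v := by
  obtain ⟨ρ, hρ, C, hC, h1⟩ := h.adm.exists_ball (h.ne_zero hu)
  obtain ⟨ρ', hρ', C', hC', h2⟩ := h.adm.exists_ball (h.ne_zero (h.smul_mem g u hu))
  refine ⟨LinearMap.mkContinuous (DistribSMul.toLinearMap ℝ X g) (C' * C) fun v => ?_,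
    fun v => rfl⟩
  have h3 := ((h2 _ (Metric.mem_ball_self hρ')).2 (g • v)).1
  rw [h.normAt_smul_smul g hu] at h3
  calc ‖g • v‖ ≤ C' * normAt B u v := h3
    _ ≤ C' * (C * ‖v‖) := by
      gcongr
      exact ((h1 _ (Metric.mem_ball_self hρ)).2 v).2
    _ = C' * C * ‖v‖ := by ring

theorem symmetrize (h : IsEquivariantSetting G B M Φ) :
    IsEquivariantSetting G (symmetrize B) M Φ :=
  { h with
    adm := h.adm.symmetrize
    form_smul := fun g u v w hu hv hw => by
      simp only [EquivariantLS.symmetrize, LinearMap.add_apply, ← smul_neg,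
        h.form_smul g u v w hu hv hw, h.form_smul g (-u) v w (neg_ne_zero.2 hu) hv hw] }

theorem mdist_symmetrize_neg (h : IsEquivariantSetting G B M Φ) (u v : X) :
    mdist M (EquivariantLS.symmetrize B) (-u) (-v) = mdist M (EquivariantLS.symmetrize B) u v := by
  have key : ∀ u v, mdist M (EquivariantLS.symmetrize B) (-u) (-v) ≤
      mdist M (EquivariantLS.symmetrize B) u v := fun u v =>
    mdist_map_le (L := -ContinuousLinearMap.id ℝ X) (by simpa using h.neg_mem)
      (fun u _ v => by simpa using normAt_symmetrize_neg u v) u v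
  exact le_antisymm (key u v) (by simpa using key (-u) (-v))

section Linear

variable [SMulCommClass G ℝ X]

theorem mdist_smul_smul (h : IsEquivariantSetting G B M Φ) (g : G) (u v : X) :
    mdist M B (g • u) (g • v) = mdist M B u v := by
  have key : ∀ (g : G) u v, mdist M B (g • u) (g • v) ≤ mdist M B u v := by
    intro g u v
    refine le_of_forall_gt fun r hr => ?_
    obtain ⟨γ, -, h2, -⟩ := exists_curve_of_mdist_lt hr
    obtain ⟨L, hL⟩ := h.exists_clm_smul g (h2 (left_mem_Icc.2 zero_le_one))
    rw [← hL, ← hL]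
    refine (mdist_map_le (fun u hu => ?_) (fun u hu v => ?_) u v).trans_lt hr
    · rw [hL]; exact h.smul_mem g u hu
    · rw [hL, hL]; exact h.normAt_smul_smul g hu v
  refine le_antisymm (key g u v) ?_
  simpa using key g⁻¹ (g • u) (g • v)

theorem isGradient_smul (h : IsEquivariantSetting G B M Φ) (g : G) {u p : X} (hu : u ∈ M)
    (hp : IsGradient M B Φ u p) : IsGradient M B Φ (g • u) (g • p) := by
  obtain ⟨L, hL⟩ := h.exists_clm_smul g hu
  obtain ⟨L', hL'⟩ := h.exists_clm_smul g⁻¹ hu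
  have hLM : ∀ u ∈ M, L u ∈ M := fun u hu => by rw [hL]; exact h.smul_mem g u hu
  have hLM' : ∀ u ∈ M, L' u ∈ M := fun u hu => by rw [hL']; exact h.smul_mem g⁻¹ u hu
  refine ⟨by simpa [hL] using map_mem_tangentSpaceAt hLM hp.1, fun w hw => ?_⟩
  have hw' : g⁻¹ • w ∈ tangentSpaceAt M u := by
    simpa [hL'] using map_mem_tangentSpaceAt hLM' hw
  have h1 := differential_map h.c11 hLM (fun u hu => by rw [hL]; exact h.invariant g u hu) hu hw'
  rw [hL, hL, smul_inv_smul] at h1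
  rw [h1, hp.2 _ hw', ← h.form_smul_smul g hu, smul_inv_smul]

end Linear

theorem neg_mem_criticalSet (h : IsEquivariantSetting G B M Φ) {u : X}
    (hu : u ∈ criticalSet M Φ) : -u ∈ criticalSet M Φ := by
  have hL : ∀ u ∈ M, (-ContinuousLinearMap.id ℝ X) u ∈ M := by simpa using h.neg_mem
  refine ⟨h.neg_mem u hu.1, fun w hw => ?_⟩
  have hw' : -w ∈ tangentSpaceAt M u := by simpa using map_mem_tangentSpaceAt hL hw
  have h1 := differential_map h.c11 hL (by simpa using h.even) hu.1 hw'
  rw [hu.2 _ hw'] at h1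
  simpa using h1

theorem neg_mem_criticalSetAt (h : IsEquivariantSetting G B M Φ) {c : ℝ} {u : X}
    (hu : u ∈ criticalSetAt M Φ c) : -u ∈ criticalSetAt M Φ c :=
  ⟨h.neg_mem_criticalSet hu.1, (h.even u hu.1.1).trans hu.2⟩

/-! ### Functions that are Lipschitz for `d` -/

theorem continuousOn_of_le_add_mdist (h : IsEquivariantSetting G B M Φ) {f : X → ℝ≥0∞}
    (hf : ∀ x ∈ M, ∀ y ∈ M, f y ≤ f x + mdist M B x y) : ContinuousOn f M := by
  intro u hu
  have hd := tendsto_mdist h.subm h.zero_notMem h.adm hu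
  have h1 : Tendsto (fun v => f u - mdist M B u v) (𝓝[M] u) (𝓝 (f u)) := by
    simpa using ENNReal.Tendsto.sub tendsto_const_nhds hd (Or.inr ENNReal.zero_ne_top)
  have h2 : Tendsto (fun v => f u + mdist M B u v) (𝓝[M] u) (𝓝 (f u)) := by
    simpa using tendsto_const_nhds.add hd
  refine tendsto_of_tendsto_of_tendsto_of_le_of_le' h1 h2 ?_ ?_
  · filter_upwards [self_mem_nhdsWithin] with v hv
    rw [tsub_le_iff_right, mdist_comm]
    exact hf v hv u hu
  · filter_upwards [self_mem_nhdsWithin] with v hv using hf u hu v hv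

theorem Nfun_le_add (w w' : X) : Nfun M B w' ≤ Nfun M B w + mdist M B w w' := by
  simp only [Nfun, ENNReal.iInf_add]
  refine iInf₂_mono fun u hu => ?_
  rw [add_assoc]
  gcongr
  exact mdist_triangle _ _ _

theorem Nfun_ne_top {w : X} (hw : w ∈ M) : Nfun M B w ≠ ⊤ := by
  refine ne_top_of_le_ne_top ?_ (iInf₂_le w hw)
  simp [mdist_self hw]

theorem Nfun_smul [SMulCommClass G ℝ X] (h : IsEquivariantSetting G B M Φ) (g : G) (w : X) :
    Nfun M B (g • w) = Nfun M B w := by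
  have key : ∀ (g : G) w, Nfun M B (g • w) ≤ Nfun M B w := by
    intro g w
    refine le_iInf₂ fun u hu => ?_
    rw [← h.mdist_smul_smul g u w, ← h.normAt_smul_smul g hu u]
    exact iInf₂_le (g • u) (h.smul_mem g u hu)
  refine le_antisymm (key g w) ?_
  simpa using key g⁻¹ (g • w)

theorem continuousOn_toReal_Nfun (h : IsEquivariantSetting G B M Φ) :
    ContinuousOn (fun w => (Nfun M B w).toReal) M := by
  have hN : ContinuousOn (Nfun M B) M :=
    h.continuousOn_of_le_add_mdist fun x _ y _ => Nfun_le_add x y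
  exact ENNReal.continuousOn_toReal.comp hN fun _ hx => Nfun_ne_top hx

end IsEquivariantSetting

/-! ### The distance between orbits -/

/-- The distance of `u` from the orbit of `v`. -/
noncomputable def orbitDist (G : Type*) [SMul G X] (M : Set X)
    (B : X → LinearMap.BilinForm ℝ X) (u v : X) : ℝ≥0∞ :=
  ⨅ g : G, mdist M B u (g • v)

namespace IsEquivariantSetting

variable {G : Type*} [Group G] [DistribMulAction G X]

theorem orbitDist_le_mdist (u v : X) : orbitDist G M B u v ≤ mdist M B u v :=
  (iInf_le _ 1).trans_eq (by rw [one_smul])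

theorem orbitDist_symmetrize_neg (h : IsEquivariantSetting G B M Φ) (u v : X) :
    orbitDist G M (EquivariantLS.symmetrize B) (-u) (-v) =
      orbitDist G M (EquivariantLS.symmetrize B) u v := by
  simp only [orbitDist, smul_neg, h.mdist_symmetrize_neg]

variable [SMulCommClass G ℝ X]

theorem orbitDist_comm (h : IsEquivariantSetting G B M Φ) (u v : X) :
    orbitDist G M B u v = orbitDist G M B v u := by
  have key : ∀ u v, orbitDist G M B u v ≤ orbitDist G M B v u := by
    intro u v
    refine le_iInf fun g => (iInf_le _ g⁻¹).trans_eq ?_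
    rw [← h.mdist_smul_smul g, smul_inv_smul, mdist_comm]
  exact le_antisymm (key u v) (key v u)

theorem orbitDist_triangle (h : IsEquivariantSetting G B M Φ) (u v w : X) :
    orbitDist G M B u w ≤ orbitDist G M B u v + orbitDist G M B v w := by
  simp only [orbitDist, ENNReal.iInf_add, ENNReal.add_iInf]
  refine le_iInf fun k => le_iInf fun g => (iInf_le _ (g * k)).trans ?_
  rw [mul_smul, ← h.mdist_smul_smul g v]
  exact mdist_triangle u (g • v) (g • k • w)

theorem orbitDist_smul_left (h : IsEquivariantSetting G B M Φ) (g : G) (u v : X) :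
    orbitDist G M B (g • u) v = orbitDist G M B u v := by
  have key : ∀ (g : G) u, orbitDist G M B (g • u) v ≤ orbitDist G M B u v := by
    intro g u
    refine le_iInf fun k => (iInf_le _ (g * k)).trans_eq ?_
    rw [mul_smul, h.mdist_smul_smul]
  refine le_antisymm (key g u) ?_
  simpa using key g⁻¹ (g • u)

/-- A property that is invariant under the group and holds near `v` holds on a ball about `v` for
the distance between orbits. -/
theorem exists_orbitDist_ball (h : IsEquivariantSetting G B M Φ) {v : X} (hv : v ∈ M)
    {p : X → Prop} (hp : ∀ (g : G), ∀ w ∈ M, p (g • w) → p w) (hnear : ∀ᶠ w in 𝓝[M] v, p w) :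
    ∃ r : ℝ≥0∞, 0 < r ∧ ∀ w ∈ M, orbitDist G M B w v < r → p w := by
  by_contra! hcon
  have hpos : ∀ n : ℕ, (0 : ℝ≥0∞) < ((n : ℝ≥0∞) + 1)⁻¹ := fun n => by simp
  choose w hwM hwd hwp using fun n : ℕ => hcon ((n : ℝ≥0∞) + 1)⁻¹ (hpos n)
  have hg : ∀ n, ∃ g : G, mdist M B v (g • w n) < ((n : ℝ≥0∞) + 1)⁻¹ := fun n => by
    have := hwd n
    rw [h.orbitDist_comm] at this
    exact iInf_lt_iff.1 this
  choose g hg using hg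
  have hlim0 : Tendsto (fun n : ℕ => ((n : ℝ≥0∞) + 1)⁻¹) atTop (𝓝 0) := by
    have := (ENNReal.tendsto_inv_nat_nhds_zero).comp (tendsto_add_atTop_nat 1)
    simpa [Function.comp_def] using this
  have hlim : Tendsto (fun n => g n • w n) atTop (𝓝 v) :=
    h.adm.tendsto_of_mdist (h.ne_zero hv)
      (tendsto_of_tendsto_of_tendsto_of_le_of_le tendsto_const_nhds hlim0 (fun _ => zero_le)
        fun n => (hg n).le)
  have hlim' : Tendsto (fun n => g n • w n) atTop (𝓝[M] v) :=
    tendsto_nhdsWithin_iff.2 ⟨hlim, Eventually.of_forall fun n => h.smul_mem _ _ (hwM n)⟩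
  obtain ⟨n, hn⟩ := (hlim'.eventually hnear).exists
  exact hwp n (hp (g n) (w n) (hwM n) hn)

end IsEquivariantSetting

end

/-! ### The local deformation -/

section

variable {X : Type*} [NormedAddCommGroup X] [InnerProductSpace ℝ X]
  {B : X → LinearMap.BilinForm ℝ X} {M : Set X} {Φ : X → ℝ}

/-- The local deformation near `u`: in a chart, points are translated in the direction of `w`, by a
length `s` that is cut off away from `u`. -/
theorem exists_local_deformation (hM : IsC11Submanifold M) (hM0 : (0 : X) ∉ M)
    (hΦ : IsC11OnManifold M Φ) {S : X → LinearMap.BilinForm ℝ X} (hB : IsAdmissible B)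
    (hS : IsAdmissible S) {u w : X} (hu : u ∈ M) (hw : w ∈ tangentSpaceAt M u) {m l₁ l₂ : ℝ}
    (hm0 : 0 < m) (hm : m < -differential M Φ u w) (hl₁ : normAt B u w < l₁)
    (hl₂ : normAt S u w < l₂) {W : Set X} (hW : W ∈ 𝓝 u) :
    ∃ H : ℝ → M → M, (Continuous fun q : ℝ × M => H q.1 q.2) ∧ (∀ x, H 0 x = x) ∧
      (∀ t x, H t x = x ∨ ∃ s > 0, Φ (H t x) ≤ Φ x - m * s ∧
        mdist M B x (H t x) ≤ ENNReal.ofReal (l₁ * s) ∧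
        mdist M S x (H t x) ≤ ENNReal.ofReal (l₂ * s) ∧ (x : X) ∈ W ∧ (H t x : X) ∈ W) ∧
      {x | Φ (H 1 x) < Φ x} ∈ 𝓝 (⟨u, hu⟩ : M) := by
  obtain ⟨e, E, he, hue⟩ := hM.exists_straightening hu
  have hu0 : u ≠ 0 := ne_of_mem_of_not_mem hu hM0
  set w' := fderiv ℝ e u w
  have htu := e.map_source hue
  have hWe : e.symm ⁻¹' W ∈ 𝓝 (e u) :=
    (e.continuousAt_symm htu).preimage_mem_nhds (by rwa [e.left_inv hue])
  have c1 : ContinuousAt (fun p : X × ℝ => p.1 + p.2 • w') (e u, 0) := by fun_prop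
  have e1 : ∀ᶠ p : X × ℝ in 𝓝 (e u, 0), p.1 + p.2 • w' ∈ e.symm ⁻¹' W :=
    c1.eventually_mem (by simpa using hWe)
  have hlim : Tendsto (fun p : X × ℝ => (e p.1, p.2)) (𝓝 (u, 0)) (𝓝 (e u, 0)) := by
    have : ContinuousAt (fun p : X × ℝ => (e p.1, p.2)) (u, 0) :=
      ((e.continuousAt hue).comp (f := Prod.fst) (x := (u, (0 : ℝ))) continuousAt_fst).prodMk
        continuousAt_snd
    exact this
  have hsrc : ∀ᶠ p : X × ℝ in 𝓝 (u, 0), p.1 ∈ e.source ∩ W :=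
    continuousAt_fst.eventually_mem (inter_mem (e.open_source.mem_nhds hue) hW)
  have hall := hsrc.and (hlim.eventually ((he.eventually_apply_le hΦ hue hu hw hm).and
    ((he.eventually_mdist_le hB hu0 hue hu hw hl₁).and
      ((he.eventually_mdist_le hS hu0 hue hu hw hl₂).and e1))))
  obtain ⟨ρ, hρ, hball⟩ := Metric.eventually_nhds_iff_ball.1 hall
  let σ : X → ℝ → X := fun x s => e.symm (e x + s • w')
  have key : ∀ x ∈ M, dist x u < ρ → ∀ s, 0 ≤ s → s < ρ →
      x ∈ e.source ∧ e x + s • w' ∈ e.target ∧ σ x s ∈ M ∧ Φ (σ x s) ≤ Φ x - m * s ∧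
      mdist M B x (σ x s) ≤ ENNReal.ofReal (l₁ * s) ∧
      mdist M S x (σ x s) ≤ ENNReal.ofReal (l₂ * s) ∧ x ∈ W ∧ σ x s ∈ W := by
    intro x hxM hx s hs0 hsρ
    have hmem : (x, s) ∈ Metric.ball ((u, 0) : X × ℝ) ρ := by
      rw [Metric.mem_ball, Prod.dist_eq, Real.dist_eq, sub_zero, abs_of_nonneg hs0]
      exact max_lt hx hsρ
    obtain ⟨⟨h1, h2⟩, h3, h4, h5, h6⟩ := hball _ hmem
    have hxE := he.apply_mem h1 hxM
    obtain ⟨-, h7, h8, h9⟩ := h3 hxE hs0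
    have h10 := h4 hxE hs0
    have h11 := h5 hxE hs0
    rw [e.left_inv h1] at h9 h10 h11
    exact ⟨h1, h7, h8, h9, h10, h11, h2, h6⟩
  let χ : ℝ × X → ℝ := fun q => max 0 (min q.1 1) * max 0 (ρ / 2 - dist q.2 u)
  have hχc : Continuous χ := by fun_prop
  have hχ0 : ∀ q, 0 ≤ χ q := fun q => mul_nonneg (le_max_left _ _) (le_max_left _ _)
  have hχρ : ∀ q, χ q < ρ := by
    intro q
    have h1 : max 0 (min q.1 1) ≤ 1 := max_le zero_le_one (min_le_right _ _)
    have h2 : max 0 (ρ / 2 - dist q.2 u) ≤ ρ / 2 :=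
      max_le (by positivity) (by linarith [dist_nonneg (x := q.2) (y := u)])
    calc χ q ≤ 1 * (ρ / 2) := mul_le_mul h1 h2 (le_max_left _ _) zero_le_one
      _ < ρ := by linarith
  have hχfar : ∀ q : ℝ × X, ρ / 2 ≤ dist q.2 u → χ q = 0 := by
    intro q hq
    simp only [χ]
    rw [max_eq_left (by linarith : ρ / 2 - dist q.2 u ≤ 0), mul_zero]
  let h : ℝ × X → X := fun q => if dist q.2 u < ρ then σ q.2 (χ q) else q.2
  have hM' : ∀ q : ℝ × X, q.2 ∈ M → h q ∈ M := by
    intro q hq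
    by_cases hd : dist q.2 u < ρ
    · simp only [h, hd, if_true]
      exact (key q.2 hq hd _ (hχ0 q) (hχρ q)).2.2.1
    · simpa only [h, hd, if_false] using hq
  have hid : ∀ q : ℝ × X, q.2 ∈ M → χ q = 0 → h q = q.2 := by
    intro q hq hq0
    by_cases hd : dist q.2 u < ρ
    · simp only [h, hd, if_true, σ, hq0, zero_smul, add_zero]
      exact e.left_inv (key q.2 hq hd 0 le_rfl hρ).1
    · simp only [h, hd, if_false]
  have hc : ContinuousOn h {q | q.2 ∈ M} := by
    intro q hq
    rcases lt_or_ge (dist q.2 u) ρ with hd | hd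
    · have hev : h =ᶠ[𝓝[{q | q.2 ∈ M}] q] fun q => σ q.2 (χ q) := by
        have : ∀ᶠ q' : ℝ × X in 𝓝 q, dist q'.2 u < ρ :=
          (continuous_snd.dist continuous_const).continuousAt.eventually (gt_mem_nhds hd)
        filter_upwards [mem_nhdsWithin_of_mem_nhds this] with q' hq'
        simp only [h, hq', if_true]
      obtain ⟨h1, h2, -⟩ := key q.2 hq hd _ (hχ0 q) (hχρ q)
      have hin : ContinuousAt (fun q : ℝ × X => e q.2 + χ q • w') q :=
        ((e.continuousAt h1).comp continuousAt_snd).add (hχc.continuousAt.smul continuousAt_const)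
      have hσ : ContinuousAt (fun q : ℝ × X => σ q.2 (χ q)) q :=
        (e.continuousAt_symm h2).comp (f := fun q : ℝ × X => e q.2 + χ q • w') hin
      exact hσ.continuousWithinAt.congr_of_eventuallyEq hev (hev.self_of_nhdsWithin hq)
    · have hev : h =ᶠ[𝓝[{q | q.2 ∈ M}] q] fun q => q.2 := by
        have : ∀ᶠ q' : ℝ × X in 𝓝 q, ρ / 2 < dist q'.2 u :=
          (continuous_snd.dist continuous_const).continuousAt.eventually
            (lt_mem_nhds (by linarith))
        filter_upwards [mem_nhdsWithin_of_mem_nhds this, self_mem_nhdsWithin] with q' hq' hqM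
        exact hid q' hqM (hχfar q' hq'.le)
      exact continuousWithinAt_snd.congr_of_eventuallyEq hev (hev.self_of_nhdsWithin hq)
  have hmove : ∀ q : ℝ × X, q.2 ∈ M → 0 < χ q → Φ (h q) ≤ Φ q.2 - m * χ q ∧
      mdist M B q.2 (h q) ≤ ENNReal.ofReal (l₁ * χ q) ∧
      mdist M S q.2 (h q) ≤ ENNReal.ofReal (l₂ * χ q) ∧ q.2 ∈ W ∧ h q ∈ W := by
    intro q hq hpos
    have hd : dist q.2 u < ρ := by
      by_contra hd
      exact hpos.ne' (hχfar q (by linarith))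
    simp only [h, hd, if_true]
    exact (key q.2 hq hd _ (hχ0 q) (hχρ q)).2.2.2
  refine ⟨fun t x => ⟨h (t, x), hM' (t, x) x.2⟩, ?_, fun x => ?_, fun t x => ?_, ?_⟩
  · refine Continuous.subtype_mk ?_ _
    exact hc.comp_continuous (f := fun q : ℝ × M => (q.1, (q.2 : X))) (by fun_prop)
      fun q => q.2.2
  · exact Subtype.ext (hid (0, x) x.2 (by simp [χ]))
  · rcases (hχ0 (t, x)).eq_or_lt with h0 | h0
    · exact Or.inl (Subtype.ext (hid (t, x) x.2 h0.symm))
    · exact Or.inr ⟨χ (t, x), h0, hmove (t, x) x.2 h0⟩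
  · have : ∀ᶠ x : M in 𝓝 ⟨u, hu⟩, dist (x : X) u < ρ / 2 :=
      (continuous_subtype_val.dist continuous_const).continuousAt.eventually
        (gt_mem_nhds (by simpa using hρ))
    filter_upwards [this] with x hx
    have hpos : 0 < χ (1, x) := by
      simp only [χ, min_self, max_eq_right (zero_le_one (α := ℝ)), one_mul]
      exact lt_max_of_lt_right (by linarith)
    have := (hmove (1, x) x.2 hpos).1
    have hms := mul_pos hm0 hpos
    change Φ (h (1, x)) < Φ x
    simp only at this
    linarith

/-! ### Compactness of the critical sets modulo the group -/

namespace IsEquivariantSetting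

variable {G : Type*} [Group G] [DistribMulAction G X]

/-- Near each point, the function `N` is bounded and the scalar products at `u` and at `-u` are
equivalent. -/
theorem exists_local_bound (h : IsEquivariantSetting G B M Φ) {v : X} (hv : v ∈ M) :
    ∃ C : ℝ, ∀ᶠ w in 𝓝[M] v, 1 + (Nfun M B w).toReal ≤ C ∧
      ∀ x, normAt (EquivariantLS.symmetrize B) w x ≤ C * normAt B w x := by
  obtain ⟨ρ, hρ, C, hC, h1⟩ := h.adm.exists_ball (h.ne_zero hv)
  obtain ⟨ρ', hρ', C', hC', h2⟩ := h.symmetrize.adm.exists_ball (h.ne_zero hv)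
  set n := 1 + (Nfun M B v).toReal + 1
  refine ⟨max n (C' * C), ?_⟩
  have hN := (h.continuousOn_toReal_Nfun v hv).eventually (gt_mem_nhds (lt_add_one _))
  filter_upwards [hN, mem_nhdsWithin_of_mem_nhds (Metric.ball_mem_nhds v hρ),
    mem_nhdsWithin_of_mem_nhds (Metric.ball_mem_nhds v hρ')] with w hw hw1 hw2
  refine ⟨le_max_of_le_left (by simp only [n]; linarith), fun x => ?_⟩
  calc normAt (EquivariantLS.symmetrize B) w x ≤ C' * ‖x‖ := ((h2 w hw2).2 x).2
    _ ≤ C' * (C * normAt B w x) := by gcongr; exact ((h1 w hw1).2 x).1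
    _ = C' * C * normAt B w x := by ring
    _ ≤ _ := by
      gcongr
      · exact normAt_nonneg ..
      · exact le_max_right _ _

/-- A vanishing distance between the orbits of `v` and of `-v` would put `v` into the closure of the
orbit of `-v`, which is closed. -/
theorem orbitDist_neg_pos (h : IsEquivariantSetting G B M Φ) (hG : SeqClosedOrbits G X) {v : X}
    (hv : v ∈ M) (hI : ∀ g : G, g • v ≠ -v) : 0 < orbitDist G M B v (-v) := by
  by_contra hcon
  have h0 : orbitDist G M B v (-v) = 0 := by simpa using hcon
  have hg : ∀ n : ℕ, ∃ g : G, mdist M B v (g • -v) < ((n : ℝ≥0∞) + 1)⁻¹ := fun n =>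
    iInf_lt_iff.1 (h0.trans_lt (by simp) : orbitDist G M B v (-v) < ((n : ℝ≥0∞) + 1)⁻¹)
  choose g hg using hg
  have hlim0 : Tendsto (fun n : ℕ => ((n : ℝ≥0∞) + 1)⁻¹) atTop (𝓝 0) := by
    have := (ENNReal.tendsto_inv_nat_nhds_zero).comp (tendsto_add_atTop_nat 1)
    simpa [Function.comp_def] using this
  have hlim : Tendsto (fun n => g n • -v) atTop (𝓝 v) :=
    h.adm.tendsto_of_mdist (h.ne_zero hv)
      (tendsto_of_tendsto_of_tendsto_of_le_of_le tendsto_const_nhds hlim0 (fun _ => zero_le)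
        fun n => (hg n).le)
  obtain ⟨k, hk⟩ := hG g (-v) v hlim
  rw [smul_neg] at hk
  exact hI k (neg_eq_iff_eq_neg.1 hk)

variable [SMulCommClass G ℝ X]

/-- The limits provided by the Cerami condition are critical points at the level `c`. -/
theorem exists_tendsto_criticalSetAt (h : IsEquivariantSetting G B M Φ) {c : ℝ}
    (hNCG : NCeramiCondition G M B Φ c) {u : ℕ → X} (hu : IsNCeramiSeq M B Φ c u) :
    ∃ (φ : ℕ → ℕ) (g : ℕ → G) (v : X), StrictMono φ ∧ v ∈ criticalSetAt M Φ c ∧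
      Tendsto (fun n => g n • u (φ n)) atTop (𝓝 v) := by
  obtain ⟨φ, g, v, hφ, hv, hlim⟩ := hNCG u hu
  obtain ⟨huM, hΦu, p, hp, hp0⟩ := hu
  have hlim' : Tendsto (fun n => g n • u (φ n)) atTop (𝓝[M] v) :=
    tendsto_nhdsWithin_iff.2 ⟨hlim, Eventually.of_forall fun n => h.smul_mem _ _ (huM _)⟩
  have hΦv : Φ v = c := by
    refine tendsto_nhds_unique ((h.c11.continuousOn v hv).tendsto.comp hlim') ?_
    refine (hΦu.comp hφ.tendsto_atTop).congr fun n => ?_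
    exact (h.invariant (g n) _ (huM (φ n))).symm
  refine ⟨φ, g, v, hφ, ⟨?_, hΦv⟩, hlim⟩
  by_contra hcrit
  obtain ⟨δ, hδ, hev⟩ := exists_le_normAt_gradient h.subm h.zero_notMem h.adm h.c11 hv hcrit
  have h1 := (hp0.comp hφ.tendsto_atTop).eventually (gt_mem_nhds (ENNReal.ofReal_pos.2 hδ))
  obtain ⟨n, hn1, hn2⟩ := (h1.and (hlim'.eventually hev)).exists
  have h2 := hn2 _ (h.isGradient_smul (g n) (huM _) (hp (φ n)))
  rw [h.normAt_smul_smul _ (huM _)] at h2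
  refine absurd hn1 (not_lt.2 ?_)
  calc ENNReal.ofReal δ ≤ ENNReal.ofReal (normAt B (u (φ n)) (p (φ n))) :=
        ENNReal.ofReal_le_ofReal h2
    _ = ENNReal.ofReal (normAt B (u (φ n)) (p (φ n))) * 1 := (mul_one _).symm
    _ ≤ _ := by
        simp only [Function.comp_apply]
        gcongr
        exact le_self_add

/-- The set `K_c` is sequentially compact for the distance between orbits. That distance may be
taken for another family `S` of scalar products. -/
theorem exists_subseq_orbitDist (h : IsEquivariantSetting G B M Φ) {c : ℝ}
    (hNCG : NCeramiCondition G M B Φ c) {S : X → LinearMap.BilinForm ℝ X}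
    (hS : IsEquivariantSetting G S M Φ) {u : ℕ → X} (hu : ∀ n, u n ∈ criticalSetAt M Φ c) :
    ∃ v ∈ criticalSetAt M Φ c, ∃ φ : ℕ → ℕ, StrictMono φ ∧
      Tendsto (fun n => orbitDist G M S (u (φ n)) v) atTop (𝓝 0) := by
  have hcer : IsNCeramiSeq M B Φ c u := by
    refine ⟨fun n => (hu n).1.1, ?_, fun _ => 0,
      fun n => isGradient_zero_of_mem_criticalSet (hu n).1, ?_⟩
    · simp only [fun n => (hu n).2, tendsto_const_nhds]
    · simp
  obtain ⟨φ, g, v, hφ, hv, hlim⟩ := h.exists_tendsto_criticalSetAt hNCG hcer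
  refine ⟨v, hv, φ, hφ, ?_⟩
  have h1 : Tendsto (fun n => mdist M S v (g n • u (φ n))) atTop (𝓝 0) :=
    (tendsto_mdist hS.subm hS.zero_notMem hS.adm hv.1.1).comp
      (tendsto_nhdsWithin_iff.2 ⟨hlim, Eventually.of_forall fun n => h.smul_mem _ _ (hu _).1.1⟩)
  refine tendsto_of_tendsto_of_tendsto_of_le_of_le tendsto_const_nhds h1 (fun _ => zero_le)
    fun n => ?_
  rw [hS.orbitDist_comm]
  exact iInf_le _ (g n)

/-- A neighborhood of the critical set at the level `c`, given as a sublevel set of a Lipschitz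
function `ψ`. It has finite genus, and `ψ` varies only where `N` is bounded and the scalar products
at `u` and at `-u` are uniformly equivalent. -/
theorem exists_cutoff (h : IsEquivariantSetting G B M Φ) (hG : SeqClosedOrbits G X) {c : ℝ}
    (hNCG : NCeramiCondition G M B Φ c) (hI : ∀ u ∈ criticalSetAt M Φ c, ∀ g : G, g • u ≠ -u) :
    ∃ (ψ : X → ℝ) (r C : ℝ) (m : ℕ), 0 < r ∧ 0 < C ∧
      (∀ u, ψ (-u) = ψ u) ∧ (∀ (g : G) u, ψ (g • u) = ψ u) ∧ (∀ v ∈ criticalSetAt M Φ c, ψ v = 0) ∧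
      (∀ x ∈ M, ∀ y ∈ M, ∀ a : ℝ, 0 ≤ a →
        mdist M (EquivariantLS.symmetrize B) x y ≤ ENNReal.ofReal a → |ψ x - ψ y| ≤ a) ∧
      ContinuousOn ψ M ∧
      (∀ u ∈ M, (1 + (Nfun M B u).toReal ≤ C ∧
          ∀ x, normAt (EquivariantLS.symmetrize B) u x ≤ C * normAt B u x) ∨
        ∀ᶠ w in 𝓝[M] u, ψ w = r) ∧
      genus {u ∈ M | ψ u < r} ≤ m ∧ (criticalSetAt M Φ c = ∅ → m = 0) := by
  set S := EquivariantLS.symmetrize B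
  have hS : IsEquivariantSetting G S M Φ := h.symmetrize
  set K := criticalSetAt M Φ c
  let D := orbitDist G M S
  have hself : ∀ x ∈ M, D x x = 0 := fun x hx =>
    le_antisymm ((orbitDist_le_mdist x x).trans_eq (mdist_self hx)) zero_le
  -- Radii of good balls about the points of `K`.
  have hrad : ∀ v ∈ K, ∃ (r : ℝ≥0∞) (C : ℝ), 0 < r ∧ r ≠ ⊤ ∧ r + r ≤ D v (-v) ∧
      ∀ w ∈ M, D w v < r → 1 + (Nfun M B w).toReal ≤ C ∧
        ∀ x, normAt S w x ≤ C * normAt B w x := by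
    intro v hv
    obtain ⟨C, hC⟩ := h.exists_local_bound hv.1.1
    obtain ⟨r, hr, hrC⟩ := hS.exists_orbitDist_ball hv.1.1 (p := fun w =>
      1 + (Nfun M B w).toReal ≤ C ∧ ∀ x, normAt S w x ≤ C * normAt B w x)
      (fun g w hw hp => by
        refine ⟨by rw [← h.Nfun_smul g w]; exact hp.1, fun x => ?_⟩
        have := hp.2 (g • x)
        rwa [hS.normAt_smul_smul g hw, h.normAt_smul_smul g hw] at this) hC
    have hpos : 0 < D v (-v) := hS.orbitDist_neg_pos hG hv.1.1 (hI v hv)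
    refine ⟨min (min r 1) (D v (-v) / 2), C, ?_, ?_, ?_, fun w hw hwr => ?_⟩
    · exact lt_min (lt_min hr zero_lt_one) (ENNReal.half_pos hpos.ne')
    · exact ne_top_of_le_ne_top ENNReal.one_ne_top ((min_le_left _ _).trans (min_le_right _ _))
    · calc _ ≤ D v (-v) / 2 + D v (-v) / 2 := add_le_add (min_le_right _ _) (min_le_right _ _)
        _ = _ := ENNReal.add_halves _
    · exact hrC w hw (hwr.trans_le ((min_le_left _ _).trans (min_le_left _ _)))
  choose! R C hR0 hRtop hRsep hRC using hrad
  obtain ⟨t, htK, ρ, hρ, hρtop, hcov⟩ := exists_finite_cover (α := M) (fun x y => D x y)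
    (fun x => hself x x.2) (fun x y => hS.orbitDist_comm _ _)
    (fun x y z => hS.orbitDist_triangle _ _ _) (K := Subtype.val ⁻¹' K)
    (fun u hu => by
      obtain ⟨v, hv, φ, hφ, hlim⟩ := h.exists_subseq_orbitDist hNCG hS (u := fun n => u n) hu
      exact ⟨⟨v, hv.1.1⟩, hv, φ, hφ, hlim⟩)
    (r := fun v => R v) (fun v hv => hR0 v hv)
  obtain ⟨C', hC'⟩ := (t.image fun v : M => C v).exists_le
  -- The function `ψ` is the distance from `K`, truncated at half the radius of the neighborhood.
  let f : X → ℝ≥0∞ := fun w => ⨅ v ∈ K, D w v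
  have hf : ∀ x y : X, f y ≤ f x + mdist M S x y := by
    intro x y
    simp only [f, ENNReal.iInf_add]
    refine iInf₂_mono fun v _ => (hS.orbitDist_triangle y x v).trans ?_
    rw [add_comm]
    gcongr
    rw [mdist_comm]
    exact orbitDist_le_mdist _ _
  have hfc : ContinuousOn f M := hS.continuousOn_of_le_add_mdist fun x _ y _ => hf x y
  set r := ρ / 2
  have hr0 : 0 < r := ENNReal.half_pos hρ.ne'
  have hrtop : r ≠ ⊤ := ne_top_of_le_ne_top hρtop ENNReal.half_le_self
  have hmin : ∀ w, min r (f w) ≠ ⊤ := fun w => ne_top_of_le_ne_top hrtop (min_le_left _ _)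
  let ψ : X → ℝ := fun w => (min r (f w)).toReal
  have hψlt : ∀ w, ψ w < r.toReal → f w < r := by
    intro w hw
    by_contra hge
    simp only [ψ, min_eq_left (not_lt.1 hge), lt_irrefl] at hw
  have hψle : ∀ x y, ∀ a : ℝ, 0 ≤ a → mdist M S x y ≤ ENNReal.ofReal a → ψ y ≤ ψ x + a := by
    intro x y a ha hxy
    have h1 : min r (f y) ≤ min r (f x) + ENNReal.ofReal a := by
      rcases le_total r (f x) with hx | hx
      · rw [min_eq_left hx]; exact (min_le_left _ _).trans le_self_add
      · rw [min_eq_right hx]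
        exact (min_le_right _ _).trans ((hf x y).trans (by gcongr))
    have h2 := ENNReal.toReal_mono (ENNReal.add_ne_top.2 ⟨hmin x, ENNReal.ofReal_ne_top⟩) h1
    rwa [ENNReal.toReal_add (hmin x) ENNReal.ofReal_ne_top, ENNReal.toReal_ofReal ha] at h2
  have hneg : ∀ u, f (-u) = f u := by
    have key : ∀ u, f (-u) ≤ f u := fun u => le_iInf₂ fun v hv => by
      refine (iInf₂_le (-v) (h.neg_mem_criticalSetAt hv)).trans_eq ?_
      exact h.orbitDist_symmetrize_neg u v
    exact fun u => le_antisymm (key u) (by simpa using key (-u))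
  refine ⟨ψ, r.toReal, max C' 1, t.card, ENNReal.toReal_pos hr0.ne' hrtop,
    lt_max_of_lt_right one_pos, fun u => ?_, fun g u => ?_, fun v hv => ?_,
    fun x hx y hy a ha hxy => ?_, ?_, fun u hu => ?_, ?_, fun hK => ?_⟩
  · simp only [ψ, hneg]
  · simp only [ψ, f, D, hS.orbitDist_smul_left]
  · have : f v = 0 := le_antisymm ((iInf₂_le v hv).trans_eq (hself v hv.1.1)) zero_le
    simp [ψ, this]
  · have h1 := hψle x y a ha hxy
    have h2 := hψle y x a ha (by rwa [mdist_comm])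
    exact abs_le.2 ⟨by linarith, by linarith⟩
  · have : ContinuousOn (fun w => min r (f w)) M :=
      (continuous_const.min continuous_id).comp_continuousOn hfc
    exact ENNReal.continuousOn_toReal.comp this fun w _ => hmin w
  · rcases lt_or_ge (f u) ρ with hlt | hge
    · left
      obtain ⟨v, hv⟩ := iInf_lt_iff.1 hlt
      obtain ⟨hvK, hv⟩ := iInf_lt_iff.1 hv
      obtain ⟨v', hv't, hv'⟩ := hcov ⟨u, hu⟩ ⟨v, hvK.1.1⟩ hvK hv
      have hle : C v' ≤ max C' 1 := le_max_of_le_left (hC' _ (Finset.mem_image_of_mem _ hv't))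
      obtain ⟨h1, h2⟩ := hRC v' (htK v' hv't) u hu hv'
      exact ⟨h1.trans hle, fun x => (h2 x).trans (by gcongr; exact normAt_nonneg ..)⟩
    · right
      have hlt : r < f u := (ENNReal.half_lt_self hρ.ne' hρtop).trans_le hge
      filter_upwards [(hfc u hu).eventually (lt_mem_nhds hlt)] with w hw
      simp only [ψ, min_eq_left hw.le]
  · -- The odd map is built from the distances to the orbits of `v` and of `-v`, for `v ∈ t`.
    have hcard : Fintype.card t = t.card := Fintype.card_coe t
    rw [← hcard]
    have hDc : ∀ v : X, ContinuousOn (fun w => D w v) M := fun v =>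
      hS.continuousOn_of_le_add_mdist fun x _ y _ => by
        refine (hS.orbitDist_triangle y x v).trans ?_
        rw [add_comm, mdist_comm]
        gcongr
        exact orbitDist_le_mdist _ _
    have hRt : ∀ (v : t) (a : ℝ≥0∞), min (R v) a ≠ ⊤ := fun v a =>
      ne_top_of_le_ne_top (hRtop v (htK v v.2)) (min_le_left _ _)
    have hcont : ∀ (v : t) (v' : X),
        ContinuousOn (fun w => (min (R v) (D w v')).toReal) {u ∈ M | ψ u < r.toReal} :=
      fun v v' => by
      have h1 : ContinuousOn (fun w => min (R v) (D w v')) {u ∈ M | ψ u < r.toReal} :=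
        ((continuous_const.min continuous_id).comp_continuousOn (hDc v')).mono (sep_subset _ _)
      exact ENNReal.continuousOn_toReal.comp h1 fun w _ => hRt v _
    refine genus_le_card (ι := t) (f := fun w v =>
      (min (R v) (D w (-v))).toReal - (min (R v) (D w v)).toReal) ?_ ?_ ?_
    · exact continuousOn_pi.2 fun v => (hcont v _).sub (hcont v _)
    · rintro w ⟨hwM, hw⟩ h0
      have hwρ : f w < ρ := (hψlt w hw).trans_le ENNReal.half_le_self
      obtain ⟨v, hv⟩ := iInf_lt_iff.1 hwρ
      obtain ⟨hvK, hv⟩ := iInf_lt_iff.1 hv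
      obtain ⟨v', hv't, hv'⟩ := hcov ⟨w, hwM⟩ ⟨v, hvK.1.1⟩ hvK hv
      have hfar : R v' ≤ D w (-v') := by
        by_contra hlt
        have hsum := ENNReal.add_lt_add hv' (not_le.1 hlt)
        refine absurd hsum (not_lt.2 ((hRsep v' (htK v' hv't)).trans ?_))
        have := hS.orbitDist_triangle (v' : X) w (-v')
        rwa [hS.orbitDist_comm (v' : X) w] at this
      have h1 := congrFun h0 ⟨v', hv't⟩
      simp only [Pi.zero_apply, min_eq_left hfar, min_eq_right (le_of_lt hv')] at h1
      have h2 := (ENNReal.toReal_lt_toReal (ne_top_of_lt hv') (hRtop v' (htK v' hv't))).2 hv'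
      linarith
    · rintro w -
      ext v
      have h1 : D (-w) (-v) = D w v := h.orbitDist_symmetrize_neg w v
      have h2 : D (-w) v = D w (-v) := by
        have := h.orbitDist_symmetrize_neg (G := G) w (-v)
        rwa [neg_neg] at this
      simp [h1, h2]
  · rw [Finset.card_eq_zero, Finset.eq_empty_iff_forall_notMem]
    intro v hv
    exact (hK ▸ htK v hv : (v : X) ∈ (∅ : Set X))

/-- Away from the critical set at the level `c`, and at levels close to `c`, the quantity
`‖∇Φ(u)‖ (1 + N(u))` is bounded below. -/
theorem exists_slope_bound (h : IsEquivariantSetting G B M Φ) {c : ℝ}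
    (hNCG : NCeramiCondition G M B Φ c) {ψ : X → ℝ} (hψ : ContinuousOn ψ M)
    (hψG : ∀ (g : G) u, ψ (g • u) = ψ u) (hψK : ∀ v ∈ criticalSetAt M Φ c, ψ v = 0) {a : ℝ}
    (ha : 0 < a) :
    ∃ ε > 0, ∃ δ > 0, ∀ u ∈ M, |Φ u - c| ≤ ε → a ≤ ψ u → ∀ p, IsGradient M B Φ u p →
      δ ≤ normAt B u p * (1 + (Nfun M B u).toReal) := by
  by_contra! hcon
  have hpos : ∀ n : ℕ, (0 : ℝ) < 1 / ((n : ℝ) + 1) := fun n => by positivity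
  choose u huM huΦ huψ p hp hlt using fun n : ℕ => hcon _ (hpos n) _ (hpos n)
  have hcer : IsNCeramiSeq M B Φ c u := by
    refine ⟨huM, ?_, p, hp, ?_⟩
    · rw [tendsto_iff_dist_tendsto_zero]
      exact squeeze_zero (fun _ => dist_nonneg) huΦ tendsto_one_div_add_atTop_nhds_zero_nat
    · have hlim := ENNReal.tendsto_ofReal (tendsto_one_div_add_atTop_nhds_zero_nat (𝕜 := ℝ))
      rw [ENNReal.ofReal_zero] at hlim
      refine tendsto_of_tendsto_of_tendsto_of_le_of_le tendsto_const_nhds hlim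
        (fun _ => zero_le) fun n => ?_
      refine le_trans (le_of_eq ?_) (ENNReal.ofReal_le_ofReal (hlt n).le)
      rw [ENNReal.ofReal_mul (normAt_nonneg ..),
        ENNReal.ofReal_add zero_le_one ENNReal.toReal_nonneg, ENNReal.ofReal_one,
        ENNReal.ofReal_toReal (Nfun_ne_top (huM n))]
  obtain ⟨φ, g, v, hφ, hv, hlim⟩ := h.exists_tendsto_criticalSetAt hNCG hcer
  have hlim' : Tendsto (fun n => g n • u (φ n)) atTop (𝓝[M] v) :=
    tendsto_nhdsWithin_iff.2 ⟨hlim, Eventually.of_forall fun n => h.smul_mem _ _ (huM _)⟩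
  have h1 : Tendsto (fun n => ψ (g n • u (φ n))) atTop (𝓝 (ψ v)) :=
    (hψ v hv.1.1).tendsto.comp hlim'
  have h2 : a ≤ ψ v := ge_of_tendsto h1 (Eventually.of_forall fun n => by
    rw [hψG]; exact huψ _)
  rw [hψK v hv] at h2
  linarith

end IsEquivariantSetting

end

/-! ### The deformation theorem -/

section

variable {X : Type*} [NormedAddCommGroup X] [InnerProductSpace ℝ X]
  {B : X → LinearMap.BilinForm ℝ X} {M : Set X} {Φ : X → ℝ}

/-- The control on the deformation: when `Φ` drops by `t`, the distance covered is at most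
`(1 + N) (exp (C t) - 1)`. This is what one obtains by integrating `|d'| ≤ C (1 + N) |Φ'|`, as `N`
is Lipschitz for `d`; it is the form of the estimate that is transitive. -/
def CeramiControlled (M : Set X) (B : X → LinearMap.BilinForm ℝ X) (Φ : X → ℝ) (C : ℝ)
    (x y : X) : Prop :=
  mdist M B x y ≤
    ENNReal.ofReal ((1 + (Nfun M B x).toReal) * (Real.exp (C * (Φ x - Φ y)) - 1))

theorem toReal_Nfun_le {x y : X} (hx : x ∈ M) {b : ℝ} (hb : 0 ≤ b)
    (h : mdist M B x y ≤ ENNReal.ofReal b) :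
    (Nfun M B y).toReal ≤ (Nfun M B x).toReal + b := by
  have h1 := (IsEquivariantSetting.Nfun_le_add (M := M) (B := B) x y).trans
    (add_le_add_right h _)
  have h2 := ENNReal.toReal_mono (ENNReal.add_ne_top.2
    ⟨IsEquivariantSetting.Nfun_ne_top hx, ENNReal.ofReal_ne_top⟩) h1
  rwa [ENNReal.toReal_add (IsEquivariantSetting.Nfun_ne_top hx) ENNReal.ofReal_ne_top,
    ENNReal.toReal_ofReal hb] at h2

theorem CeramiControlled.one_add_Nfun_le {C : ℝ} (hC : 0 ≤ C) {x y : X} (hx : x ∈ M)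
    (hxy : CeramiControlled M B Φ C x y) (hΦ : Φ y ≤ Φ x) :
    1 + (Nfun M B y).toReal ≤ (1 + (Nfun M B x).toReal) * Real.exp (C * (Φ x - Φ y)) := by
  have he : 1 ≤ Real.exp (C * (Φ x - Φ y)) :=
    Real.one_le_exp (mul_nonneg hC (sub_nonneg.2 hΦ))
  have hN : 0 ≤ (Nfun M B x).toReal := ENNReal.toReal_nonneg
  have := toReal_Nfun_le hx (mul_nonneg (by linarith) (by linarith)) hxy
  linarith

theorem CeramiControlled.trans {C : ℝ} (hC : 0 ≤ C) {x y z : X} (hx : x ∈ M)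
    (hxy : CeramiControlled M B Φ C x y) (hyz : CeramiControlled M B Φ C y z)
    (h1 : Φ y ≤ Φ x) (h2 : Φ z ≤ Φ y) : CeramiControlled M B Φ C x z := by
  have hN : 0 ≤ (Nfun M B x).toReal := ENNReal.toReal_nonneg
  have hNy : 0 ≤ (Nfun M B y).toReal := ENNReal.toReal_nonneg
  have e1 : 1 ≤ Real.exp (C * (Φ x - Φ y)) :=
    Real.one_le_exp (mul_nonneg hC (sub_nonneg.2 h1))
  have e2 : 1 ≤ Real.exp (C * (Φ y - Φ z)) :=
    Real.one_le_exp (mul_nonneg hC (sub_nonneg.2 h2))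
  have e3 : Real.exp (C * (Φ x - Φ z)) =
      Real.exp (C * (Φ x - Φ y)) * Real.exp (C * (Φ y - Φ z)) := by
    rw [← Real.exp_add]; ring_nf
  have hy := hxy.one_add_Nfun_le hC hx h1
  refine (mdist_triangle x y z).trans ((add_le_add hxy hyz).trans ?_)
  rw [← ENNReal.ofReal_add (mul_nonneg (by linarith) (by linarith))
    (mul_nonneg (by linarith) (by linarith))]
  refine ENNReal.ofReal_le_ofReal ?_
  rw [e3]
  nlinarith [mul_le_mul_of_nonneg_right hy (sub_nonneg.2 e2)]

theorem CeramiControlled.refl {C : ℝ} {x : X} (hx : x ∈ M) : CeramiControlled M B Φ C x x := by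
  simp [CeramiControlled, mdist_self hx]

/-- In a complete region, a sequence that is controlled in the sense of `CeramiControlled`, and
along which `Φ` decreases and stays bounded below, converges. -/
theorem exists_tendsto_of_ceramiControlled (hB : IsAdmissible B) (hM0 : (0 : X) ∉ M) {a b C : ℝ}
    (hC : 0 ≤ C) (hcomp : IsCompleteFor M B {u ∈ M | a ≤ Φ u ∧ Φ u ≤ b}) {x : ℕ → X}
    (hxM : ∀ n, x n ∈ M) (ha : ∀ n, a ≤ Φ (x n)) (hb : ∀ n, Φ (x n) ≤ b)
    (hΦ : ∀ n, Φ (x (n + 1)) ≤ Φ (x n)) (hx : ∀ n, CeramiControlled M B Φ C (x n) (x (n + 1))) :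
    ∃ u ∈ M, Tendsto x atTop (𝓝 u) := by
  have hanti : Antitone fun n => Φ (x n) := antitone_nat_of_succ_le hΦ
  have hctrl : ∀ m k, CeramiControlled M B Φ C (x m) (x (m + k)) := by
    intro m k
    induction k with
    | zero => exact .refl (hxM m)
    | succ k ih => exact ih.trans hC (hxM m) (hx (m + k)) (hanti (Nat.le_add_right m k)) (hΦ _)
  have hbdd : BddBelow (range fun n => Φ (x n)) := ⟨a, by rintro _ ⟨n, rfl⟩; exact ha n⟩
  have hlim := tendsto_atTop_ciInf hanti hbdd
  set l := ⨅ n, Φ (x n)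
  have hl : ∀ n, l ≤ Φ (x n) := fun n => ciInf_le hbdd n
  have hN : ∀ n, 0 ≤ (Nfun M B (x n)).toReal := fun n => ENNReal.toReal_nonneg
  set A := (1 + (Nfun M B (x 0)).toReal) * Real.exp (C * (Φ (x 0) - l))
  have hA : ∀ n, 1 + (Nfun M B (x n)).toReal ≤ A := by
    intro n
    have h0 := hctrl 0 n
    rw [zero_add] at h0
    refine (h0.one_add_Nfun_le hC (hxM 0) (hanti (Nat.zero_le n))).trans ?_
    exact mul_le_mul_of_nonneg_left (Real.exp_le_exp.2
      (mul_le_mul_of_nonneg_left (by linarith [hl n]) hC)) (by linarith [hN 0])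
  let β : ℕ → ℝ≥0∞ := fun n => ENNReal.ofReal (A * (Real.exp (C * (Φ (x n) - l)) - 1))
  have hβ : Tendsto β atTop (𝓝 0) := by
    have h1 : Tendsto (fun n => A * (Real.exp (C * (Φ (x n) - l)) - 1)) atTop
        (𝓝 (A * (Real.exp (C * (l - l)) - 1))) := by
      refine Tendsto.const_mul _ (Tendsto.sub_const ?_ _)
      exact (Real.continuous_exp.tendsto _).comp ((hlim.sub_const l).const_mul C)
    simpa using ENNReal.tendsto_ofReal h1
  have hdist : ∀ m n, m ≤ n → mdist M B (x m) (x n) ≤ β m := by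
    intro m n hmn
    obtain ⟨k, rfl⟩ := Nat.exists_eq_add_of_le hmn
    refine le_trans (hctrl m k) (ENNReal.ofReal_le_ofReal ?_)
    have h1 := hl (m + k)
    have h2 : 1 ≤ Real.exp (C * (Φ (x m) - Φ (x (m + k)))) :=
      Real.one_le_exp (mul_nonneg hC (sub_nonneg.2 (hanti (Nat.le_add_right m k))))
    have h3 := hN m
    have h4 := hA m
    have h5 : Real.exp (C * (Φ (x m) - Φ (x (m + k)))) ≤ Real.exp (C * (Φ (x m) - l)) := by
      gcongr
    exact mul_le_mul h4 (by linarith) (by linarith) (by linarith)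
  obtain ⟨u, hu, hulim⟩ := hcomp x (fun n => ⟨hxM n, ha n, hb n⟩) fun ε hε => by
    obtain ⟨n₀, hn₀⟩ := eventually_atTop.1 (hβ.eventually (gt_mem_nhds hε))
    refine ⟨n₀, fun m hm n hn => ?_⟩
    rcases le_total m n with hmn | hmn
    · exact (hdist m n hmn).trans_lt (hn₀ m hm)
    · rw [mdist_comm]
      exact (hdist n m hmn).trans_lt (hn₀ n hn)
  refine ⟨u, hu.1, hB.tendsto_of_mdist (M := M) (ne_of_mem_of_not_mem hu.1 hM0) ?_⟩
  simpa only [mdist_comm] using hulim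

theorem neg_mem_tangentSpaceAt (hM : IsC11Submanifold M) {u v : X} (hu : u ∈ M)
    (hv : v ∈ tangentSpaceAt M u) : -v ∈ tangentSpaceAt M u := by
  obtain ⟨e, E, he, hue⟩ := hM.exists_straightening hu
  rw [he.mem_tangentSpaceAt_iff hue hu] at hv ⊢
  rw [map_neg]
  exact E.neg_mem hv

namespace IsEquivariantSetting

variable {G : Type*} [Group G] [DistribMulAction G X]

/-- The local deformation in the direction of `-∇Φ(u)`, with the two controls that the Cerami
condition provides. -/
theorem exists_descent_at (h : IsEquivariantSetting G B M Φ) {ψ : X → ℝ} {r C δ : ℝ} (hC : 0 < C)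
    (hδ : 0 < δ)
    (hψ : ∀ x ∈ M, ∀ y ∈ M, ∀ a : ℝ, 0 ≤ a →
      mdist M (EquivariantLS.symmetrize B) x y ≤ ENNReal.ofReal a → |ψ x - ψ y| ≤ a)
    {u p : X} (hu : u ∈ M)
    (hψu : (1 + (Nfun M B u).toReal ≤ C ∧
          ∀ x, normAt (EquivariantLS.symmetrize B) u x ≤ C * normAt B u x) ∨
        ∀ᶠ w in 𝓝[M] u, ψ w = r)
    (hp : IsGradient M B Φ u p) (hδp : δ ≤ normAt B u p * (1 + (Nfun M B u).toReal)) :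
    ∃ H : ℝ → M → M, (Continuous fun q : ℝ × M => H q.1 q.2) ∧ (∀ x, H 0 x = x) ∧
      (∀ (t : ℝ) (x : M), CeramiControlled M B Φ (2 / δ) x (H t x) ∧
        |ψ x - ψ (H t x)| ≤ 2 * C ^ 2 / δ * (Φ x - Φ (H t x))) ∧
      (∀ (t : ℝ) (x : M), H t x = x ∨ Φ (H t x) < Φ x) ∧
      {x : M | Φ (H 1 x) < Φ x} ∈ 𝓝 (⟨u, hu⟩ : M) := by
  set S := EquivariantLS.symmetrize B
  set a := normAt B u p
  set n := 1 + (Nfun M B u).toReal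
  have hn : 1 ≤ n := le_add_of_nonneg_right ENNReal.toReal_nonneg
  have ha : 0 < a := by
    by_contra hcon
    have := normAt_nonneg B u p
    nlinarith
  set m := 3 / 4 * a ^ 2
  have hm0 : 0 < m := by positivity
  set L := 2 * C ^ 2 / δ
  have hwn : ∀ B' : X → LinearMap.BilinForm ℝ X, normAt B' u (-p) = normAt B' u p := fun B' => by
    simp [normAt]
  -- The factors `3/4`, `5/4` and `5/6` leave room for the variation of `Φ`, of the norms and of `N`
  -- near `u`: they enter through `5/4 * a ≤ 5/6 * n * (2 / δ) * m`, which holds as `δ ≤ a * n`.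
  have hd : m < -differential M Φ u (-p) := by
    rw [map_neg, neg_neg, hp.2 p hp.1, ← h.adm.sq_normAt (h.ne_zero hu)]
    simp only [m, a]
    nlinarith [pow_pos ha 2]
  -- The control of `ψ`, in each of the two cases.
  obtain ⟨l₂, W, hl₂, hW, hWψ⟩ : ∃ (l₂ : ℝ) (W : Set X), normAt S u (-p) < l₂ ∧ W ∈ 𝓝 u ∧
      ∀ x ∈ M, ∀ y ∈ M, x ∈ W → y ∈ W → ∀ s, 0 ≤ s → mdist M S x y ≤ ENNReal.ofReal (l₂ * s) →
        |ψ x - ψ y| ≤ L * (m * s) := by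
    rcases hψu with ⟨hnC, hS⟩ | hconst
    · refine ⟨L * m, univ, ?_, univ_mem, fun x hx y hy _ _ s hs hxy => ?_⟩
      · rw [hwn]
        refine (hS p).trans_lt ?_
        have h1 : δ ≤ a * C := hδp.trans (by gcongr)
        rw [show L * m = 3 / 2 * C * a * (a * C) / δ by simp only [L, m]; ring, lt_div_iff₀ hδ]
        have h2 : 0 < C * a := mul_pos hC ha
        have h3 : C * a * δ ≤ C * a * (a * C) := by gcongr
        nlinarith [mul_pos h2 hδ]
      · rw [← mul_assoc]
        exact hψ x hx y hy _ (by positivity) hxy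
    · refine ⟨normAt S u (-p) + 1, {v | v ∈ M → ψ v = r}, lt_add_one _,
        eventually_nhdsWithin_iff.1 hconst, fun x hx y hy hxW hyW s hs _ => ?_⟩
      rw [hxW hx, hyW hy, sub_self, abs_zero]
      positivity
  have hWN : {v | v ∈ M → 5 / 6 * n < 1 + (Nfun M B v).toReal} ∈ 𝓝 u := by
    refine eventually_nhdsWithin_iff.1 ?_
    have hc : ContinuousWithinAt (fun v => 1 + (Nfun M B v).toReal) M u :=
      continuousWithinAt_const.add (h.continuousOn_toReal_Nfun u hu)
    exact hc.eventually (lt_mem_nhds (by linarith : 5 / 6 * n < n))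
  obtain ⟨H, hHc, hH0, hH, hHu⟩ := exists_local_deformation h.subm h.zero_notMem h.c11 h.adm
    h.symmetrize.adm hu (neg_mem_tangentSpaceAt h.subm hu hp.1) hm0 hd (l₁ := 5 / 4 * a)
    (by rw [hwn]; linarith) hl₂ (inter_mem hW hWN)
  refine ⟨H, hHc, hH0, fun t x => ?_, fun t x => ?_, hHu⟩
  · rcases hH t x with heq | ⟨s, hs, hs1, hs2, hs3, hs4, hs5⟩
    · rw [heq]
      exact ⟨.refl x.2, by simp⟩
    · have hdrop : m * s ≤ Φ x - Φ (H t x) := by linarith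
      constructor
      · refine hs2.trans (ENNReal.ofReal_le_ofReal ?_)
        have hNx : 5 / 6 * n < 1 + (Nfun M B x).toReal := hs4.2 x.2
        have he : 2 / δ * (m * s) ≤ Real.exp (2 / δ * (Φ x - Φ (H t x))) - 1 := by
          have h1 : 2 / δ * (m * s) ≤ 2 / δ * (Φ x - Φ (H t x)) := by gcongr
          have h2 := Real.add_one_le_exp (2 / δ * (Φ x - Φ (H t x)))
          linarith
        calc 5 / 4 * a * s ≤ 5 / 6 * n * (2 / δ * (m * s)) := by
              rw [show 5 / 6 * n * (2 / δ * (m * s)) = 5 / 4 * a * s * (a * n) / δ by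
                simp only [m]; ring, le_div_iff₀ hδ]
              gcongr
          _ ≤ _ := by
              refine mul_le_mul hNx.le he (by positivity) (by linarith)
      · refine (hWψ x x.2 _ (H t x).2 hs4.1 hs5.1 s hs.le hs3).trans ?_
        gcongr
  · rcases hH t x with heq | ⟨s, hs, hs1, -⟩
    · exact Or.inl heq
    · exact Or.inr (by nlinarith [mul_pos hm0 hs])

/-- Passing a level `c` increases the genus of the sublevel sets at most by a finite number, and not
at all if there are no critical points at the level `c`. -/
theorem exists_genus_sublevel_le [CompleteSpace X] [SMulCommClass G ℝ X]
    (h : IsEquivariantSetting G B M Φ) (hG : SeqClosedOrbits G X) {a b c : ℝ} (hac : a < c)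
    (hcb : c < b) (hcomp : IsCompleteFor M B {u ∈ M | a ≤ Φ u ∧ Φ u ≤ b})
    (hNCG : NCeramiCondition G M B Φ c) (hI : ∀ u ∈ criticalSetAt M Φ c, ∀ g : G, g • u ≠ -u) :
    ∃ ε > 0, ∃ m : ℕ, genus (sublevel M Φ (c + ε)) ≤ genus (sublevel M Φ (c - ε)) + m ∧
      (criticalSetAt M Φ c = ∅ → m = 0) := by
  obtain ⟨ψ, r, C, m, hr, hC, hψneg, hψG, hψK, hψ, hψc, hψu, hgen, hm⟩ :=
    h.exists_cutoff hG hNCG hI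
  obtain ⟨ε₀, hε₀, δ, hδ, hslope⟩ := h.exists_slope_bound hNCG hψc hψG hψK (half_pos hr)
  set L := 2 * C ^ 2 / δ
  -- On `s` the level is within `ε` of `c`; the choice of `ε` ensures that `ψ` varies by less than
  -- `r / 2` while `Φ` drops by `2 ε`.
  have hL : 0 < L := by positivity
  obtain ⟨ε, hε, hεlt⟩ : ∃ ε > 0, ε < min (min ε₀ (r / 8 / L)) (min (c - a) (b - c)) :=
    exists_between (lt_min (lt_min hε₀ (by positivity))
      (lt_min (sub_pos.2 hac) (sub_pos.2 hcb)))
  obtain ⟨⟨hε1, hε2⟩, hε3, hε4⟩ : (ε < ε₀ ∧ ε < r / 8 / L) ∧ ε < c - a ∧ ε < b - c := by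
    simpa [lt_min_iff] using hεlt
  have hLε : L * (2 * ε) < r / 2 := by
    rw [lt_div_iff₀ hL] at hε2
    linarith
  have hΦc : Continuous fun x : M => Φ x :=
    continuousOn_iff_continuous_domRestrict.1 h.c11.continuousOn
  have hψc' : Continuous fun x : M => ψ x := continuousOn_iff_continuous_domRestrict.1 hψc
  let s : Set M := {x | c - ε ≤ Φ x ∧ Φ x ≤ c + ε ∧ r / 2 ≤ ψ x}
  have hs : IsClosed s :=
    (isClosed_le continuous_const hΦc).inter ((isClosed_le hΦc continuous_const).inter
      (isClosed_le continuous_const hψc'))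
  -- The relation `W` bounds the variation of `ψ` by the drop of `Φ`.
  let W : M → M → Prop := fun x y => |ψ x - ψ y| ≤ L * (Φ x - Φ y)
  have hWΦ : ∀ x y, W x y → Φ y ≤ Φ x := fun x y hxy => by
    have : 0 ≤ L * (Φ x - Φ y) := (abs_nonneg _).trans hxy
    nlinarith [nonneg_of_mul_nonneg_right this hL]
  have hWtrans : ∀ x y z, W x y → W y z → W x z := fun x y z hxy hyz => by
    have := (abs_sub_le (ψ x) (ψ y) (ψ z)).trans (add_le_add hxy hyz)
    exact this.trans_eq (by ring)
  let neg : M → M := fun x => ⟨-x, h.neg_mem x x.2⟩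
  obtain ⟨P, hPc, hPodd, hPz⟩ := exists_odd_map_of_local_descent (α := M) (Φ := fun x => Φ x) hs
    (Q := fun x y => CeramiControlled M B Φ (2 / δ) x y ∧ W x y) (W := W)
    (fun x => ⟨.refl x.2, by simp [W]⟩)
    (fun x y z hxy hyz => ⟨hxy.1.trans (by positivity) x.2 hyz.1 (hWΦ _ _ hxy.2)
      (hWΦ _ _ hyz.2), hWtrans _ _ _ hxy.2 hyz.2⟩)
    hWtrans (fun x y hxy => hxy.2) (neg := neg)
    (continuous_subtype_val.neg.subtype_mk _) (fun x => Subtype.ext (neg_neg (x : X)))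
    (fun x hx => h.ne_zero x.2 (by
      have h2 : (2 : ℝ) • (x : X) = 0 := by
        rw [two_smul, add_eq_zero_iff_eq_neg]
        exact (congrArg Subtype.val hx).symm
      simpa using h2))
    (fun x y hxy => by
      simpa only [W, neg, hψneg, h.even x x.2, h.even y y.2] using hxy)
    (fun u hu => by
      obtain ⟨p, hp⟩ := exists_isGradient h.subm h.zero_notMem h.adm Φ u.2
      exact h.exists_descent_at hC hδ hψ u.2 (hψu u u.2) hp
        (hslope u u.2 (abs_le.2 ⟨by linarith [hu.1], by linarith [hu.2.1]⟩) hu.2.2 p hp))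
    (fun x hxs hxQ => by
      obtain ⟨y, hyM, hy⟩ := exists_tendsto_of_ceramiControlled h.adm h.zero_notMem
        (C := 2 / δ) (by positivity) hcomp (x := fun n => (x n : X)) (fun n => (x n).2)
        (fun n => by linarith [(hxs n).1]) (fun n => by linarith [(hxs n).2.1])
        (fun n => hWΦ _ _ (hxQ n).2) (fun n => (hxQ n).1)
      exact ⟨⟨y, hyM⟩, tendsto_subtype_rng.2 hy⟩)
  refine ⟨ε, hε, m, ?_, hm⟩
  -- The odd deformation maps the upper sublevel set to the union of the lower one and of the
  -- neighborhood of the critical set.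
  let A : Set X := {u ∈ M | Φ u < c - ε ∨ ψ u < r}
  have hPA : ∀ x : M, Φ x ≤ c + ε → (P x : X) ∈ A := by
    intro x hx
    obtain ⟨z, hzs, hxz, hzP⟩ := hPz x
    refine ⟨(P x).2, ?_⟩
    have h1 := hWΦ _ _ hxz
    have h2 := hWΦ _ _ hzP
    by_contra! hcon
    refine hzs ⟨by linarith [hcon.1], by linarith, ?_⟩
    have h3 : |ψ z - ψ (P x)| ≤ L * (2 * ε) := by
      refine le_trans hzP ?_
      gcongr
      linarith [hcon.1]
    have h4 := (abs_le.1 h3).1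
    linarith [hcon.2]
  classical
  let P' : X → X := fun x => if hx : x ∈ M then P ⟨x, hx⟩ else x
  have hP' : ∀ x (hx : x ∈ M), P' x = P ⟨x, hx⟩ := fun x hx => dif_pos hx
  have hle : genus (sublevel M Φ (c + ε)) ≤ genus A := by
    refine genus_le_of_odd_map (P := P') ?_ (fun x hx => ?_) fun x hx => ?_
    · have : ContinuousOn P' M := by
        rw [continuousOn_iff_continuous_domRestrict]
        refine (continuous_subtype_val.comp hPc).congr fun x => ?_
        exact (hP' x x.2).symm
      exact this.mono (sep_subset _ _)
    · rw [hP' x hx.1]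
      exact hPA ⟨x, hx.1⟩ hx.2
    · rw [hP' x hx.1, hP' (-x) (h.neg_mem x hx.1)]
      exact congrArg Subtype.val (hPodd ⟨x, hx.1⟩)
  have hAM : A ⊆ M := sep_subset _ _
  refine hle.trans ((genus_le_add (A₁ := sublevel M Φ (c - ε)) (A₂ := {u ∈ M | ψ u < r})
    (a₁ := fun u => max 0 (c - ε - Φ u)) (a₂ := fun u => max 0 (r - ψ u)) ?_ ?_ ?_ ?_ ?_ ?_
    ?_).trans (by gcongr))
  · exact (continuous_const.max continuous_id).comp_continuousOn
      ((continuousOn_const.sub h.c11.continuousOn).mono hAM)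
  · exact (continuous_const.max continuous_id).comp_continuousOn
      ((continuousOn_const.sub hψc).mono hAM)
  · intro x hx
    simp only [h.even x hx.1]
  · intro x _
    simp only [hψneg]
  · intro x hx hne
    refine ⟨hx.1, ?_⟩
    by_contra hlt
    exact hne (max_eq_left (by linarith))
  · intro x hx hne
    refine ⟨hx.1, ?_⟩
    by_contra hlt
    exact hne (max_eq_left (by linarith))
  · intro x hx
    rcases hx.2 with hlt | hlt
    · exact Or.inl (lt_max_of_lt_right (by linarith)).ne'
    · exact Or.inr (lt_max_of_lt_right (by linarith)).ne'

end IsEquivariantSetting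

end

/-! ### The Ljusternik-Schnirelmann values -/

section

variable {X : Type*} [NormedAddCommGroup X] {M : Set X} {Φ : X → ℝ}

theorem genus_sublevel_mono {c c' : ℝ} (hcc : c ≤ c') :
    genus (sublevel M Φ c) ≤ genus (sublevel M Φ c') :=
  genus_mono fun _ hx => ⟨hx.1, hx.2.trans hcc⟩

theorem lsValue_mono : Monotone (lsValue M Φ) := fun _ _ hjk =>
  le_iInf₂ fun c hc => iInf₂_le c ((Nat.cast_le (α := ℕ∞).2 hjk).trans hc)

theorem lsValue_le {k : ℕ} {c : ℝ} (h : (k : ℕ∞) ≤ genus (sublevel M Φ c)) :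
    lsValue M Φ k ≤ c :=
  iInf₂_le c h

theorem le_lsValue {k : ℕ} {c : ℝ} (h : genus (sublevel M Φ c) < k) :
    (c : EReal) ≤ lsValue M Φ k := by
  refine le_iInf₂ fun c' hc' => EReal.coe_le_coe_iff.2 ?_
  by_contra! hlt
  exact (hc'.trans (genus_sublevel_mono hlt.le)).not_gt h

theorem le_genus_of_lsValue_lt {k : ℕ} {c : ℝ} (h : lsValue M Φ k < c) :
    (k : ℕ∞) ≤ genus (sublevel M Φ c) := by
  by_contra! hlt
  exact (le_lsValue hlt).not_gt h

theorem genus_lt_of_lt_lsValue {k : ℕ} {c : ℝ} (h : (c : EReal) < lsValue M Φ k) :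
    genus (sublevel M Φ c) < k := by
  by_contra! hle
  exact (lsValue_le hle).not_gt h

theorem exists_real_between {c : ℝ} {d : EReal} (h : (c : EReal) < d) :
    ∃ b : ℝ, c < b ∧ (b : EReal) < d := by
  obtain ⟨b, hb1, hb2⟩ := EReal.lt_iff_exists_real_btwn.1 h
  exact ⟨b, EReal.coe_lt_coe_iff.1 hb1, hb2⟩

theorem lt_lsValue {cStar : ℝ} {kStar k : ℕ} (hk : kStar < k)
    (hkStar : Tendsto (fun c : ℝ => genus (sublevel M Φ c)) (𝓝[>] cStar) (𝓝 (kStar : ℕ∞))) :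
    (cStar : EReal) < lsValue M Φ k := by
  obtain ⟨c, hc, hcStar⟩ := ((hkStar.eventually (gt_mem_nhds (Nat.cast_lt.2 hk))).and
    self_mem_nhdsWithin).exists
  exact (EReal.coe_lt_coe_iff.2 hcStar).trans_le (le_lsValue hc)

theorem lsValue_lt {cStar : ℝ} {cInf : EReal} (hc : (cStar : EReal) < cInf)
    (hgenus : Tendsto (fun c : ℝ => genus (sublevel M Φ c))
      (Filter.comap (fun c : ℝ => (c : EReal)) (𝓝[<] cInf)) (𝓝 (⊤ : ℕ∞))) (k : ℕ) :
    lsValue M Φ k < cInf := by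
  have hne : (Filter.comap (fun c : ℝ => (c : EReal)) (𝓝[<] cInf)).NeBot := by
    refine comap_neBot fun t ht => ?_
    obtain ⟨l, hl, hlt⟩ := (mem_nhdsLT_iff_exists_Ioo_subset' hc).1 ht
    obtain ⟨b, hb1, hb2⟩ := EReal.lt_iff_exists_real_btwn.1 hl
    exact ⟨b, hlt ⟨hb1, hb2⟩⟩
  obtain ⟨c, hck, hcInf⟩ := ((hgenus.eventually (lt_mem_nhds (ENat.natCast_lt_top k))).and
    (preimage_mem_comap self_mem_nhdsWithin)).exists
  exact (lsValue_le hck.le).trans_lt hcInf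

end

end EquivariantLS

theorem mainTheorem6
    {X : Type*} [NormedAddCommGroup X] [InnerProductSpace ℝ X] [CompleteSpace X]
    {G : Type*} [Group G] [TopologicalSpace G] [IsTopologicalGroup G]
    [DistribMulAction G X] [SMulCommClass G ℝ X]
    (B : X → LinearMap.BilinForm ℝ X)
    (hB : ∀ u : X, u ≠ 0 → IsScalarProduct (B u))
    (hBequiv : LocallyUniformlyEquivalent B)
    (hBlip : LocallyLipschitzFamily B)
    (hBinv : ∀ (g : G) (u v w : X), u ≠ 0 → v ≠ 0 → w ≠ 0 →
      B (g • u) (g • v) (g • w) = B u v w)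
    (M : Set X) (hM : IsC11Submanifold M) (hM0 : (0 : X) ∉ M)
    (hMsymm : ∀ u ∈ M, -u ∈ M) (hMinv : ∀ (g : G), ∀ u ∈ M, g • u ∈ M)
    (Φ : X → ℝ) (hΦ : IsC11OnManifold M Φ)
    (hΦeven : ∀ u ∈ M, Φ (-u) = Φ u) (hΦinv : ∀ (g : G), ∀ u ∈ M, Φ (g • u) = Φ u)
    (hG : SeqClosedOrbits G X)
    (cStar : ℝ) (cInf : EReal) (hc : (cStar : EReal) < cInf)
    (hcomplete : ∀ c : ℝ, (c : EReal) < cInf →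
      IsCompleteFor M B {u ∈ M | cStar ≤ Φ u ∧ Φ u ≤ c})
    (kStar : ℕ)
    (hkStar : Tendsto (fun c : ℝ => genus (sublevel M Φ c)) (𝓝[>] cStar) (𝓝 (kStar : ℕ∞)))
    (hgenus : Tendsto (fun c : ℝ => genus (sublevel M Φ c))
      (Filter.comap (fun c : ℝ => (c : EReal)) (𝓝[<] cInf)) (𝓝 (⊤ : ℕ∞)))
    (hNCG : ∀ c : ℝ, cStar ≤ c → (c : EReal) < cInf → NCeramiCondition G M B Φ c)
    (hI : ∀ c : ℝ, cStar ≤ c → (c : EReal) < cInf →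
      ∀ u ∈ criticalSetAt M Φ c, ∀ g : G, g • u ≠ -u) :
    (∀ k : ℕ, kStar < k →
      (cStar : EReal) < lsValue M Φ k ∧ lsValue M Φ k ≤ lsValue M Φ (k + 1) ∧
        lsValue M Φ k < cInf) ∧
    Tendsto (fun k => lsValue M Φ k) atTop (𝓝 cInf) ∧
    (∀ k : ℕ, kStar < k → ∃ u ∈ criticalSet M Φ, (Φ u : EReal) = lsValue M Φ k) ∧
    (∃ u : ℕ → X, (∀ k, u k ∈ criticalSet M Φ ∧ -u k ∈ criticalSet M Φ) ∧
      (∀ j k, j ≠ k → u j ≠ u k ∧ u j ≠ -u k) ∧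
      Tendsto (fun k => (Φ (u k) : EReal)) atTop (𝓝 cInf)) := by
  have h : IsEquivariantSetting G B M Φ :=
    { adm := ⟨hB, hBequiv, hBlip⟩
      form_smul := hBinv
      subm := hM
      zero_notMem := hM0
      neg_mem := hMsymm
      smul_mem := hMinv
      c11 := hΦ
      even := hΦeven
      invariant := hΦinv }
  have hlt : ∀ k, lsValue M Φ k < cInf := lsValue_lt hc hgenus
  have hgt : ∀ k, kStar < k → (cStar : EReal) < lsValue M Φ k := fun k hk =>
    lt_lsValue hk hkStar
  -- Completeness up to a level `b` above `c` makes the deformation theorem applicable at `c`.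
  have hpass : ∀ c : ℝ, cStar < c → (c : EReal) < cInf → ∃ ε > 0, ∃ m : ℕ,
      genus (sublevel M Φ (c + ε)) ≤ genus (sublevel M Φ (c - ε)) + m ∧
        (criticalSetAt M Φ c = ∅ → m = 0) := by
    intro c hc1 hc2
    obtain ⟨b, hcb, hb⟩ := exists_real_between hc2
    exact h.exists_genus_sublevel_le hG hc1 hcb (hcomplete b hb) (hNCG c hc1.le hc2)
      (hI c hc1.le hc2)
  have hcrit : ∀ k, kStar < k → ∃ u ∈ criticalSet M Φ, (Φ u : EReal) = lsValue M Φ k := by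
    intro k hk
    obtain ⟨c, hck⟩ : ∃ c : ℝ, (c : EReal) = lsValue M Φ k :=
      ⟨_, EReal.coe_toReal ((hlt k).trans_le le_top).ne (bot_le.trans_lt (hgt k hk)).ne'⟩
    obtain ⟨ε, hε, m, hle, hm⟩ := hpass c (EReal.coe_lt_coe_iff.1 (hck ▸ hgt k hk))
      (hck ▸ hlt k)
    rw [← hck]
    by_contra! hcon
    have hempty : criticalSetAt M Φ c = ∅ := eq_empty_of_forall_notMem fun u hu =>
      hcon u hu.1 (congrArg _ hu.2)
    rw [hm hempty, Nat.cast_zero, add_zero] at hle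
    have h1 := genus_lt_of_lt_lsValue (M := M) (Φ := Φ) (k := k) (c := c - ε)
      (hck ▸ EReal.coe_lt_coe_iff.2 (sub_lt_self c hε))
    have h2 := le_genus_of_lsValue_lt (M := M) (Φ := Φ) (k := k) (c := c + ε)
      (hck ▸ EReal.coe_lt_coe_iff.2 (lt_add_of_pos_right c hε))
    exact (h2.trans hle).not_gt h1
  have hlim : Tendsto (fun k => lsValue M Φ k) atTop (𝓝 cInf) := by
    have hsup := tendsto_atTop_iSup (lsValue_mono (M := M) (Φ := Φ))
    suffices hs : ⨆ k, lsValue M Φ k = cInf by rwa [hs] at hsup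
    refine (iSup_le fun k => (hlt k).le).antisymm (le_of_not_gt fun hs => ?_)
    have hgs := (hgt _ kStar.lt_succ_self).trans_le (le_iSup (lsValue M Φ) (kStar + 1))
    obtain ⟨c, hcs⟩ : ∃ c : ℝ, (c : EReal) = ⨆ k, lsValue M Φ k :=
      ⟨_, EReal.coe_toReal (hs.trans_le le_top).ne (bot_le.trans_lt hgs).ne'⟩
    rw [← hcs] at hs hgs
    obtain ⟨ε, hε, m, hle, -⟩ := hpass c (EReal.coe_lt_coe_iff.1 hgs) hs
    obtain ⟨k, hk⟩ := lt_iSup_iff.1 (hcs ▸ EReal.coe_lt_coe_iff.2 (sub_lt_self c hε) :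
      ((c - ε : ℝ) : EReal) < ⨆ k, lsValue M Φ k)
    have h1 := genus_lt_of_lt_lsValue hk
    have h2 := le_genus_of_lsValue_lt (M := M) (Φ := Φ) (k := k + m) (c := c + ε)
      ((hcs ▸ le_iSup (lsValue M Φ) (k + m)).trans_lt
        (EReal.coe_lt_coe_iff.2 (lt_add_of_pos_right c hε)))
    rw [Nat.cast_add] at h2
    exact (h2.trans hle).not_gt (WithTop.add_lt_add_right (ENat.natCast_ne_top m) h1)
  refine ⟨fun k hk => ⟨hgt k hk, lsValue_mono k.le_succ, hlt k⟩, hlim, hcrit, ?_⟩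
  -- As no value `c_k` attains the limit, they have a strictly increasing subsequence.
  have hnext : ∀ k, ∃ l > k, lsValue M Φ k < lsValue M Φ l := fun k =>
    ((eventually_gt_atTop k).and (hlim.eventually (lt_mem_nhds (hlt k)))).exists
  choose next hnext1 hnext2 using hnext
  let κ : ℕ → ℕ := fun n => next^[n] (kStar + 1)
  have hκ : ∀ n, κ (n + 1) = next (κ n) := fun n => Function.iterate_succ_apply' next n _
  have hκmono : StrictMono κ := strictMono_nat_of_lt_succ fun n => by
    rw [hκ]
    exact hnext1 _
  have hvmono : StrictMono fun n => lsValue M Φ (κ n) := strictMono_nat_of_lt_succ fun n => by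
    rw [hκ]
    exact hnext2 _
  choose! u hu huΦ using hcrit
  have hκk : ∀ n, kStar < κ n := fun n =>
    kStar.lt_succ_self.trans_le (hκmono.monotone (Nat.zero_le n))
  have hne : ∀ i j, i ≠ j → Φ (u (κ i)) ≠ Φ (u (κ j)) := fun i j hij heq => by
    have := congrArg (fun r : ℝ => (r : EReal)) heq
    simp only [huΦ _ (hκk _)] at this
    exact hij (hvmono.injective this)
  refine ⟨fun n => u (κ n), fun n => ⟨hu _ (hκk n), h.neg_mem_criticalSet (hu _ (hκk n))⟩,
    fun i j hij => ⟨fun heq => hne i j hij (congrArg Φ heq), fun heq => hne i j hij ?_⟩, ?_⟩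
  · exact (congrArg Φ heq).trans (hΦeven _ (hu _ (hκk j)).1)
  · simp only [huΦ _ (hκk _)]
    exact hlim.comp hκmono.tendsto_atTop
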